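/- Let $R$ be an associative unital ring, not necessarily commutative, that is free as a $\mathbb{Z}$-module, with a $\mathbb{Z}$-basis $I$ (possibly infinite) containing $1$. **The algebra.** Let $\Lambda=\mathbb{Z}[e_1,e_2,\dots]$ be the ring of symmetric functions, with power sums $p_l$ and Schur functions $s_\lambda$; let $\Lambda^{(U)}$, $U\in I$, be copies of $\Lambda$ and write $f^{(U)}$ for $f\in\Lambda$ in the copy $U$. A multipartition is a family $\lambda=(\lambda(U))_{U\in I}$ of partitions, almost all empty, and $s_\lambda=\prod_{U}s_{\lambda(U)}^{(U)}$. Let $\mathcal{G}^{\mathbb{Q}}=\bigotimes_{l\ge1}\mathcal{U}(\mathbb{Q}\otimes R)$ (restricted tensor product of enveloping algebras of $\mathbb{Q}\otimes R$ with the commutator bracket), and let $T_l:\mathbb{Q}\otimes R\to\mathcal{G}^{\mathbb{Q}}$ be the inclusion into the $l$-th factor. It is a Hopf algebra in which all $T_l(r)$ are primitive. There is exactly one family $(Z_\lambda)$ in $\mathcal{G}^{\mathbb{Q}}$, indexed by multipartitions, with $$\sum_{\lambda}s_\lambda\otimes Z_\lambda=\prod_{l\ge1}\exp\Big(T_l\Big(\log\Big(1+\sum_{U\in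 I}p_l^{(U)}\,U\Big)\Big)\Big).$$ The $Z_\lambda$ form a $\mathbb{Z}$-basis of a subring $\mathcal{G}=\mathcal{G}_\infty^{\mathbb{Z}}(R)$ of $\mathcal{G}^{\mathbb{Q}}$, and the comultiplication, counit and antipode of $\mathcal{G}^{\mathbb{Q}}$ restrict to a Hopf algebra structure over $\mathbb{Z}$ on $\mathcal{G}$. **Its dual.** Let $Q=\mathcal{G}^*=\mathrm{Hom}_{\mathbb{Z}}(\mathcal{G},\mathbb{Z})$ be the full dual with the dual structure: the product dual to the comultiplication, unit the counit of $\mathcal G$, comultiplication $Q\to(\mathcal{G}\otimes\mathcal{G})^*=Q\,\widehat\otimes\,Q$ dual to the product, counit $\varphi\mapsto\varphi(1)$, and antipode dual to the antipode. Then $$\varphi\longmapsto\sum_\lambda\varphi(Z_\lambda)\,s_\lambda$$ is a ring isomorphism from $Q$ onto the power series ring $\mathbb{Z}[[e_n^{(U)}: U\in I,\ n\ge1]]$. **The formal group.** For a commutative ring $A$ let $W(A)=\mathrm{Hom}_{\mathrm{alg}}(\Lambda,A)$ be the ring of big Witt vectors, an element being the sequence $(a_1,a_2,\dots)$ of the images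 of $e_1,e_2,\dots$; addition is induced by $e_n\mapsto\sum_{i=0}^n e_i\otimes e_{n-i}$ and multiplication by $e_n\mapsto e_n(\{x_iy_j\}_{i,j})=\sum_{\mu\vdash n}s_\mu\otimes s_{\mu'}$. Let $\widehat W(A)\subset W(A)$ be the ideal of sequences whose entries are nilpotent and almost all zero. The formal neighbourhood of the identity in $(W\otimes_{\mathbb{Z}}R)^\times$ is the group-valued functor $$F(A)=\{u\in(W(A)\otimes_{\mathbb{Z}}R)^\times:\ u-1\in\widehat W(A)\otimes_{\mathbb{Z}}R\},$$ and the functions on $F$ (respectively $F\times F$) are the natural maps from it to the affine line $A\mapsto A$; they form a ring $\mathcal{O}(F)$ (respectively $\mathcal{O}(F\times F)$). **Theorem.** $Q$ is isomorphic to the Hopf algebra of functions on $F$. Precisely, there is a ring isomorphism $\Psi:Q\to\mathcal{O}(F)$ that sends $\varphi$ to the function whose value at $u\in F(A)$ is the power series of $\varphi$ evaluated at $e_n^{(U)}=$ the $n$-th entry of the coefficient of $U$ in $u-1$, and an additive isomorphism $\Psi_2:(\mathcal{G}\otimes\mathcal{G})^*\to\mathcal{O}(F\times F)$ that is its completed tensor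 square, that is, $\Psi_2(\varphi\otimes\psi)(u,v)=\Psi(\varphi)(u)\,\Psi(\psi)(v)$ and for each $u,v\in F(A)$ there is a finite set $S\subset\mathcal{G}\otimes\mathcal{G}$ such that $\Psi_2(\beta)(u,v)=0$ whenever $\beta$ vanishes on $S$. With the comultiplication $\Delta$, the counit and the antipode $\sigma$ of $Q$ described above, for all $\varphi\in Q$, all commutative rings $A$ and all $u,v\in F(A)$, $$\Psi_2(\Delta\varphi)(u,v)=\Psi(\varphi)(uv),\qquad \Psi(\varphi)(1)=\varphi(1),\qquad \Psi(\sigma\varphi)(u)=\Psi(\varphi)(u^{-1}).$$ -/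

import Mathlib

open PowerSeries TensorProduct
open scoped Kronecker

universe u v w

/-! ### Big Witt vectors -/

/-- The big Witt vectors of a commutative ring `A`: ring homomorphisms from the ring of symmetric functions
`ℤ[e₁, e₂, …]` to `A`.  Such a homomorphism is the sequence `(a₁, a₂, …)` of the images of the `eₙ`, and it
is recorded by its generating series `E(t) = 1 + a₁ t + a₂ t² + ⋯`. -/
@[ext]
structure BigWitt (A : Type*) [CommRing A] where
  series : A⟦X⟧
  const : constantCoeff series = 1

namespace BigWitt

section Ops

variable {A : Type*} [CommRing A]

/-- The image of `eₙ` (with `e₀ = 1`). -/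
noncomputable def coeff (n : ℕ) (x : BigWitt A) : A := PowerSeries.coeff n x.series

theorem coeff_zero (x : BigWitt A) : coeff 0 x = 1 := by
  simpa [coeff] using x.const

theorem ext_coeff {x y : BigWitt A} (h : ∀ n, coeff n x = coeff n y) : x = y :=
  BigWitt.ext (PowerSeries.ext h)

/-- The `n × n` matrix with first row `a₁, …, aₙ` and all entries just below the diagonal equal to `-1`.  Its
eigenvalues `x₁, …, xₙ` satisfy `eᵢ(x₁, …, xₙ) = aᵢ`, that is
`det (1 + t C) = 1 + a₁ t + ⋯ + aₙ tⁿ`. -/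
noncomputable def companion (n : ℕ) (x : BigWitt A) : Matrix (Fin n) (Fin n) A :=
  Matrix.of fun i j => if (i : ℕ) = 0 then coeff (j + 1) x else if (i : ℕ) = j + 1 then -1 else 0

/-- The series `det (1 + t M)`, the generating series of the elementary symmetric functions of the
eigenvalues of `M`. -/
noncomputable def detSeries {m : Type*} [Fintype m] [DecidableEq m] (M : Matrix m m A) : A⟦X⟧ :=
  (1 + (X : A⟦X⟧) • M.map (C : A →+* A⟦X⟧)).det

theorem constantCoeff_detSeries {m : Type*} [Fintype m] [DecidableEq m] (M : Matrix m m A) :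
    constantCoeff (detSeries M) = 1 := by
  unfold detSeries
  rw [RingHom.map_det]
  have : (RingHom.mapMatrix (constantCoeff (R := A))) (1 + (X : A⟦X⟧) • M.map (C : A →+* A⟦X⟧)) = 1 := by
    ext i j
    by_cases h : i = j <;> simp [h, Matrix.one_apply]
  rw [this, Matrix.det_one]

/-- Zero is the point with all `eₙ ↦ 0`. -/
noncomputable instance : Zero (BigWitt A) := ⟨⟨1, by simp⟩⟩

/-- One is the point with `e₁ ↦ 1` and `eₙ ↦ 0` for `n ≥ 2`. -/
noncomputable instance : One (BigWitt A) := ⟨⟨1 + X, by simp⟩⟩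

/-- Addition is dual to `eₙ ↦ ∑ eᵢ ⊗ eₙ₋ᵢ`: multiply the generating series. -/
noncomputable instance : Add (BigWitt A) := ⟨fun x y => ⟨x.series * y.series, by simp [x.const, y.const]⟩⟩

noncomputable instance : Neg (BigWitt A) :=
  ⟨fun x => ⟨invOfUnit x.series 1, by simp⟩⟩

/-- Multiplication is dual to the Kronecker comultiplication `eₙ ↦ eₙ({xᵢ yⱼ})`: the `n`-th component of
`x * y` is the `n`-th elementary symmetric function of the products of the eigenvalues of
`companion n x` and of `companion n y`. -/
noncomputable instance : Mul (BigWitt A) :=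
  ⟨fun x y => ⟨PowerSeries.mk fun n =>
    PowerSeries.coeff n (detSeries (companion n x ⊗ₖ companion n y)), by
      rw [← PowerSeries.coeff_zero_eq_constantCoeff_apply, PowerSeries.coeff_mk,
        PowerSeries.coeff_zero_eq_constantCoeff_apply, constantCoeff_detSeries]⟩⟩

theorem series_zero : (0 : BigWitt A).series = 1 := rfl
theorem series_one : (1 : BigWitt A).series = 1 + X := rfl
theorem series_add (x y : BigWitt A) : (x + y).series = x.series * y.series := rfl
theorem series_neg (x : BigWitt A) : x.series * (-x).series = 1 :=
  mul_invOfUnit x.series 1 (by simp [x.const])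
theorem coeff_mul (n : ℕ) (x y : BigWitt A) :
    coeff n (x * y) = PowerSeries.coeff n (detSeries (companion n x ⊗ₖ companion n y)) := by
  have h : (x * y).series = PowerSeries.mk fun n =>
      PowerSeries.coeff n (detSeries (companion n x ⊗ₖ companion n y)) := rfl
  rw [coeff, h, PowerSeries.coeff_mk]

/-- The additive group of big Witt vectors. -/
@[reducible]
noncomputable def addGroupAux : AddCommGroup (BigWitt A) where
  add_assoc x y z := BigWitt.ext (mul_assoc _ _ _)
  zero_add x := BigWitt.ext (one_mul _)
  add_zero x := BigWitt.ext (mul_one _)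
  add_comm x y := BigWitt.ext (mul_comm _ _)
  neg_add_cancel x := BigWitt.ext (by rw [series_add, mul_comm, series_neg, series_zero])
  nsmul := nsmulRec
  zsmul := zsmulRec

/-- Functoriality of the big Witt vectors. -/
noncomputable def mapFun {B : Type*} [CommRing B] (f : A →+* B) (x : BigWitt A) : BigWitt B :=
  ⟨PowerSeries.map f x.series, by
    rw [← PowerSeries.coeff_zero_eq_constantCoeff_apply, PowerSeries.coeff_map,
      PowerSeries.coeff_zero_eq_constantCoeff_apply, x.const, map_one]⟩

theorem coeff_mapFun {B : Type*} [CommRing B] (f : A →+* B) (n : ℕ) (x : BigWitt A) :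
    coeff n (mapFun f x) = f (coeff n x) := PowerSeries.coeff_map _ _ _

theorem map_detSeries {B : Type*} [CommRing B] (f : A →+* B) {m : Type*} [Fintype m] [DecidableEq m]
    (M : Matrix m m A) : PowerSeries.map f (detSeries M) = detSeries (M.map f) := by
  unfold detSeries
  rw [RingHom.map_det]
  congr 1
  ext i j : 1
  by_cases h : i = j <;> simp [h]

theorem map_companion {B : Type*} [CommRing B] (f : A →+* B) (n : ℕ) (x : BigWitt A) :
    (companion n x).map f = companion n (mapFun f x) := by
  ext i j
  simp only [companion, Matrix.map_apply, Matrix.of_apply, coeff_mapFun]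
  split_ifs <;> simp

theorem mapFun_add {B : Type*} [CommRing B] (f : A →+* B) (x y : BigWitt A) :
    mapFun f (x + y) = mapFun f x + mapFun f y :=
  BigWitt.ext (map_mul (PowerSeries.map f) _ _)

theorem mapFun_mul {B : Type*} [CommRing B] (f : A →+* B) (x y : BigWitt A) :
    mapFun f (x * y) = mapFun f x * mapFun f y := by
  refine ext_coeff fun n => ?_
  rw [coeff_mapFun, coeff_mul, coeff_mul, ← PowerSeries.coeff_map, map_detSeries, ← map_companion,
    ← map_companion]
  congr 2
  ext i j
  simp

theorem mapFun_one {B : Type*} [CommRing B] (f : A →+* B) :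
    mapFun f (1 : BigWitt A) = 1 := BigWitt.ext (by simp [mapFun, series_one])

theorem mapFun_zero {B : Type*} [CommRing B] (f : A →+* B) :
    mapFun f (0 : BigWitt A) = 0 := BigWitt.ext (by simp [mapFun, series_zero])

end Ops

section Ghost

variable {A : Type*} [CommRing A]

/-- The logarithmic derivative `t E'(t) / E(t)`. -/
noncomputable def logDer (x : BigWitt A) : A⟦X⟧ := (-x).series * (X * d⁄dX A x.series)

theorem series_mul_logDer (x : BigWitt A) : x.series * logDer x = X * d⁄dX A x.series := by
  unfold logDer
  rw [← mul_assoc, series_neg, one_mul]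

theorem logDer_eq (x : BigWitt A) (g : A⟦X⟧) (h : X * d⁄dX A x.series = x.series * g) :
    logDer x = g := by
  unfold logDer
  rw [h, ← mul_assoc, mul_comm _ x.series, series_neg, one_mul]

theorem coeff_X_mul_der (f : A⟦X⟧) (n : ℕ) :
    PowerSeries.coeff n (X * d⁄dX A f) = n * PowerSeries.coeff n f := by
  cases n with
  | zero => simp
  | succ n => rw [PowerSeries.coeff_succ_X_mul, PowerSeries.coeff_derivative]; push_cast; ring

/-- Newton's identities. -/
theorem newton (x : BigWitt A) (n : ℕ) :
    (n : A) * coeff n x =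
      ∑ p ∈ Finset.HasAntidiagonal.antidiagonal n, coeff p.1 x * PowerSeries.coeff p.2 (logDer x) := by
  unfold coeff
  rw [← coeff_X_mul_der, ← series_mul_logDer, PowerSeries.coeff_mul]

theorem coeff_zero_logDer (x : BigWitt A) : PowerSeries.coeff 0 (logDer x) = 0 := by
  have := newton x 0
  simpa [coeff_zero] using this.symm

theorem logDer_congr {x y : BigWitt A} {N : ℕ} (h : ∀ n ≤ N, coeff n x = coeff n y) :
    ∀ n ≤ N, PowerSeries.coeff n (logDer x) = PowerSeries.coeff n (logDer y) := by
  intro n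
  induction n using Nat.strong_induction_on with
  | _ n ih =>
    intro hn
    have hx := newton x n
    have hy := newton y n
    rw [← Finset.add_sum_erase _ _ (Finset.HasAntidiagonal.mem_antidiagonal.2 (show ((0, n) : ℕ × ℕ).1 + ((0, n) : ℕ × ℕ).2 = n from zero_add n)), coeff_zero, one_mul] at hx hy
    have : ∑ p ∈ (Finset.HasAntidiagonal.antidiagonal n).erase (0, n), coeff p.1 x * PowerSeries.coeff p.2 (logDer x) =
        ∑ p ∈ (Finset.HasAntidiagonal.antidiagonal n).erase (0, n), coeff p.1 y * PowerSeries.coeff p.2 (logDer y) := by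
      refine Finset.sum_congr rfl fun p hp => ?_
      obtain ⟨h1, h2⟩ := Finset.mem_erase.1 hp
      have h3 := Finset.HasAntidiagonal.mem_antidiagonal.1 h2
      have h4 : p.1 ≠ 0 := fun h0 => h1 (Prod.ext h0 (by simpa [h0] using h3))
      rw [h p.1 (by omega), ih p.2 (by omega) (by omega)]
    rw [h n hn, this] at hx
    exact add_right_cancel (hx.symm.trans hy)

theorem coeff_congr [IsDomain A] [CharZero A] {x y : BigWitt A} {N : ℕ}
    (h : ∀ n ≤ N, PowerSeries.coeff n (logDer x) = PowerSeries.coeff n (logDer y)) :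
    ∀ n ≤ N, coeff n x = coeff n y := by
  intro n
  induction n using Nat.strong_induction_on with
  | _ n ih =>
    intro hn
    rcases Nat.eq_zero_or_pos n with rfl | hpos
    · rw [coeff_zero, coeff_zero]
    have hne : (n : A) ≠ 0 := Nat.cast_ne_zero.2 hpos.ne'
    refine mul_left_cancel₀ hne ?_
    rw [newton x n, newton y n]
    refine Finset.sum_congr rfl fun p hp => ?_
    have h3 := Finset.HasAntidiagonal.mem_antidiagonal.1 hp
    rcases Nat.eq_zero_or_pos p.2 with h0 | h0
    · rw [h0, coeff_zero_logDer, coeff_zero_logDer, mul_zero, mul_zero]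
    · rw [ih p.1 (by omega) (by omega), h p.2 (by omega)]

theorem ext_logDer [IsDomain A] [CharZero A] {x y : BigWitt A} (h : logDer x = logDer y) : x = y :=
  ext_coeff fun n => coeff_congr (N := n) (fun k _ => by rw [h]) n le_rfl

theorem logDer_add (x y : BigWitt A) : logDer (x + y) = logDer x + logDer y := by
  apply logDer_eq
  rw [series_add, Derivation.leibniz, smul_eq_mul, smul_eq_mul]
  linear_combination -y.series * series_mul_logDer x - x.series * series_mul_logDer y

/-- Substitution of `t M` into a power series `f(t)`. -/
noncomputable def evalMat {m : Type*} [Fintype m] [DecidableEq m] (M : Matrix m m A) (f : A⟦X⟧) :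
    Matrix m m A⟦X⟧ :=
  Matrix.of fun i j => PowerSeries.mk fun k => PowerSeries.coeff k f * (M ^ k) i j

variable {m : Type*} [Fintype m] [DecidableEq m] (M : Matrix m m A)

theorem evalMat_mul (f g : A⟦X⟧) : evalMat M (f * g) = evalMat M f * evalMat M g := by
  ext i j n
  simp only [evalMat, Matrix.of_apply, Matrix.mul_apply, PowerSeries.coeff_mk, map_sum,
    PowerSeries.coeff_mul]
  rw [Finset.sum_comm, Finset.sum_mul]
  refine Finset.sum_congr rfl fun p hp => ?_
  rw [← Finset.HasAntidiagonal.mem_antidiagonal.1 hp, pow_add, Matrix.mul_apply, Finset.mul_sum]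
  refine Finset.sum_congr rfl fun l _ => by ring

theorem evalMat_one : evalMat M (1 : A⟦X⟧) = 1 := by
  ext i j n
  simp only [evalMat, Matrix.of_apply, PowerSeries.coeff_mk, PowerSeries.coeff_one]
  by_cases hn : n = 0
  · subst hn
    by_cases h : i = j <;> simp [h, Matrix.one_apply]
  · by_cases h : i = j <;> simp [h, hn, Matrix.one_apply, PowerSeries.coeff_one]

theorem constantCoeff_det_evalMat (y : BigWitt A) :
    constantCoeff (evalMat M y.series).det = 1 := by
  rw [RingHom.map_det]
  have : (RingHom.mapMatrix (constantCoeff (R := A))) (evalMat M y.series) = 1 := by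
    ext i j
    simp only [evalMat, RingHom.mapMatrix_apply, Matrix.map_apply, Matrix.of_apply,
      ← PowerSeries.coeff_zero_eq_constantCoeff_apply, PowerSeries.coeff_mk]
    rw [PowerSeries.coeff_zero_eq_constantCoeff_apply, y.const, pow_zero, one_mul]
  rw [this, Matrix.det_one]

theorem derivation_det {S B : Type*} [CommRing S] [CommRing B] [Algebra S B] (D : Derivation S B B)
    (P Q : Matrix m m B) (h : Q * P = 1) :
    D P.det = P.det * (Q * P.map D).trace := by
  have hadj : P.adjugate = P.det • Q := by
    have := congrArg (· * P.adjugate) h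
    simp only [mul_assoc, Matrix.mul_adjugate, one_mul, Matrix.mul_smul, mul_one] at this
    exact this.symm
  have h1 : D P.det = ∑ i, (P.updateCol i (fun k => D (P k i))).det := by
    simp only [Matrix.det_apply, map_sum]
    rw [Finset.sum_comm]
    refine Finset.sum_congr rfl fun σ _ => ?_
    rw [← Finset.smul_sum, Units.smul_def, Units.smul_def, map_zsmul]
    congr 1
    have hprod : ∀ s : Finset m, D (∏ i ∈ s, P (σ i) i) =
        ∑ i ∈ s, ∏ j ∈ s, P.updateCol i (fun k => D (P k i)) (σ j) j := by
      intro s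
      induction s using Finset.induction_on with
      | empty => simp
      | insert a s ha ih =>
        rw [Finset.prod_insert ha, Derivation.leibniz, ih, Finset.sum_insert ha,
          Finset.prod_insert ha, add_comm, Finset.smul_sum]
        congr 1
        · rw [Matrix.updateCol_self, smul_eq_mul, mul_comm]
          congr 1
          refine Finset.prod_congr rfl fun j hj => ?_
          rw [Matrix.updateCol_ne (ne_of_mem_of_not_mem hj ha)]
        · refine Finset.sum_congr rfl fun i hi => ?_
          rw [Finset.prod_insert ha, Matrix.updateCol_ne (ne_of_mem_of_not_mem hi ha).symm, smul_eq_mul]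
    exact hprod Finset.univ
  rw [h1]
  have h2 : ∀ i, (P.updateCol i (fun k => D (P k i))).det = (P.adjugate * P.map D) i i := by
    intro i
    rw [← Matrix.cramer_apply, Matrix.cramer_eq_adjugate_mulVec]
    rfl
  simp only [h2]
  rw [hadj, Matrix.smul_mul]
  simp [Matrix.trace, Finset.mul_sum]

/-- `f(tM)` has logarithmic derivative with coefficients `gₙ tr(Mⁿ)`. -/
theorem logDer_det_evalMat (y : BigWitt A) (n : ℕ) :
    PowerSeries.coeff n (logDer ⟨(evalMat M y.series).det, constantCoeff_det_evalMat M y⟩) =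
      PowerSeries.coeff n (logDer y) * (M ^ n).trace := by
  have key : logDer ⟨(evalMat M y.series).det, constantCoeff_det_evalMat M y⟩ =
      (evalMat M (logDer y)).trace := by
    apply logDer_eq
    have hinv : evalMat M (-y).series * evalMat M y.series = 1 := by
      rw [← evalMat_mul, mul_comm, series_neg, evalMat_one]
    have := derivation_det ((X : A⟦X⟧) • d⁄dX A) _ _ hinv
    simp only [Derivation.smul_apply, smul_eq_mul] at this
    show X * d⁄dX A (evalMat M y.series).det = _
    rw [this]
    congr 2
    have : (evalMat M y.series).map ⇑((X : A⟦X⟧) • d⁄dX A) = evalMat M (X * d⁄dX A y.series) := by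
      ext i j n
      simp only [Matrix.map_apply, Derivation.smul_apply, smul_eq_mul, coeff_X_mul_der, evalMat,
        Matrix.of_apply, PowerSeries.coeff_mk]
      ring
    rw [this, ← evalMat_mul]
    rfl
  rw [key]
  simp [evalMat, Matrix.trace, Finset.mul_sum]

theorem one_add_X_smul :
    1 + (X : A⟦X⟧) • M.map (C : A →+* A⟦X⟧) = evalMat M (1 : BigWitt A).series := by
  ext i j n
  rw [series_one]
  simp only [evalMat, Matrix.of_apply, PowerSeries.coeff_mk, map_add, PowerSeries.coeff_one,
    PowerSeries.coeff_X]
  rcases n with _ | _ | n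
  · by_cases h : i = j <;> simp [h]
  · by_cases h : i = j <;> simp [h, PowerSeries.coeff_one]
  · by_cases h : i = j <;> simp [h, PowerSeries.coeff_one, PowerSeries.coeff_X]

theorem detSeries_eq : detSeries M = (evalMat M (1 : BigWitt A).series).det := by
  rw [← one_add_X_smul, detSeries]

/-- The big Witt vector with generating series `det (1 + t M)`. -/
noncomputable def ofMatrix : BigWitt A := ⟨detSeries M, constantCoeff_detSeries M⟩

theorem logDer_ofMatrix (n : ℕ) :
    PowerSeries.coeff n (logDer (ofMatrix M)) =
      PowerSeries.coeff n (logDer (1 : BigWitt A)) * (M ^ n).trace := by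
  rw [← logDer_det_evalMat]
  congr 2
  exact BigWitt.ext (detSeries_eq M)

theorem logDer_one (n : ℕ) (hn : n ≠ 0) :
    PowerSeries.coeff n (logDer (1 : BigWitt A)) = (-1) ^ (n + 1) := by
  induction n with
  | zero => exact absurd rfl hn
  | succ n ih => 
    have := congrArg (PowerSeries.coeff (n+1)) (series_mul_logDer (1 : BigWitt A))
    rw [series_one, add_mul, one_mul, map_add, PowerSeries.coeff_succ_X_mul, coeff_X_mul_der] at this
    rcases Nat.eq_zero_or_pos n with rfl | h
    · rw [coeff_zero_logDer] at this
      simpa [PowerSeries.coeff_one] using this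
    · rw [ih h.ne'] at this
      have h2 : n ≠ 0 := h.ne'
      simp [PowerSeries.coeff_one, PowerSeries.coeff_X, h2] at this
      rw [eq_neg_of_add_eq_zero_left this]
      ring

theorem detSeries_companion (n : ℕ) (x : BigWitt A) :
    detSeries (companion n x) = 1 + ∑ k : Fin n, C (coeff (k + 1) x) * X ^ ((k : ℕ) + 1) := by
  rcases n with _ | n
  · simp [detSeries]
  let V : Matrix (Fin (n + 1)) (Fin (n + 1)) A⟦X⟧ :=
    Matrix.of fun i j => if j ≤ i then X ^ ((i : ℕ) - j) else 0
  have hV : V.det = 1 := by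
    rw [Matrix.det_of_isLowerTriangular]
    · simp [V]
    · intro i j hij
      have : i < j := hij
      simp [V, not_le.2 this]
  set P : Matrix (Fin (n + 1)) (Fin (n + 1)) A⟦X⟧ :=
    1 + (X : A⟦X⟧) • (companion (n + 1) x).map (C : A →+* A⟦X⟧) with hP
  have hrow : ∀ i : Fin n, ∀ j, (P * V) i.succ j = if i.succ = j then 1 else 0 := by
    intro i j
    rw [Matrix.mul_apply]
    have h0 : ∀ k, P i.succ k = (if i.succ = k then 1 else 0) - (if i.castSucc = k then X else 0) := by
      intro k
      simp only [hP, companion, Matrix.add_apply, Matrix.one_apply, Matrix.smul_apply,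
        Matrix.map_apply, Matrix.of_apply, Fin.val_succ, smul_eq_mul]
      by_cases h : i.castSucc = k
      · have h' : (i : ℕ) + 1 = k + 1 := by rw [← h]; simp
        simp [h, h', sub_eq_add_neg]
      · have h' : ¬ (i : ℕ) = k := fun hh => h (Fin.ext hh)
        simp [h, h']
    simp only [h0, sub_mul, ite_mul, one_mul, zero_mul, Finset.sum_sub_distrib,
      Finset.sum_ite_eq, Finset.mem_univ, if_true]
    simp only [V, Matrix.of_apply, Fin.val_succ, Fin.val_castSucc]
    rcases lt_trichotomy j i.succ with h | h | h
    · have h1 : j ≤ i.castSucc := Fin.le_castSucc_iff.2 h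
      have h2 : (i : ℕ) + 1 - j = (i - j) + 1 := by
        have : (j : ℕ) ≤ i := h1
        omega
      simp [h.le, h1, h2, h.ne', pow_succ, mul_comm]
    · subst h
      have : ¬ i.succ ≤ i.castSucc := by simp
      simp
    · have h1 : ¬ j ≤ i.castSucc := fun hh => absurd (Fin.le_castSucc_iff.1 hh) (not_lt.2 h.le)
      simp [not_le.2 h, h1, h.ne]
  have hdet : (P * V).det = P.det := by rw [Matrix.det_mul, hV, mul_one]
  have hup : (P * V).det = (P * V) 0 0 := by
    rw [Matrix.det_of_isUpperTriangular, Fin.prod_univ_succ]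
    · simp [hrow]
    · intro i j hij
      have hij' : j < i := hij
      obtain ⟨i, rfl⟩ := Fin.exists_succ_eq.2 (Fin.ne_zero_of_lt hij')
      simp [hrow, hij'.ne']
  show P.det = _
  rw [← hdet, hup, Matrix.mul_apply]
  have hr0 : ∀ k, P 0 k * V k 0 = (if k = 0 then 1 else 0) + C (coeff (k + 1) x) * X ^ ((k : ℕ) + 1) := by
    intro k
    simp only [hP, V, companion, Matrix.add_apply, Matrix.one_apply, Matrix.smul_apply,
        Matrix.map_apply, Matrix.of_apply, smul_eq_mul]
    by_cases hk : k = 0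
    · subst hk; simp; ring
    · simp [hk, Ne.symm hk, pow_succ]; ring
  simp only [hr0, Finset.sum_add_distrib]
  simp

theorem coeff_detSeries_companion {n k : ℕ} (x : BigWitt A) (h : k ≤ n) :
    PowerSeries.coeff k (detSeries (companion n x)) = coeff k x := by
  rw [detSeries_companion]
  rcases k with _ | k
  · simp [coeff_zero]
  · simp only [map_add, map_sum, PowerSeries.coeff_one, PowerSeries.coeff_C_mul, PowerSeries.coeff_X_pow]
    rw [Finset.sum_eq_single ⟨k, h⟩]
    · simp
    · intro j _ hj
      have : k ≠ j := fun hh => hj (Fin.ext hh.symm)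
      simp [this]
    · simp

theorem logDer_eq_trace {n k : ℕ} (x : BigWitt A) (h : k ≤ n) :
    PowerSeries.coeff k (logDer x) =
      PowerSeries.coeff k (logDer (1 : BigWitt A)) * (companion n x ^ k).trace := by
  rw [← logDer_ofMatrix]
  exact logDer_congr (N := n) (fun j hj => (coeff_detSeries_companion x hj).symm) k h

theorem kron_pow {m' : Type*} [Fintype m'] [DecidableEq m'] (M : Matrix m m A) (M' : Matrix m' m' A)
    (k : ℕ) : (M ⊗ₖ M') ^ k = (M ^ k) ⊗ₖ (M' ^ k) := by
  induction k with
  | zero => simp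
  | succ k ih => rw [pow_succ, pow_succ, pow_succ, ih, Matrix.mul_kronecker_mul]

theorem logDer_kron (N k : ℕ) (h : k ≤ N) (x y : BigWitt A) :
    PowerSeries.coeff k (logDer (ofMatrix (companion N x ⊗ₖ companion N y))) =
      PowerSeries.coeff k (logDer (1 : BigWitt A)) * PowerSeries.coeff k (logDer x) *
        PowerSeries.coeff k (logDer y) := by
  rcases Nat.eq_zero_or_pos k with rfl | hk
  · simp only [coeff_zero_logDer, mul_zero]
  rw [logDer_ofMatrix, kron_pow, Matrix.trace_kronecker, logDer_eq_trace x h, logDer_eq_trace y h,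
    logDer_one k hk.ne']
  have : ((-1 : A) ^ (k + 1)) * (-1) ^ (k + 1) = 1 := by rw [← mul_pow]; simp
  linear_combination (-(-1 : A) ^ (k + 1) * (companion N x ^ k).trace * (companion N y ^ k).trace) * this

section Domain

variable [IsDomain A] [CharZero A]

theorem coeff_mul_of_le (x y : BigWitt A) (N n : ℕ) (h : n ≤ N) :
    coeff n (x * y) = coeff n (ofMatrix (companion N x ⊗ₖ companion N y)) := by
  rw [coeff_mul]
  refine coeff_congr (N := n) (x := ofMatrix (companion n x ⊗ₖ companion n y)) (fun k hk => ?_) n le_rfl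
  rw [logDer_kron n k hk, logDer_kron N k (hk.trans h)]

theorem coeff_logDer_mul (x y : BigWitt A) (n : ℕ) :
    PowerSeries.coeff n (logDer (x * y)) =
      PowerSeries.coeff n (logDer (1 : BigWitt A)) * PowerSeries.coeff n (logDer x) *
        PowerSeries.coeff n (logDer y) := by
  rw [← logDer_kron n n le_rfl]
  exact logDer_congr (N := n) (fun k hk => coeff_mul_of_le x y n k hk) n le_rfl

theorem mul_comm_aux (x y : BigWitt A) : x * y = y * x := by
  refine ext_logDer (PowerSeries.ext fun n => ?_)
  rw [coeff_logDer_mul, coeff_logDer_mul, mul_right_comm]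

theorem mul_assoc_aux (x y z : BigWitt A) : x * y * z = x * (y * z) := by
  refine ext_logDer (PowerSeries.ext fun n => ?_)
  simp only [coeff_logDer_mul]
  ring

theorem one_mul_aux (x : BigWitt A) : 1 * x = x := by
  refine ext_logDer (PowerSeries.ext fun n => ?_)
  rw [coeff_logDer_mul]
  rcases Nat.eq_zero_or_pos n with rfl | h
  · simp only [coeff_zero_logDer, mul_zero]
  · rw [logDer_one n h.ne', ← mul_pow]
    simp

theorem mul_add_aux (x y z : BigWitt A) : x * (y + z) = x * y + x * z := by
  refine ext_logDer (PowerSeries.ext fun n => ?_)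
  simp only [coeff_logDer_mul, logDer_add, map_add]
  ring

end Domain

open Classical in
/-- The canonical lift of a big Witt vector along `ℤ[A] → A`. -/
noncomputable def liftPoly (x : BigWitt A) : BigWitt (MvPolynomial A ℤ) :=
  ⟨PowerSeries.mk fun n => if n = 0 then 1 else if coeff n x = 0 then 0 else MvPolynomial.X (coeff n x), by
    rw [← PowerSeries.coeff_zero_eq_constantCoeff_apply, PowerSeries.coeff_mk, if_pos rfl]⟩

/-- The canonical surjection `ℤ[A] → A`. -/
noncomputable def polyEval (A : Type*) [CommRing A] : MvPolynomial A ℤ →+* A :=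
  (MvPolynomial.aeval (fun a : A => a)).toRingHom

theorem mapFun_liftPoly (x : BigWitt A) : mapFun (polyEval A) (liftPoly x) = x := by
  refine ext_coeff fun n => ?_
  rw [coeff_mapFun]
  by_cases h : n = 0
  · subst h; simp [coeff_zero]
  · by_cases h' : coeff n x = 0
    · simp [liftPoly, coeff] at h' ⊢
      simp [h, h']
    · simp [liftPoly, coeff, polyEval] at h' ⊢
      simp [h, h']

noncomputable instance : CommRing (BigWitt A) where
  __ := addGroupAux
  mul_comm x y := by
    rw [← mapFun_liftPoly x, ← mapFun_liftPoly y, ← mapFun_mul, mul_comm_aux, mapFun_mul]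
  mul_assoc x y z := by
    rw [← mapFun_liftPoly x, ← mapFun_liftPoly y, ← mapFun_liftPoly z]
    simp only [← mapFun_mul]
    rw [mul_assoc_aux]
  one_mul x := by
    rw [← mapFun_liftPoly x, ← mapFun_one (polyEval A), ← mapFun_mul, one_mul_aux]
  mul_one x := by
    rw [← mapFun_liftPoly x, ← mapFun_one (polyEval A), ← mapFun_mul, mul_comm_aux, one_mul_aux]
  left_distrib x y z := by
    rw [← mapFun_liftPoly x, ← mapFun_liftPoly y, ← mapFun_liftPoly z]
    simp only [← mapFun_mul, ← mapFun_add]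
    rw [mul_add_aux]
  right_distrib x y z := by
    rw [← mapFun_liftPoly x, ← mapFun_liftPoly y, ← mapFun_liftPoly z]
    simp only [← mapFun_mul, ← mapFun_add]
    rw [mul_comm_aux, mul_add_aux, mul_comm_aux, mul_comm_aux (liftPoly z)]
  zero_mul x := by
    let _ := addGroupAux (A := MvPolynomial A ℤ)
    let _ := addGroupAux (A := A)
    have h : (0 : BigWitt A) * x + 0 * x = 0 * x + 0 := by
      rw [← mapFun_liftPoly x, ← mapFun_zero (polyEval A)]
      simp only [← mapFun_mul, ← mapFun_add]
      rw [mul_comm_aux, ← mul_add_aux, add_zero, add_zero]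
    exact add_left_cancel h
  mul_zero x := by
    let _ := addGroupAux (A := MvPolynomial A ℤ)
    let _ := addGroupAux (A := A)
    have h : x * (0 : BigWitt A) + x * 0 = x * 0 + 0 := by
      rw [← mapFun_liftPoly x, ← mapFun_zero (polyEval A)]
      simp only [← mapFun_mul, ← mapFun_add]
      rw [← mul_add_aux, add_zero, add_zero]
    exact add_left_cancel h

/-- Functoriality of the ring of big Witt vectors. -/
noncomputable def map {B : Type*} [CommRing B] (f : A →+* B) : BigWitt A →+* BigWitt B where
  toFun := mapFun f
  map_one' := mapFun_one f
  map_mul' := mapFun_mul f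
  map_zero' := mapFun_zero f
  map_add' := mapFun_add f

end Ghost

section Formal

variable {A : Type*} [CommRing A]

theorem mul_series_eq_aux [IsDomain A] [CharZero A] (d : ℕ) (x y : BigWitt A)
    (h : ∀ n, d < n → coeff n x = 0) :
    (x * y).series = (evalMat (companion d x) y.series).det := by
  have hx : ofMatrix (companion d x) = x := by
    refine ext_coeff fun n => ?_
    rcases le_or_gt n d with hn | hn
    · exact coeff_detSeries_companion x hn
    · rw [h n hn]
      show PowerSeries.coeff n (detSeries _) = 0
      rw [detSeries_companion]
      have : n ≠ 0 := by omega
      simp only [map_add, map_sum, PowerSeries.coeff_one, PowerSeries.coeff_C_mul,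
        PowerSeries.coeff_X_pow, this, if_false, zero_add]
      refine Finset.sum_eq_zero fun k _ => ?_
      have : n ≠ k + 1 := by omega
      simp [this]
  refine congrArg BigWitt.series
    (ext_logDer (y := ⟨_, constantCoeff_det_evalMat (companion d x) y⟩) (PowerSeries.ext fun n => ?_))
  rw [logDer_det_evalMat, coeff_logDer_mul, ← hx, logDer_ofMatrix, hx]
  rcases Nat.eq_zero_or_pos n with rfl | hn
  · simp only [coeff_zero_logDer, mul_zero, zero_mul]
  rw [logDer_one n hn.ne']
  have : ((-1 : A) ^ (n + 1)) * (-1) ^ (n + 1) = 1 := by rw [← mul_pow]; simp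
  linear_combination (PowerSeries.coeff n (logDer y) * (companion d x ^ n).trace) * this

theorem mul_series_eq (d : ℕ) (x y : BigWitt A) (h : ∀ n, d < n → coeff n x = 0) :
    (x * y).series = (evalMat (companion d x) y.series).det := by
  have h1 := mul_series_eq_aux d (liftPoly x) (liftPoly y) (fun n hn => by
    have : n ≠ 0 := by omega
    have h2 := h n hn
    simp [coeff, liftPoly] at h2 ⊢
    simp [this, h2])
  have h2 := congrArg (PowerSeries.map (polyEval A)) h1
  have h3 : PowerSeries.map (polyEval A) (liftPoly x * liftPoly y).series = (x * y).series := by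
    have := mapFun_mul (polyEval A) (liftPoly x) (liftPoly y)
    rw [mapFun_liftPoly, mapFun_liftPoly] at this
    exact congrArg BigWitt.series this
  rw [← h3, h2, RingHom.map_det]
  congr 1
  ext i j n
  have hy : ∀ n, polyEval A (PowerSeries.coeff n (liftPoly y).series) = PowerSeries.coeff n y.series := by
    intro n
    have := congrArg (coeff n) (mapFun_liftPoly y)
    rw [coeff_mapFun] at this
    exact this
  simp only [evalMat, RingHom.mapMatrix_apply, Matrix.map_apply, Matrix.of_apply,
    PowerSeries.coeff_map, PowerSeries.coeff_mk, map_mul, hy]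
  congr 1
  have h4 := map_companion (polyEval A) d (liftPoly x)
  rw [mapFun_liftPoly] at h4
  rw [← h4]
  have := (RingHom.mapMatrix (m := Fin d) (polyEval A)).map_pow (companion d (liftPoly x)) n
  exact congrFun (congrFun this i) j

theorem isFormal_iff (x : BigWitt A) :
    ((∀ n, n ≠ 0 → IsNilpotent (coeff n x)) ∧ {n | coeff n x ≠ 0}.Finite) ↔
      ∃ f : Polynomial A, IsUnit f ∧ (f : A⟦X⟧) = x.series := by
  constructor
  · rintro ⟨h1, h2⟩
    obtain ⟨N, hN⟩ := h2.bddAbove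
    have hc : ((PowerSeries.trunc (N + 1) x.series : Polynomial A) : A⟦X⟧) = x.series := by
      ext n
      rw [Polynomial.coeff_coe, PowerSeries.coeff_trunc]
      split_ifs with h
      · rfl
      · by_contra hh
        have : n ≤ N := hN (show coeff n x ≠ 0 from fun h0 => hh h0.symm)
        omega
    refine ⟨_, Polynomial.isUnit_of_coeff_isUnit_isNilpotent ?_ ?_, hc⟩
    · rw [← Polynomial.coeff_coe, hc]
      rw [show PowerSeries.coeff 0 x.series = 1 from coeff_zero x]
      exact isUnit_one
    · intro i hi
      rw [← Polynomial.coeff_coe, hc]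
      exact h1 i hi
  · rintro ⟨f, hf, hfx⟩
    have hc : ∀ n, coeff n x = f.coeff n := fun n => by rw [coeff, ← hfx, Polynomial.coeff_coe]
    refine ⟨fun n hn => hc n ▸ (Polynomial.coeff_isUnit_isNilpotent_of_isUnit hf).2 n hn, ?_⟩
    refine (f.support.finite_toSet).subset fun n hn => ?_
    simpa [hc] using hn

theorem coeff_neg_one (n : ℕ) : PowerSeries.coeff n (-1 : BigWitt A).series = (-1) ^ n := by
  have h := series_neg (1 : BigWitt A)
  rw [series_one, add_mul, one_mul] at h
  induction n with
  | zero => rw [pow_zero]; exact coeff_zero _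
  | succ n ih =>
    have := congrArg (PowerSeries.coeff (n + 1)) h
    rw [map_add, PowerSeries.coeff_succ_X_mul, ih, PowerSeries.coeff_one, if_neg (by omega)] at this
    rw [eq_neg_of_add_eq_zero_left this]
    ring

theorem pow_companion_eq_zero (f : Polynomial A) (hf : IsUnit f) (x : BigWitt A)
    (hfx : (f : A⟦X⟧) = x.series) (hfin : ∀ n, f.natDegree < n → coeff n x = 0) :
    ∃ K, ∀ k, K ≤ k → companion f.natDegree x ^ k = 0 := by
  set M := companion f.natDegree x with hM
  let κ : Polynomial A →+* A⟦X⟧ := Polynomial.coeToPowerSeries.ringHom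
  have hκ : Function.Injective κ := Polynomial.coe_injective A
  set P : Matrix (Fin f.natDegree) (Fin f.natDegree) (Polynomial A) :=
    1 + (Polynomial.X : Polynomial A) • M.map (Polynomial.C : A →+* Polynomial A) with hP
  have hPκ : κ.mapMatrix P = evalMat M (1 : BigWitt A).series := by
    rw [← one_add_X_smul]
    ext i j : 1
    have hc := mul_comm (C (M i j) : A⟦X⟧) X
    by_cases h : i = j
    · subst h; simp [hP, κ, hc]
    · simp [hP, h, κ, hc]
  have hdet : P.det = f := by
    apply hκ
    rw [RingHom.map_det, hPκ, ← mul_series_eq _ x 1 hfin, mul_one]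
    exact hfx.symm
  have hPu : IsUnit P := (Matrix.isUnit_iff_isUnit_det P).2 (by rw [hdet]; exact hf)
  obtain ⟨Q, hQ⟩ := hPu.exists_left_inv
  have hQκ : κ.mapMatrix Q = evalMat M (-1 : BigWitt A).series := by
    have h1 := congrArg κ.mapMatrix hQ
    rw [map_mul, map_one, hPκ] at h1
    have h2 : evalMat M (1 : BigWitt A).series * evalMat M (-1 : BigWitt A).series = 1 := by
      rw [← evalMat_mul, series_neg, evalMat_one]
    exact left_inv_eq_right_inv h1 h2
  refine ⟨(∑ i, ∑ j, (Q i j).natDegree) + 1, fun k hk => ?_⟩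
  ext i j
  have h3 : (Q i j).natDegree < k := by
    have h4 : (Q i j).natDegree ≤ ∑ j, (Q i j).natDegree :=
      Finset.single_le_sum (f := fun j => (Q i j).natDegree) (fun _ _ => Nat.zero_le _)
        (Finset.mem_univ j)
    have h5 : ∑ j, (Q i j).natDegree ≤ ∑ i, ∑ j, (Q i j).natDegree :=
      Finset.single_le_sum (f := fun i => ∑ j, (Q i j).natDegree) (fun _ _ => Nat.zero_le _)
        (Finset.mem_univ i)
    omega
  have h6 := congrArg (PowerSeries.coeff k) (congrFun (congrFun hQκ i) j)
  simp only [evalMat, RingHom.mapMatrix_apply, Matrix.map_apply, Matrix.of_apply,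
    PowerSeries.coeff_mk, coeff_neg_one] at h6
  have h7 : PowerSeries.coeff k (κ (Q i j)) = 0 := by
    show PowerSeries.coeff k ((Q i j : Polynomial A) : A⟦X⟧) = 0
    rw [Polynomial.coeff_coe, Polynomial.coeff_eq_zero_of_natDegree_lt h3]
  rw [h7] at h6
  have h8 : ((-1 : A) ^ k) * (-1) ^ k = 1 := by rw [← mul_pow]; simp
  have : (M ^ k) i j = (-1) ^ k * ((-1) ^ k * (M ^ k) i j) := by rw [← mul_assoc, h8, one_mul]
  rw [this, ← h6, mul_zero, Matrix.zero_apply]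

theorem isUnit_mul_series (f : Polynomial A) (hf : IsUnit f) (y x : BigWitt A)
    (hfx : (f : A⟦X⟧) = x.series) :
    ∃ g : Polynomial A, IsUnit g ∧ (g : A⟦X⟧) = (y • x).series := by
  have hfin : ∀ n, f.natDegree < n → coeff n x = 0 := by
    intro n hn
    rw [coeff, ← hfx, Polynomial.coeff_coe, Polynomial.coeff_eq_zero_of_natDegree_lt hn]
  obtain ⟨K, hK⟩ := pow_companion_eq_zero f hf x hfx hfin
  set M := companion f.natDegree x with hM
  let κ : Polynomial A →+* A⟦X⟧ := Polynomial.coeToPowerSeries.ringHom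
  have hκ : Function.Injective κ := Polynomial.coe_injective A
  let p : A⟦X⟧ → Matrix (Fin f.natDegree) (Fin f.natDegree) (Polynomial A) :=
    fun g => Matrix.of fun i j => PowerSeries.trunc K (evalMat M g i j)
  have hp : ∀ g, κ.mapMatrix (p g) = evalMat M g := by
    intro g
    ext i j n
    show PowerSeries.coeff n ((PowerSeries.trunc K (evalMat M g i j) : Polynomial A) : A⟦X⟧) = _
    rw [Polynomial.coeff_coe, PowerSeries.coeff_trunc]
    split_ifs with h
    · rfl
    · simp [evalMat, hK n (not_lt.1 h)]
  refine ⟨(p y.series).det, ?_, ?_⟩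
  · refine IsUnit.of_mul_eq_one (p (-y).series).det (hκ ?_)
    rw [← Matrix.det_mul, RingHom.map_det, map_mul, hp, hp, ← evalMat_mul, series_neg, evalMat_one,
      Matrix.det_one, map_one]
  · rw [smul_eq_mul, mul_comm, mul_series_eq _ x y hfin, ← hp, ← RingHom.map_det]
    rfl

/-- The ideal `Ŵ(A)` of the big Witt vectors with nilpotent components `a₁, a₂, …`, almost all zero: the points
of the formal completion of `W` at zero. -/
noncomputable def formalIdeal (A : Type*) [CommRing A] : Ideal (BigWitt A) where
  carrier := {x | (∀ n, n ≠ 0 → IsNilpotent (coeff n x)) ∧ {n | coeff n x ≠ 0}.Finite}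
  zero_mem' := by
    rw [Set.mem_ofPred_eq, isFormal_iff]
    exact ⟨1, isUnit_one, by simp [series_zero]⟩
  add_mem' := by
    intro x y hx hy
    rw [Set.mem_ofPred_eq, isFormal_iff] at *
    obtain ⟨f, hf, hfx⟩ := hx
    obtain ⟨g, hg, hgy⟩ := hy
    exact ⟨f * g, hf.mul hg, by rw [Polynomial.coe_mul, hfx, hgy, series_add]⟩
  smul_mem' := by
    intro y x hx
    rw [Set.mem_ofPred_eq, isFormal_iff] at *
    obtain ⟨f, hf, hfx⟩ := hx
    have hfin : ∀ n, f.natDegree < n → coeff n x = 0 := by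
      intro n hn
      rw [coeff, ← hfx, Polynomial.coeff_coe, Polynomial.coeff_eq_zero_of_natDegree_lt hn]
    exact isUnit_mul_series f hf y x hfx

end Formal
end BigWitt

/-! ### Functoriality of the formal ideal -/

namespace BigWitt

theorem map_mem_formalIdeal {A B : Type*} [CommRing A] [CommRing B] (f : A →+* B) {x : BigWitt A}
    (hx : x ∈ formalIdeal A) : map f x ∈ formalIdeal B := by
  obtain ⟨h1, h2⟩ := hx
  refine ⟨fun n hn => ?_, h2.subset fun n hn h0 => hn ?_⟩
  · rw [show coeff n (map f x) = f (coeff n x) from coeff_mapFun f n x]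
    exact (h1 n hn).map f
  · rw [show coeff n (map f x) = f (coeff n x) from coeff_mapFun f n x, h0, map_zero]

end BigWitt

/-! ### The formal neighbourhood of the identity in `(W ⊗ R)ˣ` -/

section FormalNbhd

variable (R : Type*) [Ring R]

/-- The ring homomorphism `W(A) ⊗ R → W(B) ⊗ R` induced by `A → B`. -/
noncomputable def wittTensorMap {A B : Type*} [CommRing A] [CommRing B] (f : A →+* B) :
    BigWitt A ⊗[ℤ] R →ₐ[ℤ] BigWitt B ⊗[ℤ] R :=
  Algebra.TensorProduct.map (BigWitt.map f).toIntAlgHom (AlgHom.id ℤ R)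

/-- The finite sums of tensors `x ⊗ r` in `W(A) ⊗ R` with `x` in the ideal `Ŵ(A)`, that is `Ŵ(A) ⊗ R`. -/
noncomputable def formalTensor (A : Type*) [CommRing A] : AddSubmonoid (BigWitt A ⊗[ℤ] R) :=
  AddSubmonoid.closure {z | ∃ x ∈ BigWitt.formalIdeal A, ∃ r : R, z = x ⊗ₜ[ℤ] r}

variable {R}

theorem mul_mem_formalTensor {A : Type*} [CommRing A] {z : BigWitt A ⊗[ℤ] R}
    (hz : z ∈ formalTensor R A) (v : BigWitt A ⊗[ℤ] R) : z * v ∈ formalTensor R A := by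
  induction v using TensorProduct.induction_on with
  | zero => rw [mul_zero]; exact zero_mem _
  | add v w hv hw => rw [mul_add]; exact add_mem hv hw
  | tmul y s =>
    induction hz using AddSubmonoid.closure_induction with
    | mem z hz =>
      obtain ⟨x, hx, r, rfl⟩ := hz
      rw [Algebra.TensorProduct.tmul_mul_tmul]
      exact AddSubmonoid.subset_closure ⟨_, Ideal.mul_mem_right y _ hx, _, rfl⟩
    | zero => rw [zero_mul]; exact zero_mem _
    | add a b _ _ ha hb => rw [add_mul]; exact add_mem ha hb

theorem map_mem_formalTensor {A B : Type*} [CommRing A] [CommRing B] (f : A →+* B)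
    {z : BigWitt A ⊗[ℤ] R} (hz : z ∈ formalTensor R A) : wittTensorMap R f z ∈ formalTensor R B := by
  induction hz using AddSubmonoid.closure_induction with
  | mem z hz =>
    obtain ⟨x, hx, r, rfl⟩ := hz
    exact AddSubmonoid.subset_closure ⟨_, BigWitt.map_mem_formalIdeal f hx, r, by simp [wittTensorMap]⟩
  | zero => rw [map_zero]; exact zero_mem _
  | add a b _ _ ha hb => rw [map_add]; exact add_mem ha hb

variable (R)

/-- The group of `A`-points of the formal neighbourhood of the multiplicative identity in `(W ⊗ R)ˣ`: the units
of `W(A) ⊗ R` that differ from `1` by an element of `Ŵ(A) ⊗ R`. -/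
noncomputable def formalNbhd (A : Type*) [CommRing A] : Subgroup (BigWitt A ⊗[ℤ] R)ˣ where
  carrier := {u | (u : BigWitt A ⊗[ℤ] R) - 1 ∈ formalTensor R A}
  one_mem' := by
    show ((1 : (BigWitt A ⊗[ℤ] R)ˣ) : BigWitt A ⊗[ℤ] R) - 1 ∈ formalTensor R A
    rw [Units.val_one, sub_self]
    exact zero_mem _
  mul_mem' := by
    intro u v hu hv
    have h : ((u * v : (BigWitt A ⊗[ℤ] R)ˣ) : BigWitt A ⊗[ℤ] R) - 1 =
        ((u : BigWitt A ⊗[ℤ] R) - 1) * v + ((v : BigWitt A ⊗[ℤ] R) - 1) := by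
      rw [Units.val_mul, sub_mul, one_mul]; abel
    show ((u * v : (BigWitt A ⊗[ℤ] R)ˣ) : BigWitt A ⊗[ℤ] R) - 1 ∈ formalTensor R A
    rw [h]
    exact add_mem (mul_mem_formalTensor hu _) hv
  inv_mem' := by
    intro u hu
    have h : ((u⁻¹ : (BigWitt A ⊗[ℤ] R)ˣ) : BigWitt A ⊗[ℤ] R) - 1 =
        ((u : BigWitt A ⊗[ℤ] R) - 1) * -((u⁻¹ : (BigWitt A ⊗[ℤ] R)ˣ) : BigWitt A ⊗[ℤ] R) := by
      have e : (u : BigWitt A ⊗[ℤ] R) * -((u⁻¹ : (BigWitt A ⊗[ℤ] R)ˣ) : BigWitt A ⊗[ℤ] R) = -1 :=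
        (mul_neg _ _).trans (congrArg Neg.neg (Units.mul_inv u))
      rw [sub_mul, one_mul, e]; abel
    show ((u⁻¹ : (BigWitt A ⊗[ℤ] R)ˣ) : BigWitt A ⊗[ℤ] R) - 1 ∈ formalTensor R A
    rw [h]
    exact mul_mem_formalTensor hu _

/-- Functoriality of the formal neighbourhood. -/
noncomputable def formalNbhdMap {A B : Type*} [CommRing A] [CommRing B] (f : A →+* B)
    (u : formalNbhd R A) : formalNbhd R B :=
  ⟨Units.map (wittTensorMap R f : BigWitt A ⊗[ℤ] R →* BigWitt B ⊗[ℤ] R) u, by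
    have h := map_mem_formalTensor f (show ((u : (BigWitt A ⊗[ℤ] R)ˣ) : BigWitt A ⊗[ℤ] R) - 1 ∈ formalTensor R A from u.2)
    rw [map_sub, map_one] at h
    exact h⟩

end FormalNbhd

/-- The ring of functions on the `n`-th power of the formal neighbourhood of the identity in `(W ⊗ R)ˣ`: natural
transformations from the functor `A ↦ (formalNbhd R A)ⁿ` to the affine line `A ↦ A`. -/
def FormalFun (R : Type u) [Ring R] (n : ℕ) :
    Subring (∀ A : CommRingCat.{w}, (Fin n → formalNbhd R A) → A) where
  carrier := {g | ∀ (A B : CommRingCat.{w}) (f : A →+* B) (u : Fin n → formalNbhd R A),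
    g B (fun i => formalNbhdMap R f (u i)) = f (g A u)}
  zero_mem' := fun A B f u => by simp
  one_mem' := fun A B f u => by simp
  add_mem' := fun hg hh A B f u => by simp [hg A B f u, hh A B f u]
  mul_mem' := fun hg hh A B f u => by simp [hg A B f u, hh A B f u]
  neg_mem' := fun hg A B f u => by simp [hg A B f u]

/-- The value of a function at a tuple of points. -/
def evalAt {R : Type u} [Ring R] {n : ℕ} (g : FormalFun.{u, w} R n) {A : CommRingCat.{w}}
    (p : Fin n → formalNbhd R A) : A := g.1 A p


/-! ### Symmetric functions -/

section Symmetric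

/-- The ring of symmetric functions `Λ = ℤ[e₁, e₂, …]`; the variable `n` is the elementary symmetric
function `eₙ`. -/
abbrev SymFun : Type := MvPolynomial ℕ+ ℤ

/-- The elementary symmetric functions, with `e₀ = 1` and `eₖ = 0` for `k < 0`. -/
noncomputable def elemSym (k : ℤ) : SymFun :=
  if h : 0 < k then MvPolynomial.X ⟨k.toNat, by omega⟩ else if k = 0 then 1 else 0

/-- The series `E(t) = 1 + e₁ t + e₂ t² + ⋯`, as the universal big Witt vector. -/
noncomputable def genericWitt : BigWitt SymFun :=
  ⟨PowerSeries.mk fun n => elemSym n, by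
    rw [← PowerSeries.coeff_zero_eq_constantCoeff_apply, PowerSeries.coeff_mk]
    simp [elemSym]⟩

/-- The power sum symmetric functions, defined by `E'(t) / E(t) = p₁ - p₂ t + p₃ t² - ⋯`. -/
noncomputable def powerSum (n : ℕ) : SymFun :=
  (-1) ^ (n + 1) * PowerSeries.coeff n (BigWitt.logDer genericWitt)

/-- The Schur function of a partition, by the Jacobi–Trudi formula `det (e_{λ'ᵢ - i + j})`, where `λ'` is the
conjugate partition. -/
noncomputable def schur (μ : YoungDiagram) : SymFun :=
  (Matrix.of fun i j : Fin (μ.rowLen 0) => elemSym ((μ.colLen i : ℤ) - i + j)).det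

/-- Multipartitions: families of partitions indexed by `I`, almost all of them empty. -/
def Multipartition (I : Type*) : Type _ := {f : I → YoungDiagram // {U | f U ≠ ⊥}.Finite}

/-- The tensor product of copies of `Λ` indexed by `I`; the variable `(U, n)` is `eₙ` in the copy `U`. -/
abbrev MultiSymFun (I : Type*) : Type _ := MvPolynomial (I × ℕ+) ℤ

/-- The symmetric function `f` in the copy of `Λ` with index `U`. -/
noncomputable def inCopy {I : Type*} (U : I) : SymFun →ₐ[ℤ] MultiSymFun I :=
  MvPolynomial.rename (Prod.mk U)

/-- The product of the Schur functions `s_{λ(U)}` in the copy `U`, over all `U`. -/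
noncomputable def multiSchur {I : Type*} (μ : Multipartition I) : MultiSymFun I :=
  ∏ U ∈ μ.2.toFinset, inCopy U (schur (μ.1 U))

end Symmetric

/-! ### The rational algebra and the elements `Z` -/

section Rational

/-- The `ℚ`-algebra `ℚ ⊗ R`, as a Lie algebra under the commutator. -/
def RatLie (R : Type*) [Ring R] : Type _ := ℚ ⊗[ℤ] R

variable (R : Type*) [Ring R]

noncomputable instance : Ring (RatLie R) := inferInstanceAs (Ring (ℚ ⊗[ℤ] R))
noncomputable instance : Algebra ℚ (RatLie R) := inferInstanceAs (Algebra ℚ (ℚ ⊗[ℤ] R))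
noncomputable instance : LieRing (RatLie R) := LieRing.ofAssociativeRing
noncomputable instance : LieAlgebra ℚ (RatLie R) := LieAlgebra.ofAssociativeAlgebra

/-- The element `1 ⊗ r` of `ℚ ⊗ R`. -/
noncomputable def RatLie.of (r : R) : RatLie R := (1 : ℚ) ⊗ₜ[ℤ] r

/-- The tensor product over `i ≥ 1` of copies of the enveloping algebra of `ℚ ⊗ R` (spanned by pure tensors with
almost all factors `1`), realised as the enveloping algebra of the direct sum of copies of `ℚ ⊗ R`. -/
abbrev GQ : Type _ := UniversalEnvelopingAlgebra ℚ (DirectSum ℕ+ fun _ => RatLie R)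

variable {R}

/-- The map `Tₗ` from `ℚ ⊗ R` to the `l`-th tensor factor. -/
noncomputable def tMap (l : ℕ+) (r : RatLie R) : GQ R :=
  UniversalEnvelopingAlgebra.ι ℚ (DirectSum.of (fun _ : ℕ+ => RatLie R) l r)

/-- `log (1 + x)` for a power series `x` without constant term, in central variables, with coefficients in a
not necessarily commutative `ℚ`-algebra. -/
noncomputable def logOneAdd {σ S : Type*} [Ring S] [Algebra ℚ S] (x : MvPowerSeries σ S) :
    MvPowerSeries σ S :=
  fun m => ∑ k ∈ Finset.Icc 1 m.degree, ((-1) ^ (k + 1) / (k : ℚ)) • MvPowerSeries.coeff m (x ^ k)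

/-- `exp x` for a power series `x` without constant term. -/
noncomputable def expSeries {σ S : Type*} [Ring S] [Algebra ℚ S] (x : MvPowerSeries σ S) :
    MvPowerSeries σ S :=
  fun m => ∑ k ∈ Finset.range (m.degree + 1), (1 / (k.factorial : ℚ)) • MvPowerSeries.coeff m (x ^ k)

/-- `Θₗ(1 + x) = exp (Tₗ (log (1 + x)))`. -/
noncomputable def theta {σ : Type*} (l : ℕ+) (x : MvPowerSeries σ (RatLie R)) :
    MvPowerSeries σ (GQ R) :=
  expSeries fun m => tMap l (MvPowerSeries.coeff m (logOneAdd x))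

variable {I : Type*} (b : Module.Basis I ℤ R)

/-- The series `∑_U pₗ^{(U)} U`, in the variables `eₙ^{(U)}`. -/
noncomputable def powerSumSeries (l : ℕ+) : MvPowerSeries (I × ℕ+) (RatLie R) :=
  fun m => ∑ᶠ U, MvPolynomial.coeff m (inCopy U (powerSum l)) • RatLie.of R (b U)

/-- The degree of a monomial in the variables `eₙ^{(U)}`, where `eₙ^{(U)}` has degree `n`. -/
def symDegree (m : I × ℕ+ →₀ ℕ) : ℕ := m.sum fun s k => k * (s.2 : ℕ)

/-- The infinite product over `l ≥ 1` of `Θₗ(1 + ∑_U pₗ^{(U)} U)`.  The `l`-th factor is `1` up to degree `l - 1`,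
so that a coefficient in degree `d` is that of the product of the first `d` factors. -/
noncomputable def genSeries : MvPowerSeries (I × ℕ+) (GQ R) :=
  fun m => MvPowerSeries.coeff m
    ((List.range (symDegree m)).map fun l => theta l.succPNat (powerSumSeries b l.succPNat)).prod

/-- The equality of generating series `∑ s_λ ⊗ Z_λ = ∏ Θₗ(1 + ∑_U pₗ^{(U)} U)` that defines the `Z_λ`. -/
def IsZFamily (Z : Multipartition I → GQ R) : Prop :=
  ∀ m : I × ℕ+ →₀ ℕ, MvPowerSeries.coeff m (genSeries b) =
    ∑ᶠ μ : Multipartition I, MvPolynomial.coeff m (multiSchur μ) • Z μ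

end Rational

/-! ### Hopf structures -/

section Hopf

/-- A Hopf algebra structure on a given ring, over `ℤ`. -/
structure HopfStructure (G : Type*) [Ring G] extends Coalgebra ℤ G where
  counit_one : counit 1 = 1
  counit_mul : ∀ x y, counit (x * y) = counit x * counit y
  comul_one : comul 1 = 1
  comul_mul : ∀ x y, comul (x * y) = comul x * comul y
  antipode : G →ₗ[ℤ] G
  mul_antipode_rTensor_comul :
    LinearMap.mul' ℤ G ∘ₗ antipode.rTensor G ∘ₗ comul = Algebra.linearMap ℤ G ∘ₗ counit
  mul_antipode_lTensor_comul :
    LinearMap.mul' ℤ G ∘ₗ antipode.lTensor G ∘ₗ comul = Algebra.linearMap ℤ G ∘ₗ counit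

section GQ

variable (R : Type*) [Ring R]

attribute [local instance] LieRing.ofAssociativeRing

/-- The comultiplication on the rational algebra for which all `Tₗ(r)` are primitive. -/
noncomputable def comulQ : GQ R →ₐ[ℚ] GQ R ⊗[ℚ] GQ R :=
  UniversalEnvelopingAlgebra.lift ℚ
    { toLinearMap :=
        ((TensorProduct.mk ℚ (GQ R) (GQ R)).flip 1 + TensorProduct.mk ℚ (GQ R) (GQ R) 1) ∘ₗ
          (UniversalEnvelopingAlgebra.ι ℚ : _ →ₗ⁅ℚ⁆ GQ R).toLinearMap
      map_lie' := by
        intro x y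
        simp [LieRing.of_associative_ring_bracket, add_mul, mul_add, TensorProduct.tmul_sub]
        abel }

/-- The counit on the rational algebra. -/
noncomputable def counitQ : GQ R →ₐ[ℚ] ℚ := UniversalEnvelopingAlgebra.lift ℚ 0

/-- The antipode on the rational algebra, an anti-automorphism with `Tₗ(r) ↦ -Tₗ(r)`. -/
noncomputable def antipodeQ : GQ R →ₐ[ℚ] (GQ R)ᵐᵒᵖ :=
  UniversalEnvelopingAlgebra.lift ℚ
    { toLinearMap := -((MulOpposite.opLinearEquiv ℚ).toLinearMap ∘ₗ
          (UniversalEnvelopingAlgebra.ι ℚ : _ →ₗ⁅ℚ⁆ GQ R).toLinearMap)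
      map_lie' := by
        intro x y
        apply MulOpposite.unop_injective
        simp [LieRing.of_associative_ring_bracket] }

variable {R}

/-- The map `G ⊗ G → GQ ⊗ GQ` induced by the inclusion of a subring `G`. -/
noncomputable def inclTensor (G : Subring (GQ R)) : G ⊗[ℤ] G →ₗ[ℤ] GQ R ⊗[ℚ] GQ R :=
  TensorProduct.lift (LinearMap.mk₂ ℤ (fun x y : G => (x : GQ R) ⊗ₜ[ℚ] (y : GQ R))
    (fun x x' y => by simp [TensorProduct.add_tmul])
    (fun c x y => by simp [TensorProduct.smul_tmul'])
    (fun x y y' => by simp [TensorProduct.tmul_add])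
    (fun c x y => by
      rw [← TensorProduct.tmul_smul]; rfl))

/-- A Hopf algebra structure on a subring is restricted from the rational algebra. -/
structure HopfStructure.IsRestriction {G : Subring (GQ R)} (h : HopfStructure G) : Prop where
  comul_eq : ∀ x, inclTensor G (h.comul x) = comulQ R x
  counit_eq : ∀ x, (h.counit x : ℚ) = counitQ R x
  antipode_eq : ∀ x, (h.antipode x : GQ R) = (antipodeQ R x).unop

end GQ

/-- The functional `φ ⊗ ψ : x ⊗ y ↦ φ(x) ψ(y)`. -/
noncomputable def dualTmul {G : Type*} [Ring G] (φ ψ : Module.Dual ℤ G) : Module.Dual ℤ (G ⊗[ℤ] G) :=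
  LinearMap.mul' ℤ ℤ ∘ₗ TensorProduct.map φ ψ

namespace HopfStructure

variable {G : Type*} [Ring G] (h : HopfStructure G)

/-- The product on the full dual `G*`, dual to the comultiplication; its unit is the counit of `G`. -/
noncomputable def dualMul (φ ψ : Module.Dual ℤ G) : Module.Dual ℤ G := dualTmul φ ψ ∘ₗ h.comul

/-- The antipode on the full dual, dual to the antipode. -/
def dualAntipode (φ : Module.Dual ℤ G) : Module.Dual ℤ G := φ ∘ₗ h.antipode

end HopfStructure

/-- The comultiplication on the full dual, dual to the multiplication; it takes its values in
`(G ⊗ G)*`, the completed tensor square of `G*`. -/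
noncomputable def dualComul {G : Type*} [Ring G] (φ : Module.Dual ℤ G) : Module.Dual ℤ (G ⊗[ℤ] G) :=
  φ ∘ₗ LinearMap.mul' ℤ G

end Hopf

/-- The coordinates on the formal neighbourhood: the coordinate `(U, n)` of a point `u` is the component `aₙ`
of the coefficient of `u - 1` at the basis element `U`. -/
noncomputable def nbhdCoord {R I : Type*} [Ring R] (b : Module.Basis I ℤ R) {A : Type*} [CommRing A]
    (u : formalNbhd R A) (s : I × ℕ+) : A :=
  BigWitt.coeff s.2 ((Algebra.TensorProduct.basis (BigWitt A) b).repr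
    (((u : (BigWitt A ⊗[ℤ] R)ˣ) : BigWitt A ⊗[ℤ] R) - 1) s.1)

/-! Write ξ_m for the coefficient of the generating series at a monomial m in the variables
e_n^{(U)}. The theorem is first proved for the ξ_m. The Z_λ differ from them by an integral
unitriangular change of basis: by Jacobi–Trudi, a product of Schur functions is one monomial in the
e_n^{(U)} plus integral multiples of monomials of the same weight whose indices have a larger sum of
squares (`isLead_multiSchur`).

The core is a multiplicativity statement. For a point u of F(A) put G(u) = ∑ c^m ⊗ ξ_m, where c is
the family of coordinates of u - 1. Then G(u) G(v) = G(uv) (`evalSeries_nbhd_mul`). Indeed the l-th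
ghost component is a ring homomorphism, and it carries u to 1 + ∑ p_l(c_U) U, which is exactly the
argument of the l-th factor (`ghostTensor_nbhd`). Moreover 1 + x ↦ exp(T_l(log(1 + x))) is
multiplicative because T_l respects commutators (`expSeries_mapLin_logOneAdd_mul`): both sides solve
the same first order linear equation for the Euler derivation, and the coefficient of that equation
is a sum of iterated commutators. Factors with different l commute.

Applied to a pair of points with universal coordinates over a truncated polynomial ring,
multiplicativity shows that ξ_i ξ_j is an integral combination of the ξ_m
(`coeff_mul_coeff_mem_span`). The ξ_m are linearly independent: the generating series is grouplike,
so the polynomials obtained by applying functionals to its coefficients form an algebra; it contains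
all p_l^{(U)}, hence all monomials (`exists_dual_functional`). Thus the ξ_m are a basis of a Hopf
order with Δξ_m = ∑ ξ_i ⊗ ξ_j, whose dual is a power series ring. Pairing φ with G(u) G(v) = G(uv)
identifies the comultiplication of the dual with the product of points, and the antipode corresponds
to the inverse because it inverts the generating series.

On the geometric side, elements of Ŵ(A) are nilpotent (`isNilpotent_of_mem_formalIdeal`), so every
finite family of nilpotent coordinates defines a unit, and F is a formal affine space. A natural
function on it is determined by its values at the universal bounded points, and these values
assemble to one power series (`eval_surjective`). -/

/-! ### Locally finite sums of power series with noncommutative coefficients -/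

namespace NCSeries

section Gsum

variable {σ S : Type*} [Ring S]

/-- A sequence of power series whose `i`-th term has no monomials of degree less than `i`. -/
def IsGraded (f : ℕ → MvPowerSeries σ S) : Prop :=
  ∀ i (m : σ →₀ ℕ), m.degree < i → MvPowerSeries.coeff m (f i) = 0

/-- The sum of a sequence as in `IsGraded`. -/
noncomputable def gsum (f : ℕ → MvPowerSeries σ S) : MvPowerSeries σ S :=
  fun m => ∑ i ∈ Finset.range (m.degree + 1), MvPowerSeries.coeff m (f i)

theorem coeff_gsum (f : ℕ → MvPowerSeries σ S) (m : σ →₀ ℕ) : MvPowerSeries.coeff m (gsum f) =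
    ∑ i ∈ Finset.range (m.degree + 1), MvPowerSeries.coeff m (f i) := rfl

theorem IsGraded.coeff_gsum {f : ℕ → MvPowerSeries σ S} (hf : IsGraded f) {m : σ →₀ ℕ} {N : ℕ}
    (h : m.degree ≤ N) : MvPowerSeries.coeff m (gsum f) =
      ∑ i ∈ Finset.range (N + 1), MvPowerSeries.coeff m (f i) := by
  rw [NCSeries.coeff_gsum]
  refine Finset.sum_subset (Finset.range_subset_range.2 (by omega)) fun i _ hi => hf i m ?_
  simpa using hi

theorem gsum_congr {f g : ℕ → MvPowerSeries σ S} (h : ∀ n, f n = g n) : gsum f = gsum g := by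
  rw [funext h]

/-- At a monomial of degree N only the terms of index at most N matter, so the product becomes a
finite sum over a square of pairs of indices. The Cauchy product runs over a triangle inside this
square, and the remaining pairs contribute nothing because degrees add up. -/
theorem IsGraded.gsum_mul {f g : ℕ → MvPowerSeries σ S} (hf : IsGraded f) (hg : IsGraded g) :
    gsum f * gsum g =
      gsum fun n => ∑ p ∈ Finset.HasAntidiagonal.antidiagonal n, f p.1 * g p.2 := by
  classical
  ext m
  set N := m.degree with hN
  have e1 : ∑ p ∈ Finset.range (N + 1) ×ˢ Finset.range (N + 1),
      MvPowerSeries.coeff m (f p.1 * g p.2) = MvPowerSeries.coeff m (gsum f * gsum g) := by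
    rw [MvPowerSeries.coeff_mul]
    simp only [MvPowerSeries.coeff_mul]
    rw [Finset.sum_comm]
    refine Finset.sum_congr rfl fun q hq => ?_
    have h2 := Finset.HasAntidiagonal.mem_antidiagonal.1 hq
    have h3 : q.1.degree + q.2.degree = m.degree := by rw [← h2, map_add]
    rw [hf.coeff_gsum (N := N) (by omega), hg.coeff_gsum (N := N) (by omega), Finset.sum_mul_sum,
      Finset.sum_product]
  rw [← e1, NCSeries.coeff_gsum]
  simp only [map_sum]
  rw [Finset.sum_sigma']
  symm
  refine Finset.sum_of_injOn (fun x => x.2) ?_ ?_ ?_ ?_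
  · rintro ⟨a, b⟩ h ⟨a', b'⟩ h' hb
    simp only [Finset.coe_sigma, Finset.mem_coe, Set.mem_sigma_iff,
      Finset.HasAntidiagonal.mem_antidiagonal] at h h' hb
    subst hb
    have : a = a' := by omega
    subst this; rfl
  · rintro ⟨a, b⟩ h
    simp only [Finset.coe_sigma, Finset.mem_coe, Set.mem_sigma_iff, Finset.mem_range,
      Finset.HasAntidiagonal.mem_antidiagonal] at h
    simp only [Finset.coe_product, Set.mem_prod, Finset.mem_coe, Finset.mem_range]
    omega
  · rintro ⟨a, b⟩ _ h2
    rw [MvPowerSeries.coeff_mul]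
    refine Finset.sum_eq_zero fun q hq => ?_
    have h2' := Finset.HasAntidiagonal.mem_antidiagonal.1 hq
    have h3 : q.1.degree + q.2.degree = m.degree := by rw [← h2', map_add]
    have h4 : m.degree < a + b := by
      by_contra hlt
      refine h2 ⟨⟨a + b, (a, b)⟩, ?_, rfl⟩
      simp only [Finset.coe_sigma, Set.mem_sigma_iff, Finset.mem_coe, Finset.mem_range,
        Finset.HasAntidiagonal.mem_antidiagonal, and_true]
      omega
    dsimp only
    rcases lt_or_ge q.1.degree a with h | h
    · rw [hf _ _ h, zero_mul]
    · rw [hg b q.2 (by omega), mul_zero]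
  · intro _ _; rfl

theorem IsGraded.gsum_mul_right {f : ℕ → MvPowerSeries σ S} (hf : IsGraded f)
    (z : MvPowerSeries σ S) : gsum f * z = gsum fun n => f n * z := by
  classical
  ext m
  rw [NCSeries.coeff_gsum, MvPowerSeries.coeff_mul]
  simp only [MvPowerSeries.coeff_mul]
  rw [Finset.sum_comm]
  refine Finset.sum_congr rfl fun q hq => ?_
  have h2 := Finset.HasAntidiagonal.mem_antidiagonal.1 hq
  have h3 : q.1.degree + q.2.degree = m.degree := by rw [← h2, map_add]
  rw [hf.coeff_gsum (N := m.degree) (by omega), Finset.sum_mul]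

theorem IsGraded.mul_right {f : ℕ → MvPowerSeries σ S} (hf : IsGraded f)
    (z : MvPowerSeries σ S) : IsGraded fun n => f n * z := by
  classical
  intro n m hm
  rw [MvPowerSeries.coeff_mul]
  refine Finset.sum_eq_zero fun q hq => ?_
  have h2 := Finset.HasAntidiagonal.mem_antidiagonal.1 hq
  have h3 : q.1.degree + q.2.degree = m.degree := by rw [← h2, map_add]
  rw [hf _ _ (by omega), zero_mul]

theorem isGraded_pow {x : MvPowerSeries σ S} (hx : MvPowerSeries.constantCoeff x = 0) :
    IsGraded fun n => x ^ n := fun i m hm => by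
  refine MvPowerSeries.coeff_of_lt_order ?_
  have := MvPowerSeries.le_order_pow_of_constantCoeff_eq_zero i hx
  exact lt_of_lt_of_le (by exact_mod_cast hm) this

variable [Algebra ℚ S]

theorem coeff_smul_rat (c : ℚ) (x : MvPowerSeries σ S) (m : σ →₀ ℕ) :
    MvPowerSeries.coeff m (c • x) = c • MvPowerSeries.coeff m x := rfl

theorem IsGraded.smul {f : ℕ → MvPowerSeries σ S} (hf : IsGraded f) (c : ℕ → ℚ) :
    IsGraded fun n => c n • f n := fun i m hm => by
  rw [coeff_smul_rat, hf i m hm, smul_zero]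

/-- The exponential generating function `∑ uₙ / n!`. -/
noncomputable def egf (u : ℕ → MvPowerSeries σ S) : MvPowerSeries σ S :=
  gsum fun n => (1 / (n.factorial : ℚ)) • u n

theorem IsGraded.egf_mul {f g : ℕ → MvPowerSeries σ S} (hf : IsGraded f) (hg : IsGraded g) :
    egf f * egf g = egf fun n => ∑ p ∈ Finset.HasAntidiagonal.antidiagonal n,
      n.choose p.1 • (f p.1 * g p.2) := by
  unfold egf
  rw [(hf.smul _).gsum_mul (hg.smul _)]
  refine gsum_congr fun n => ?_
  rw [Finset.smul_sum]
  refine Finset.sum_congr rfl fun p hp => ?_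
  have h := Finset.HasAntidiagonal.mem_antidiagonal.1 hp
  rw [smul_mul_smul_comm, ← Nat.cast_smul_eq_nsmul ℚ, smul_smul]
  congr 1
  have h1 := Nat.add_choose_mul_factorial_mul_factorial p.1 p.2
  rw [← Nat.choose_symm_add, h] at h1
  have h2 : (p.1.factorial : ℚ) ≠ 0 := by positivity
  have h3 : (p.2.factorial : ℚ) ≠ 0 := by positivity
  have h4 : (n.factorial : ℚ) ≠ 0 := by positivity
  field_simp
  have : ((n.choose p.1 : ℕ) : ℚ) * p.1.factorial * p.2.factorial = n.factorial := by exact_mod_cast h1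
  linarith

theorem expSeries_eq (x : MvPowerSeries σ S) : expSeries x = egf fun n => x ^ n := rfl

/-- The sum on the right starts at n = 0, which is harmless: division by zero in ℚ gives 0, so that
term vanishes. -/
theorem logOneAdd_eq (x : MvPowerSeries σ S) :
    logOneAdd x = gsum fun n => ((-1) ^ (n + 1) / (n : ℚ)) • x ^ n := by
  ext m
  rw [NCSeries.coeff_gsum, Finset.sum_range_succ']
  simp only [Nat.cast_zero, div_zero, zero_smul, map_zero, add_zero]
  show ∑ k ∈ Finset.Icc 1 m.degree, _ = _
  rw [Finset.range_eq_Ico, Finset.sum_Ico_add' (fun k : ℕ => MvPowerSeries.coeff m (((-1) ^ (k + 1) / (k : ℚ)) • x ^ k))]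
  rfl

theorem constantCoeff_expSeries (x : MvPowerSeries σ S) :
    MvPowerSeries.constantCoeff (expSeries x) = 1 := by
  rw [← MvPowerSeries.coeff_zero_eq_constantCoeff_apply, expSeries_eq, egf, NCSeries.coeff_gsum]
  simp

theorem constantCoeff_logOneAdd (x : MvPowerSeries σ S) :
    MvPowerSeries.constantCoeff (logOneAdd x) = 0 := by
  rw [← MvPowerSeries.coeff_zero_eq_constantCoeff_apply, logOneAdd_eq, NCSeries.coeff_gsum]
  simp

theorem expSeries_add {x y : MvPowerSeries σ S} (hx : MvPowerSeries.constantCoeff x = 0)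
    (hy : MvPowerSeries.constantCoeff y = 0) (h : Commute x y) :
    expSeries (x + y) = expSeries x * expSeries y := by
  rw [expSeries_eq, expSeries_eq, expSeries_eq, (isGraded_pow hx).egf_mul (isGraded_pow hy)]
  congr 1
  funext n
  rw [h.add_pow']

theorem expSeries_zero : expSeries (0 : MvPowerSeries σ S) = 1 := by
  classical
  ext m
  rw [expSeries_eq, egf, NCSeries.coeff_gsum, Finset.sum_eq_single 0]
  · simp
  · intro k _ hk; simp [hk]
  · simp

theorem expSeries_mul_neg {x : MvPowerSeries σ S} (hx : MvPowerSeries.constantCoeff x = 0) :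
    expSeries x * expSeries (-x) = 1 := by
  rw [← expSeries_add hx (by simpa using hx) (Commute.refl x).neg_right, add_neg_cancel, expSeries_zero]

theorem expSeries_neg_mul {x : MvPowerSeries σ S} (hx : MvPowerSeries.constantCoeff x = 0) :
    expSeries (-x) * expSeries x = 1 := by
  rw [← expSeries_add (by simpa using hx) hx (Commute.refl x).neg_left, neg_add_cancel, expSeries_zero]

/-! ### `exp (log (1 + x)) = 1 + x` -/

/-- Substitution of a series without constant term into a power series in one variable. -/
noncomputable def psEval (x : MvPowerSeries σ S) (f : ℚ⟦X⟧) : MvPowerSeries σ S :=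
  gsum fun n => PowerSeries.coeff n f • x ^ n

theorem psEval_mul {x : MvPowerSeries σ S} (hx : MvPowerSeries.constantCoeff x = 0) (f g : ℚ⟦X⟧) :
    psEval x (f * g) = psEval x f * psEval x g := by
  unfold psEval
  rw [((isGraded_pow hx).smul _).gsum_mul ((isGraded_pow hx).smul _)]
  refine gsum_congr fun n => ?_
  rw [PowerSeries.coeff_mul, Finset.sum_smul]
  refine Finset.sum_congr rfl fun p hp => ?_
  rw [smul_mul_smul_comm, ← pow_add, Finset.HasAntidiagonal.mem_antidiagonal.1 hp]

theorem psEval_one (x : MvPowerSeries σ S) : psEval x 1 = 1 := by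
  ext m
  rw [psEval, NCSeries.coeff_gsum, Finset.sum_eq_single 0]
  · simp
  · intro k _ hk; simp [PowerSeries.coeff_one, hk]
  · simp

theorem psEval_pow {x : MvPowerSeries σ S} (hx : MvPowerSeries.constantCoeff x = 0) (f : ℚ⟦X⟧)
    (k : ℕ) : psEval x (f ^ k) = psEval x f ^ k := by
  induction k with
  | zero => rw [pow_zero, pow_zero, psEval_one]
  | succ k ih => rw [pow_succ, pow_succ, psEval_mul hx, ih]

/-- The composite f satisfies (1 + X) f' = f with constant term 1, that is (n + 1) f_{n+1} = (1 - n)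
f_n. The factor 1 - n stops the recursion after degree one. -/
theorem exp_subst_log : (PowerSeries.exp ℚ).subst (PowerSeries.log ℚ) = (1 + X : ℚ⟦X⟧) := by
  set f : ℚ⟦X⟧ := (PowerSeries.exp ℚ).subst (PowerSeries.log ℚ) with hf
  have h1 : d⁄dX ℚ f = f * d⁄dX ℚ (PowerSeries.log ℚ) := by
    rw [hf, PowerSeries.derivative_subst PowerSeries.HasSubst.log, PowerSeries.derivative_exp]
  have h2 : d⁄dX ℚ (PowerSeries.log ℚ) * (1 + X) = 1 := by
    rw [PowerSeries.deriv_log]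
    ext n
    rw [mul_add, mul_one, map_add, PowerSeries.coeff_mk, PowerSeries.coeff_one]
    cases n with
    | zero => simp
    | succ n => rw [PowerSeries.coeff_succ_mul_X]; simp [pow_succ]
  have h3 : d⁄dX ℚ f * (1 + X) = f := by rw [h1, mul_assoc, h2, mul_one]
  have h0 : PowerSeries.coeff 0 f = 1 := by
    rw [hf, PowerSeries.coeff_subst' PowerSeries.HasSubst.log, finsum_eq_single _ 0]
    · simp
    · intro k hk
      rw [PowerSeries.coeff_zero_eq_constantCoeff_apply, map_pow, PowerSeries.constantCoeff_log,
        zero_pow hk, smul_zero]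
  have hrec : ∀ n : ℕ, PowerSeries.coeff (n + 1) f * (n + 1) + PowerSeries.coeff n f * n =
      PowerSeries.coeff n f := by
    intro n
    have := congrArg (PowerSeries.coeff n) h3
    rw [mul_add, mul_one, map_add, PowerSeries.coeff_derivative] at this
    cases n with
    | zero => simpa using this
    | succ n => 
      rw [PowerSeries.coeff_succ_mul_X, PowerSeries.coeff_derivative] at this
      push_cast at this ⊢
      linarith
  have h1' : PowerSeries.coeff 1 f = 1 := by
    have := hrec 0
    simpa [h0] using this
  have h2' : ∀ n, PowerSeries.coeff (n + 2) f = 0 := by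
    intro n
    induction n with
    | zero => 
      have := hrec 1
      rw [h1'] at this
      norm_num at this
      simpa using this
    | succ n ih =>
      have := hrec (n + 2)
      rw [ih, zero_mul, add_zero] at this
      have h : ((n + 2 : ℕ) : ℚ) + 1 ≠ 0 := by positivity
      exact (mul_eq_zero.1 this).resolve_right h
  ext n
  rcases n with _ | _ | n
  · simp [h0]
  · simp [h1', PowerSeries.coeff_one]
  · rw [h2']; simp [PowerSeries.coeff_one, PowerSeries.coeff_X]

/-- Finite form of the previous identity: the k-th power of the logarithm starts in degree k, so the
sum may be cut at any N ≥ n. -/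
theorem sum_coeff_log_pow (n N : ℕ) (h : n ≤ N) :
    ∑ k ∈ Finset.range (N + 1), (1 / (k.factorial : ℚ)) *
      PowerSeries.coeff n (PowerSeries.log ℚ ^ k) = PowerSeries.coeff n (1 + X : ℚ⟦X⟧) := by
  rw [← exp_subst_log, PowerSeries.coeff_subst' PowerSeries.HasSubst.log,
    finsum_eq_sum_of_support_subset (s := Finset.range (N + 1))]
  · refine Finset.sum_congr rfl fun k _ => ?_
    rw [PowerSeries.coeff_exp, smul_eq_mul]; rfl
  · intro k hk
    by_contra hlt
    apply hk
    have : n < k := by simpa using lt_of_le_of_lt h (by simpa using hlt)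
    have h0 : MvPowerSeries.coeff (Finsupp.single () n) (PowerSeries.log ℚ ^ k) = 0 :=
      isGraded_pow (x := PowerSeries.log ℚ) PowerSeries.constantCoeff_log k _ (by simpa using this)
    show _ • MvPowerSeries.coeff (Finsupp.single () n) (PowerSeries.log ℚ ^ k) = 0
    rw [h0, smul_zero]

/-- Only powers of the single element x occur, and these commute. The claim is therefore the
identity in ℚ⟦X⟧ with x substituted, even if S is noncommutative. -/
theorem expSeries_logOneAdd {x : MvPowerSeries σ S} (hx : MvPowerSeries.constantCoeff x = 0) :
    expSeries (logOneAdd x) = 1 + x := by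
  have hl : logOneAdd x = psEval x (PowerSeries.log ℚ) := by
    rw [logOneAdd_eq, psEval]
    refine gsum_congr fun n => ?_
    rw [PowerSeries.coeff_log]
    split_ifs with h
    · subst h; simp
    · rfl
  have h1 : psEval x (1 + X) = 1 + x := by
    ext m
    -- The cut-off is one more than the degree, so that the terms of index 0 and 1 can always be
    -- split off.
    rw [psEval, ((isGraded_pow hx).smul _).coeff_gsum (N := m.degree + 1) (by omega),
      Finset.sum_range_succ', Finset.sum_range_succ']
    rw [Finset.sum_eq_zero]
    · simp [PowerSeries.coeff_one, add_comm]
    · intro k _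
      simp [PowerSeries.coeff_one, PowerSeries.coeff_X]
  rw [← h1]
  ext m
  rw [hl, expSeries_eq, egf, NCSeries.coeff_gsum]
  conv_rhs => rw [psEval, NCSeries.coeff_gsum]
  simp only [coeff_smul_rat]
  have h2 : ∀ k, MvPowerSeries.coeff m (psEval x (PowerSeries.log ℚ) ^ k) =
      ∑ n ∈ Finset.range (m.degree + 1), PowerSeries.coeff n (PowerSeries.log ℚ ^ k) •
        MvPowerSeries.coeff m (x ^ n) := by
    intro k
    rw [← psEval_pow hx]; rfl
  simp only [h2, Finset.smul_sum]
  rw [Finset.sum_comm]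
  refine Finset.sum_congr rfl fun n hn => ?_
  simp only [smul_smul]
  rw [← Finset.sum_smul, sum_coeff_log_pow n _ (by simpa using Nat.lt_succ_iff.1 (by simpa using hn))]

end Gsum

/-! ### The Euler derivation -/

section Euler

variable {σ S : Type*} [Ring S]

/-- The derivation that multiplies a monomial by its degree. -/
noncomputable def euler : MvPowerSeries σ S →+ MvPowerSeries σ S where
  toFun x := fun m => m.degree • MvPowerSeries.coeff m x
  map_zero' := by ext m; show m.degree • MvPowerSeries.coeff m (0 : MvPowerSeries σ S) = 0; simp
  map_add' x y := by
    ext m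
    show m.degree • MvPowerSeries.coeff m (x + y) = m.degree • MvPowerSeries.coeff m x +
      m.degree • MvPowerSeries.coeff m y
    rw [map_add, smul_add]

theorem coeff_euler (x : MvPowerSeries σ S) (m : σ →₀ ℕ) :
    MvPowerSeries.coeff m (euler x) = m.degree • MvPowerSeries.coeff m x := rfl

theorem euler_mul (x y : MvPowerSeries σ S) : euler (x * y) = euler x * y + x * euler y := by
  classical
  ext m
  rw [coeff_euler, map_add, MvPowerSeries.coeff_mul, MvPowerSeries.coeff_mul,
    MvPowerSeries.coeff_mul, Finset.smul_sum, ← Finset.sum_add_distrib]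
  refine Finset.sum_congr rfl fun p hp => ?_
  rw [← Finset.HasAntidiagonal.mem_antidiagonal.1 hp, map_add, coeff_euler, coeff_euler, add_smul,
    smul_mul_assoc, mul_smul_comm]

theorem euler_one : euler (1 : MvPowerSeries σ S) = 0 := by
  have := euler_mul (1 : MvPowerSeries σ S) 1
  simpa using this

theorem constantCoeff_euler (x : MvPowerSeries σ S) :
    MvPowerSeries.constantCoeff (euler x) = 0 := by
  rw [← MvPowerSeries.coeff_zero_eq_constantCoeff_apply, coeff_euler]; simp

/-- A linear differential equation for the Euler derivation has at most one solution with given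
constant term. -/
theorem eq_of_euler_eq [Algebra ℚ S] {a f g : MvPowerSeries σ S}
    (ha : MvPowerSeries.constantCoeff a = 0) (hf : euler f = a * f) (hg : euler g = a * g)
    (h0 : MvPowerSeries.constantCoeff f = MvPowerSeries.constantCoeff g) : f = g := by
  classical
  have key : ∀ (N : ℕ) (m : σ →₀ ℕ), m.degree = N → MvPowerSeries.coeff m f = MvPowerSeries.coeff m g := by
    intro N
    induction N using Nat.strong_induction_on with
    | _ N ih =>
      intro m hm
      by_cases hN : N = 0
      · have : m = 0 := by rw [← Finsupp.degree_eq_zero_iff, hm, hN]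
        subst this
        simpa using h0
      have e1 := congrArg (MvPowerSeries.coeff m) hf
      have e2 := congrArg (MvPowerSeries.coeff m) hg
      rw [coeff_euler, MvPowerSeries.coeff_mul] at e1 e2
      -- The series `a` has no constant term, so the right-hand side involves only coefficients of
      -- `f` and `g` in degrees below that of `m`.
      have e3 : m.degree • MvPowerSeries.coeff m f = m.degree • MvPowerSeries.coeff m g := by
        rw [e1, e2]
        refine Finset.sum_congr rfl fun p hp => ?_
        have hp' := Finset.HasAntidiagonal.mem_antidiagonal.1 hp
        by_cases h1 : p.1 = 0
        · rw [h1, MvPowerSeries.coeff_zero_eq_constantCoeff_apply, ha, zero_mul, zero_mul]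
        · have h2 : p.1.degree ≠ 0 := fun h => h1 ((Finsupp.degree_eq_zero_iff _).1 h)
          have h3 : p.1.degree + p.2.degree = m.degree := by rw [← hp', map_add]
          rw [ih p.2.degree (by omega) p.2 rfl]
      rw [hm, ← Nat.cast_smul_eq_nsmul ℚ, ← Nat.cast_smul_eq_nsmul ℚ] at e3
      exact smul_right_injective S (Nat.cast_ne_zero.2 hN : (N : ℚ) ≠ 0) e3
  exact MvPowerSeries.ext fun m => key _ m rfl

theorem IsGraded.euler {f : ℕ → MvPowerSeries σ S} (hf : IsGraded f) :
    IsGraded fun n => euler (f n) := fun i m hm => by rw [coeff_euler, hf i m hm, smul_zero]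

theorem euler_egf [Algebra ℚ S] (f : ℕ → MvPowerSeries σ S) :
    euler (egf f) = egf fun n => euler (f n) := by
  ext m
  rw [coeff_euler, egf, egf, NCSeries.coeff_gsum, NCSeries.coeff_gsum, Finset.smul_sum]
  refine Finset.sum_congr rfl fun k _ => ?_
  rw [coeff_smul_rat, coeff_smul_rat, coeff_euler, smul_comm]

end Euler

/-! ### Iterated commutators -/

section Ad

variable {B : Type*} [Ring B]

/-- `∑ (n choose i) uᵢ (-x)ⁿ⁻ⁱ`. -/
def adSum (x : B) (u : ℕ → B) (n : ℕ) : B :=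
  ∑ p ∈ Finset.HasAntidiagonal.antidiagonal n, n.choose p.1 • (u p.1 * (-x) ^ p.2)

/-- Pascal's rule turns the binomial sums into a recursion by commutators with x. For uᵢ = xⁱ z it
yields the iterated commutators of x with z, for uᵢ = D(xⁱ) those of x with D x. In this form the
sums can be transported by a map that only respects commutators. -/
theorem adSum_succ (x : B) (u w : ℕ → B) (h : ∀ i, u (i + 1) = x * u i + w i) (n : ℕ) :
    adSum x u (n + 1) = x * adSum x u n - adSum x u n * x + adSum x w n := by
  have h1 : adSum x u (n + 1) = _ :=
    Finset.sum_antidiagonal_choose_succ_nsmul (M := B) (fun i j => u i * (-x) ^ j) n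
  rw [h1]
  unfold adSum
  rw [Finset.mul_sum, Finset.sum_mul, sub_eq_neg_add, ← Finset.sum_neg_distrib, add_assoc,
    ← Finset.sum_add_distrib, ← Finset.sum_add_distrib, ← Finset.sum_add_distrib]
  refine Finset.sum_congr rfl fun p hp => ?_
  rw [Nat.choose_symm_of_eq_add (Finset.HasAntidiagonal.mem_antidiagonal.1 hp).symm, h, pow_succ,
    mul_neg, mul_neg, smul_neg, smul_mul_assoc, mul_assoc, add_mul, smul_add, mul_smul_comm, mul_assoc]

theorem adSum_zero (x : B) (u : ℕ → B) : adSum x u 0 = u 0 := by simp [adSum]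

theorem adSum_pow_mul_succ (x z : B) (n : ℕ) :
    adSum x (fun i => x ^ i * z) (n + 1) =
      x * adSum x (fun i => x ^ i * z) n - adSum x (fun i => x ^ i * z) n * x := by
  rw [adSum_succ x _ (fun _ => 0) (fun i => by simp [pow_succ', mul_assoc])]
  simp [adSum]

/-- The inhomogeneous part is D x times the binomial expansion of (x - x)ⁿ, which survives only for
n = 0. Since D 1 = 0, the sum of index n + 1 is thus the n-fold commutator of x with D x. -/
theorem adSum_der_succ (D : B →+ B) (hD : ∀ a b, D (a * b) = D a * b + a * D b) (x : B) (n : ℕ) :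
    adSum x (fun i => D (x ^ i)) (n + 1) =
      x * adSum x (fun i => D (x ^ i)) n - adSum x (fun i => D (x ^ i)) n * x +
        if n = 0 then D x else 0 := by
  rw [adSum_succ x _ (fun i => D x * x ^ i) (fun i => by rw [pow_succ', hD, add_comm])]
  congr 1
  unfold adSum
  have h := (Commute.refl x).neg_right.add_pow' n
  rw [add_neg_cancel] at h
  rw [Finset.sum_congr rfl (fun p _ => by rw [mul_assoc, ← mul_smul_comm]), ← Finset.mul_sum, ← h]
  split_ifs with h0
  · rw [h0, pow_zero, mul_one]
  · rw [zero_pow h0, mul_zero]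

end Ad

/-! ### Conjugation by exponentials and their logarithmic derivatives -/

section Conj

variable {σ S : Type*} [Ring S] [Algebra ℚ S]

theorem expSeries_conj {x : MvPowerSeries σ S} (hx : MvPowerSeries.constantCoeff x = 0)
    (z : MvPowerSeries σ S) :
    expSeries x * z * expSeries (-x) = egf (adSum x fun i => x ^ i * z) := by
  have h1 : expSeries x * z = egf fun i => x ^ i * z := by
    rw [expSeries_eq, egf, ((isGraded_pow hx).smul _).gsum_mul_right]
    exact gsum_congr fun n => smul_mul_assoc _ _ _
  rw [h1, expSeries_eq, ((isGraded_pow hx).mul_right z).egf_mul (isGraded_pow (by simpa using hx))]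
  rfl

theorem euler_expSeries_mul {x : MvPowerSeries σ S} (hx : MvPowerSeries.constantCoeff x = 0) :
    euler (expSeries x) * expSeries (-x) = egf (adSum x fun i => euler (x ^ i)) := by
  rw [expSeries_eq, expSeries_eq, euler_egf,
    (isGraded_pow hx).euler.egf_mul (isGraded_pow (by simpa using hx))]
  rfl

end Conj

/-! ### Multiplicativity of `exp ∘ T ∘ log` -/

section Theta

variable {σ S S' : Type*} [Ring S] [Ring S'] [Algebra ℚ S] [Algebra ℚ S']

/-- The coefficientwise application of a linear map. -/
noncomputable def mapLin (T : S →ₗ[ℚ] S') : MvPowerSeries σ S →ₗ[ℚ] MvPowerSeries σ S' where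
  toFun x := fun m => T (MvPowerSeries.coeff m x)
  map_add' x y := by
    ext m
    show T (MvPowerSeries.coeff m (x + y)) = T (MvPowerSeries.coeff m x) + T (MvPowerSeries.coeff m y)
    rw [map_add, map_add]
  map_smul' c x := by
    ext m
    show T (MvPowerSeries.coeff m (c • x)) = c • T (MvPowerSeries.coeff m x)
    rw [coeff_smul_rat, map_smul]

variable (T : S →ₗ[ℚ] S')

theorem coeff_mapLin (x : MvPowerSeries σ S) (m : σ →₀ ℕ) :
    MvPowerSeries.coeff m (mapLin T x) = T (MvPowerSeries.coeff m x) := rfl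

theorem constantCoeff_mapLin {x : MvPowerSeries σ S} (hx : MvPowerSeries.constantCoeff x = 0) :
    MvPowerSeries.constantCoeff (mapLin T x) = 0 := by
  rw [← MvPowerSeries.coeff_zero_eq_constantCoeff_apply] at *
  rw [coeff_mapLin, hx, map_zero]

theorem mapLin_egf (f : ℕ → MvPowerSeries σ S) :
    mapLin T (egf f) = egf fun n => mapLin T (f n) := by
  ext m
  rw [coeff_mapLin, egf, egf, NCSeries.coeff_gsum, NCSeries.coeff_gsum, map_sum]
  refine Finset.sum_congr rfl fun k _ => ?_
  rw [coeff_smul_rat, coeff_smul_rat, map_smul, coeff_mapLin]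

theorem mapLin_euler (x : MvPowerSeries σ S) : mapLin T (euler x) = euler (mapLin T x) := by
  ext m
  rw [coeff_mapLin, coeff_euler, coeff_euler, map_nsmul, coeff_mapLin]

theorem sum_antidiagonal_swap [DecidableEq σ] {M : Type*} [AddCommMonoid M] (m : σ →₀ ℕ)
    (f : (σ →₀ ℕ) → (σ →₀ ℕ) → M) :
    ∑ p ∈ Finset.HasAntidiagonal.antidiagonal m, f p.1 p.2 =
      ∑ p ∈ Finset.HasAntidiagonal.antidiagonal m, f p.2 p.1 :=
  Finset.sum_equiv (Equiv.prodComm _ _)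
    (fun p => by simp [Finset.HasAntidiagonal.mem_antidiagonal, add_comm]) fun _ _ => rfl

variable {T} (hT : ∀ a b, T (a * b - b * a) = T a * T b - T b * T a)
include hT

/-- The variables are central, so after swapping the factors in one of the two convolutions each
coefficient is a sum of commutators of coefficients. -/
theorem mapLin_lie (x y : MvPowerSeries σ S) :
    mapLin T (x * y - y * x) = mapLin T x * mapLin T y - mapLin T y * mapLin T x := by
  classical
  ext m
  rw [coeff_mapLin, map_sub, map_sub (MvPowerSeries.coeff m), MvPowerSeries.coeff_mul,
    MvPowerSeries.coeff_mul, MvPowerSeries.coeff_mul, MvPowerSeries.coeff_mul]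
  rw [sum_antidiagonal_swap m fun a b => MvPowerSeries.coeff a y * MvPowerSeries.coeff b x,
    sum_antidiagonal_swap m fun a b =>
      MvPowerSeries.coeff a (mapLin T y) * MvPowerSeries.coeff b (mapLin T x),
    ← Finset.sum_sub_distrib, ← Finset.sum_sub_distrib, map_sum]
  refine Finset.sum_congr rfl fun p _ => ?_
  exact hT _ _

/-- Conjugation by exp x is the exponential series in the commutator with x, so it is carried over
by a linear map that preserves commutators, although such a map need not respect products. The same
argument applies to the logarithmic derivative in `mapLin_logDer`. -/
theorem mapLin_conj {x : MvPowerSeries σ S} (hx : MvPowerSeries.constantCoeff x = 0)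
    (z : MvPowerSeries σ S) :
    mapLin T (expSeries x * z * expSeries (-x)) =
      expSeries (mapLin T x) * mapLin T z * expSeries (-mapLin T x) := by
  rw [expSeries_conj hx, expSeries_conj (constantCoeff_mapLin T hx), mapLin_egf]
  congr 1
  funext n
  induction n with
  | zero => simp [adSum_zero]
  | succ n ih => rw [adSum_pow_mul_succ, adSum_pow_mul_succ, mapLin_lie hT, ih]

theorem mapLin_logDer {x : MvPowerSeries σ S} (hx : MvPowerSeries.constantCoeff x = 0) :
    mapLin T (euler (expSeries x) * expSeries (-x)) =
      euler (expSeries (mapLin T x)) * expSeries (-mapLin T x) := by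
  rw [euler_expSeries_mul hx, euler_expSeries_mul (constantCoeff_mapLin T hx), mapLin_egf]
  congr 1
  funext n
  induction n with
  | zero => simp [adSum_zero, euler_one]
  | succ n ih =>
    rw [adSum_der_succ _ euler_mul, adSum_der_succ _ euler_mul, map_add, mapLin_lie hT, ih]
    split_ifs
    · rw [mapLin_euler]
    · rw [map_zero]

/-- For a linear map `T` that preserves commutators, `1 + x ↦ exp (T (log (1 + x)))` is
multiplicative. -/
theorem expSeries_mapLin_logOneAdd_mul {x y : MvPowerSeries σ S}
    (hx : MvPowerSeries.constantCoeff x = 0) (hy : MvPowerSeries.constantCoeff y = 0) :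
    expSeries (mapLin T (logOneAdd x)) * expSeries (mapLin T (logOneAdd y)) =
      expSeries (mapLin T (logOneAdd (x + y + x * y))) := by
  have hz : MvPowerSeries.constantCoeff (x + y + x * y) = 0 := by simp [hx, hy]
  set P := logOneAdd x with hP
  set Q := logOneAdd y with hQ
  set W := logOneAdd (x + y + x * y) with hW
  have hP0 : MvPowerSeries.constantCoeff P = 0 := constantCoeff_logOneAdd x
  have hQ0 : MvPowerSeries.constantCoeff Q = 0 := constantCoeff_logOneAdd y
  have hW0 : MvPowerSeries.constantCoeff W = 0 := constantCoeff_logOneAdd _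
  have hWe : expSeries W = expSeries P * expSeries Q := by
    rw [hW, hP, hQ, expSeries_logOneAdd hz, expSeries_logOneAdd hx, expSeries_logOneAdd hy]
    noncomm_ring
  have hWi : expSeries (-W) = expSeries (-Q) * expSeries (-P) := by
    refine left_inv_eq_right_inv (expSeries_neg_mul hW0) ?_
    rw [hWe, mul_assoc, ← mul_assoc _ (expSeries (-Q)), expSeries_mul_neg hQ0, one_mul,
      expSeries_mul_neg hP0]
  -- Thus exp(T V) solves a linear equation whose coefficient is T applied to the logarithmic
  -- derivative of exp V.
  have hode : ∀ {V : MvPowerSeries σ S}, MvPowerSeries.constantCoeff V = 0 →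
      euler (expSeries (mapLin T V)) =
        mapLin T (euler (expSeries V) * expSeries (-V)) * expSeries (mapLin T V) := by
    intro V hV
    rw [mapLin_logDer hT hV, mul_assoc, expSeries_neg_mul (constantCoeff_mapLin T hV), mul_one]
  -- Both sides are shown to solve the equation belonging to W, where exp W = exp P exp Q.
  -- Uniqueness of the solution replaces the Baker–Campbell–Hausdorff formula.
  refine eq_of_euler_eq (a := mapLin T (euler (expSeries W) * expSeries (-W))) ?_ ?_ (hode hW0) ?_
  · apply constantCoeff_mapLin
    rw [map_mul, constantCoeff_euler, zero_mul]
  · have hPT := constantCoeff_mapLin T hP0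
    -- Moving exp(T P) to the right conjugates the coefficient, and this conjugation may be
    -- performed before applying T.
    have e1 : expSeries (mapLin T P) * mapLin T (euler (expSeries Q) * expSeries (-Q)) =
        mapLin T (expSeries P * (euler (expSeries Q) * expSeries (-Q)) * expSeries (-P)) *
          expSeries (mapLin T P) := by
      rw [mapLin_conj hT hP0, mul_assoc (_ * _), expSeries_neg_mul hPT, mul_one]
    rw [euler_mul, hode hP0, hode hQ0, ← mul_assoc (expSeries (mapLin T P)), e1, hWi, hWe, euler_mul]
    -- The logarithmic derivative of a product: that of the first factor plus the conjugate, by the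
    -- first factor, of that of the second.
    have e2 : (euler (expSeries P) * expSeries Q + expSeries P * euler (expSeries Q)) *
        (expSeries (-Q) * expSeries (-P)) = euler (expSeries P) * expSeries (-P) +
        expSeries P * (euler (expSeries Q) * expSeries (-Q)) * expSeries (-P) := by
      rw [add_mul]
      congr 1
      · rw [mul_assoc, ← mul_assoc (expSeries Q), expSeries_mul_neg hQ0, one_mul]
      · noncomm_ring
    rw [e2, map_add]
    noncomm_ring
  · rw [map_mul]
    simp only [constantCoeff_expSeries, mul_one]

end Theta

end NCSeries

/-! ### The rational algebra -/

namespace NCSeries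

/-! ### Functoriality of the exponential and products of commuting factors -/

section Functorial

variable {σ S S' : Type*} [Ring S] [Ring S']

theorem commute_of_coeff {x y : MvPowerSeries σ S}
    (h : ∀ m n, Commute (MvPowerSeries.coeff m x) (MvPowerSeries.coeff n y)) : Commute x y := by
  classical
  refine MvPowerSeries.ext fun m => ?_
  rw [MvPowerSeries.coeff_mul, MvPowerSeries.coeff_mul,
    sum_antidiagonal_swap m fun a b => MvPowerSeries.coeff a x * MvPowerSeries.coeff b y]
  exact Finset.sum_congr rfl fun p _ => h _ _

variable [Algebra ℚ S] [Algebra ℚ S']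

theorem map_expSeries (f : S →ₐ[ℚ] S') (x : MvPowerSeries σ S) :
    MvPowerSeries.map (f : S →+* S') (expSeries x) =
      expSeries (MvPowerSeries.map (f : S →+* S') x) := by
  ext m
  rw [MvPowerSeries.coeff_map, expSeries_eq, expSeries_eq, egf, egf, coeff_gsum, coeff_gsum, map_sum]
  refine Finset.sum_congr rfl fun k _ => ?_
  rw [coeff_smul_rat, coeff_smul_rat, ← map_pow, MvPowerSeries.coeff_map]
  exact map_smul f _ _

theorem commute_expSeries {x y : MvPowerSeries σ S} (hx : MvPowerSeries.constantCoeff x = 0)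
    (hy : MvPowerSeries.constantCoeff y = 0) (h : Commute x y) :
    Commute (expSeries x) (expSeries y) := by
  rw [Commute, SemiconjBy, ← expSeries_add hx hy h, ← expSeries_add hy hx h.symm, add_comm]

end Functorial

/-- Each f_L has to pass only the g_j with j < L, so f_L and g_L need not commute; this is needed
since Θ_l(1 + x) and Θ_l(1 + y) do not. -/
theorem list_prod_mul_prod {M : Type*} [Monoid M] (f g : ℕ → M)
    (h : ∀ i j, i ≠ j → Commute (f i) (g j)) (L : ℕ) :
    ((List.range L).map f).prod * ((List.range L).map g).prod =
      ((List.range L).map fun i => f i * g i).prod := by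
  induction L with
  | zero => simp
  | succ L ih =>
    have hc : Commute (f L) ((List.range L).map g).prod := by
      refine Commute.list_prod_right _ _ fun x hx => ?_
      obtain ⟨j, hj, rfl⟩ := List.mem_map.1 hx
      exact h _ _ (by have := List.mem_range.1 hj; omega)
    simp only [List.range_succ, List.map_append, List.prod_append, List.map_singleton,
      List.prod_singleton]
    rw [← ih, mul_assoc, ← mul_assoc (f L), hc.eq]
    simp only [mul_assoc]

end NCSeries

open NCSeries

/-! ### The maps T_l, the series Θ_l and the projections to the factors -/

section TMap

variable {R : Type*} [Ring R]

attribute [local instance] LieRing.ofAssociativeRing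

/-- The map `Tₗ` as a linear map. -/
noncomputable def tLin (l : ℕ+) : RatLie R →ₗ[ℚ] GQ R :=
  (UniversalEnvelopingAlgebra.ι ℚ : _ →ₗ⁅ℚ⁆ GQ R).toLinearMap ∘ₗ
    DirectSum.lof ℚ ℕ+ (fun _ => RatLie R) l

theorem tLin_commutator (l : ℕ+) (a b : RatLie R) :
    tLin l (a * b - b * a) = tLin l a * tLin l b - tLin l b * tLin l a := by
  show UniversalEnvelopingAlgebra.ι ℚ (DirectSum.of (fun _ : ℕ+ => RatLie R) l ⁅a, b⁆) =
    ⁅(UniversalEnvelopingAlgebra.ι ℚ (DirectSum.of (fun _ : ℕ+ => RatLie R) l a) : GQ R),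
      UniversalEnvelopingAlgebra.ι ℚ (DirectSum.of (fun _ : ℕ+ => RatLie R) l b)⁆
  rw [← LieHom.map_lie, DirectSum.lie_of_same]

theorem tLin_commute {l k : ℕ+} (h : l ≠ k) (a b : RatLie R) : Commute (tLin l a) (tLin k b) := by
  have h1 : ⁅(UniversalEnvelopingAlgebra.ι ℚ (DirectSum.of (fun _ : ℕ+ => RatLie R) l a) : GQ R),
      UniversalEnvelopingAlgebra.ι ℚ (DirectSum.of (fun _ : ℕ+ => RatLie R) k b)⁆ = 0 := by
    rw [← LieHom.map_lie, DirectSum.lie_of_of_ne _ h, map_zero]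
  exact sub_eq_zero.1 h1

theorem theta_eq {σ : Type*} (l : ℕ+) (x : MvPowerSeries σ (RatLie R)) :
    theta l x = expSeries (mapLin (tLin l) (logOneAdd x)) := rfl

theorem constantCoeff_mapLin_logOneAdd {σ : Type*} (l : ℕ+) (x : MvPowerSeries σ (RatLie R)) :
    MvPowerSeries.constantCoeff (mapLin (tLin l) (logOneAdd x)) = 0 :=
  constantCoeff_mapLin _ (constantCoeff_logOneAdd x)

theorem theta_mul {σ : Type*} (l : ℕ+) {x y : MvPowerSeries σ (RatLie R)}
    (hx : MvPowerSeries.constantCoeff x = 0) (hy : MvPowerSeries.constantCoeff y = 0) :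
    theta l x * theta l y = theta l (x + y + x * y) :=
  expSeries_mapLin_logOneAdd_mul (tLin_commutator l) hx hy

theorem theta_commute {σ : Type*} {l k : ℕ+} (h : l ≠ k) (x y : MvPowerSeries σ (RatLie R)) :
    Commute (theta l x) (theta k y) :=
  commute_expSeries (constantCoeff_mapLin_logOneAdd l x) (constantCoeff_mapLin_logOneAdd k y)
    (commute_of_coeff fun _ _ => tLin_commute h _ _)

theorem comulQ_tLin (l : ℕ+) (r : RatLie R) :
    comulQ R (tLin l r) = tLin l r ⊗ₜ 1 + 1 ⊗ₜ tLin l r :=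
  UniversalEnvelopingAlgebra.lift_ι_apply ℚ _ _

theorem counitQ_tLin (l : ℕ+) (r : RatLie R) : counitQ R (tLin l r) = 0 :=
  UniversalEnvelopingAlgebra.lift_ι_apply ℚ _ _

theorem antipodeQ_tLin (l : ℕ+) (r : RatLie R) :
    antipodeQ R (tLin l r) = MulOpposite.op (-tLin l r) :=
  UniversalEnvelopingAlgebra.lift_ι_apply ℚ _ _

/-- The representation of the rational algebra on `ℚ ⊗ R` through the `l`-th factor. -/
noncomputable def projQ (l : ℕ+) : GQ R →ₐ[ℚ] RatLie R :=
  UniversalEnvelopingAlgebra.lift ℚ (DirectSum.lieAlgebraComponent ℚ ℕ+ (fun _ => RatLie R) l)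

theorem projQ_tLin (l k : ℕ+) (r : RatLie R) : projQ l (tLin k r) = if k = l then r else 0 := by
  have h : projQ l (tLin k r) = DirectSum.lieAlgebraComponent ℚ ℕ+ (fun _ => RatLie R) l
      (DirectSum.of (fun _ : ℕ+ => RatLie R) k r) := UniversalEnvelopingAlgebra.lift_ι_apply ℚ _ _
  rw [h]
  show DirectSum.of (fun _ : ℕ+ => RatLie R) k r l = _
  split_ifs with hkl
  · subst hkl; exact DirectSum.of_eq_same _ _
  · exact DirectSum.of_eq_of_ne _ _ _ (Ne.symm hkl)

/-- The projection is an algebra homomorphism that undoes T_l and kills T_k for k ≠ l, so the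
exponential meets the logarithm itself, or 0. -/
theorem map_projQ_theta {σ : Type*} (l k : ℕ+) {x : MvPowerSeries σ (RatLie R)}
    (hx : MvPowerSeries.constantCoeff x = 0) :
    MvPowerSeries.map ((projQ l : GQ R →ₐ[ℚ] RatLie R) : GQ R →+* RatLie R) (theta k x) = if k = l then 1 + x else 1 := by
  rw [theta_eq, map_expSeries]
  have h : MvPowerSeries.map ((projQ l : GQ R →ₐ[ℚ] RatLie R) : GQ R →+* RatLie R) (mapLin (tLin k) (logOneAdd x)) =
      if k = l then logOneAdd x else 0 := by
    ext m
    rw [MvPowerSeries.coeff_map, coeff_mapLin]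
    refine (projQ_tLin l k _).trans ?_
    split_ifs <;> simp
  rw [h]
  split_ifs
  · exact expSeries_logOneAdd hx
  · exact expSeries_zero

end TMap

/-! ### Grouplike series -/

section Grouplike

variable {σ : Type*} {R : Type*} [Ring R]

variable (R) in
/-- The algebra homomorphism `x ↦ x ⊗ 1`. -/
noncomputable def inclLeft : GQ R →ₐ[ℚ] GQ R ⊗[ℚ] GQ R := Algebra.TensorProduct.includeLeft

variable (R) in
/-- The algebra homomorphism `x ↦ 1 ⊗ x`. -/
noncomputable def inclRight : GQ R →ₐ[ℚ] GQ R ⊗[ℚ] GQ R := Algebra.TensorProduct.includeRight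

theorem inclLeft_apply (x : GQ R) : inclLeft R x = x ⊗ₜ 1 := rfl
theorem inclRight_apply (x : GQ R) : inclRight R x = 1 ⊗ₜ x := rfl

/-- A power series over the rational algebra whose coefficients form a sequence of divided powers. -/
def Grouplike (F : MvPowerSeries σ (GQ R)) : Prop :=
  MvPowerSeries.map (comulQ R : GQ R →+* GQ R ⊗[ℚ] GQ R) F =
    MvPowerSeries.map (inclLeft R : GQ R →+* GQ R ⊗[ℚ] GQ R) F *
      MvPowerSeries.map (inclRight R : GQ R →+* GQ R ⊗[ℚ] GQ R) F

theorem grouplike_commute (F G : MvPowerSeries σ (GQ R)) : Commute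
    (MvPowerSeries.map (inclLeft R : GQ R →+* GQ R ⊗[ℚ] GQ R) F)
    (MvPowerSeries.map (inclRight R : GQ R →+* GQ R ⊗[ℚ] GQ R) G) := by
  refine commute_of_coeff fun m n => ?_
  rw [MvPowerSeries.coeff_map, MvPowerSeries.coeff_map, RingHom.coe_coe, RingHom.coe_coe,
    inclLeft_apply, inclRight_apply, Commute, SemiconjBy, Algebra.TensorProduct.tmul_mul_tmul,
    Algebra.TensorProduct.tmul_mul_tmul, one_mul, mul_one, one_mul, mul_one]

theorem Grouplike.one : Grouplike (1 : MvPowerSeries σ (GQ R)) := by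
  simp [Grouplike]

theorem Grouplike.mul {F G : MvPowerSeries σ (GQ R)} (hF : Grouplike F) (hG : Grouplike G) :
    Grouplike (F * G) := by
  unfold Grouplike at *
  rw [map_mul, hF, hG, map_mul, map_mul, mul_assoc, ← mul_assoc (MvPowerSeries.map _ F) _ (MvPowerSeries.map _ G),
    ← (grouplike_commute G F).eq]
  simp only [mul_assoc]

theorem Grouplike.list_prod {l : List (MvPowerSeries σ (GQ R))} (h : ∀ F ∈ l, Grouplike F) :
    Grouplike l.prod := by
  induction l with
  | nil => exact Grouplike.one
  | cons F l ih =>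
    rw [List.prod_cons]
    exact (h F (by simp)).mul (ih fun G hG => h G (by simp [hG]))

/-- The exponent has primitive coefficients, so its image is a sum of two commuting series from the
two tensor factors, and the exponential of such a sum is a product. -/
theorem grouplike_theta (l : ℕ+) (x : MvPowerSeries σ (RatLie R)) : Grouplike (theta l x) := by
  set Y := mapLin (tLin l) (logOneAdd x) with hY
  have hY0 : MvPowerSeries.constantCoeff Y = 0 := constantCoeff_mapLin_logOneAdd l x
  have e : MvPowerSeries.map (comulQ R : GQ R →+* GQ R ⊗[ℚ] GQ R) Y =
      MvPowerSeries.map (inclLeft R : GQ R →+* GQ R ⊗[ℚ] GQ R) Y +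
      MvPowerSeries.map (inclRight R : GQ R →+* GQ R ⊗[ℚ] GQ R) Y := by
    ext m
    rw [map_add, MvPowerSeries.coeff_map, MvPowerSeries.coeff_map, MvPowerSeries.coeff_map,
      RingHom.coe_coe, RingHom.coe_coe, RingHom.coe_coe, hY, coeff_mapLin, comulQ_tLin,
      inclLeft_apply, inclRight_apply]
  show Grouplike (expSeries Y)
  unfold Grouplike
  rw [map_expSeries, e, expSeries_add _ _ (grouplike_commute Y Y)]
  · congr 1
    · exact (map_expSeries (inclLeft R) Y).symm
    · exact (map_expSeries (inclRight R) Y).symm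
  · rw [MvPowerSeries.constantCoeff_map, hY0, map_zero]
  · rw [MvPowerSeries.constantCoeff_map, hY0, map_zero]

theorem Grouplike.coeff [DecidableEq σ] {F : MvPowerSeries σ (GQ R)} (hF : Grouplike F) (m : σ →₀ ℕ) :
    comulQ R (MvPowerSeries.coeff m F) = ∑ p ∈ Finset.HasAntidiagonal.antidiagonal m,
      MvPowerSeries.coeff p.1 F ⊗ₜ MvPowerSeries.coeff p.2 F := by
  have := congrArg (MvPowerSeries.coeff m) hF
  rw [MvPowerSeries.coeff_map, MvPowerSeries.coeff_mul] at this
  refine this.trans (Finset.sum_congr rfl fun p _ => ?_)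
  rw [MvPowerSeries.coeff_map, MvPowerSeries.coeff_map, RingHom.coe_coe, RingHom.coe_coe,
    inclLeft_apply, inclRight_apply, Algebra.TensorProduct.tmul_mul_tmul, one_mul, mul_one]

theorem map_counitQ_theta (l : ℕ+) (x : MvPowerSeries σ (RatLie R)) :
    MvPowerSeries.map (counitQ R : GQ R →+* ℚ) (theta l x) = 1 := by
  rw [theta_eq, map_expSeries]
  have : MvPowerSeries.map (counitQ R : GQ R →+* ℚ) (mapLin (tLin l) (logOneAdd x)) = 0 := by
    ext m
    rw [MvPowerSeries.coeff_map, RingHom.coe_coe, coeff_mapLin, counitQ_tLin, map_zero]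
  rw [this, expSeries_zero]

variable (R) in
/-- The antipode as a linear map. -/
noncomputable def antipodeLin : GQ R →ₗ[ℚ] GQ R :=
  (MulOpposite.opLinearEquiv ℚ).symm.toLinearMap ∘ₗ (antipodeQ R).toLinearMap

theorem antipodeLin_apply (x : GQ R) : antipodeLin R x = (antipodeQ R x).unop := rfl

theorem antipodeLin_mul (x y : GQ R) :
    antipodeLin R (x * y) = antipodeLin R y * antipodeLin R x := by
  simp only [antipodeLin_apply, map_mul, MulOpposite.unop_mul]

/-- The coefficientwise application of the antipode. -/
noncomputable def antipodeSeries (F : MvPowerSeries σ (GQ R)) : MvPowerSeries σ (GQ R) :=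
  mapLin (antipodeLin R) F

theorem coeff_antipodeSeries (F : MvPowerSeries σ (GQ R)) (m : σ →₀ ℕ) :
    MvPowerSeries.coeff m (antipodeSeries F) = antipodeLin R (MvPowerSeries.coeff m F) := rfl

theorem antipodeSeries_mul (F G : MvPowerSeries σ (GQ R)) :
    antipodeSeries (F * G) = antipodeSeries G * antipodeSeries F := by
  classical
  ext m
  rw [coeff_antipodeSeries, MvPowerSeries.coeff_mul, MvPowerSeries.coeff_mul, map_sum,
    sum_antidiagonal_swap m fun a b =>
      MvPowerSeries.coeff a (antipodeSeries G) * MvPowerSeries.coeff b (antipodeSeries F)]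
  refine Finset.sum_congr rfl fun p _ => ?_
  rw [antipodeLin_mul]
  rfl

theorem antipodeSeries_one : antipodeSeries (1 : MvPowerSeries σ (GQ R)) = 1 := by
  classical
  ext m
  rw [coeff_antipodeSeries, MvPowerSeries.coeff_one]
  split_ifs
  · rw [antipodeLin_apply, map_one, MulOpposite.unop_one]
  · rw [map_zero]

theorem antipodeSeries_pow (F : MvPowerSeries σ (GQ R)) (k : ℕ) :
    antipodeSeries (F ^ k) = antipodeSeries F ^ k := by
  induction k with
  | zero => rw [pow_zero, pow_zero, antipodeSeries_one]
  | succ k ih => rw [pow_succ, pow_succ', antipodeSeries_mul, ih]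

/-- The antipode negates the primitive exponent. Being an anti-homomorphism, it still respects
powers of one element, hence replaces exp Y by exp(-Y). -/
theorem antipodeSeries_theta (l : ℕ+) (x : MvPowerSeries σ (RatLie R)) :
    antipodeSeries (theta l x) * theta l x = 1 ∧ theta l x * antipodeSeries (theta l x) = 1 := by
  set Y := mapLin (tLin l) (logOneAdd x) with hY
  have hY0 : MvPowerSeries.constantCoeff Y = 0 := constantCoeff_mapLin_logOneAdd l x
  have e : antipodeSeries Y = -Y := by
    ext m
    rw [coeff_antipodeSeries, hY, coeff_mapLin, antipodeLin_apply, antipodeQ_tLin]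
    rfl
  have e2 : antipodeSeries (expSeries Y) = expSeries (-Y) := by
    rw [antipodeSeries, expSeries_eq, mapLin_egf, expSeries_eq]
    congr 1
    funext k
    rw [← e]
    exact antipodeSeries_pow Y k
  show antipodeSeries (expSeries Y) * expSeries Y = 1 ∧ expSeries Y * antipodeSeries (expSeries Y) = 1
  rw [e2]
  exact ⟨expSeries_neg_mul hY0, expSeries_mul_neg hY0⟩

theorem antipodeSeries_list_prod {l : List (MvPowerSeries σ (GQ R))}
    (h : ∀ F ∈ l, antipodeSeries F * F = 1 ∧ F * antipodeSeries F = 1) :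
    antipodeSeries l.prod * l.prod = 1 ∧ l.prod * antipodeSeries l.prod = 1 := by
  induction l with
  | nil => simp [antipodeSeries_one]
  | cons F l ih =>
    obtain ⟨h1, h2⟩ := h F (by simp)
    obtain ⟨h3, h4⟩ := ih fun G hG => h G (by simp [hG])
    rw [List.prod_cons, antipodeSeries_mul]
    constructor
    · rw [mul_assoc, ← mul_assoc _ F, h1, one_mul, h3]
    · rw [mul_assoc, ← mul_assoc l.prod, h4, one_mul, h2]

end Grouplike

/-! ### Homogeneity of the power sums -/

section Homogeneous

theorem coeff_genericWitt (n : ℕ) : BigWitt.coeff n genericWitt = elemSym n := by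
  rw [BigWitt.coeff, genericWitt, PowerSeries.coeff_mk]

theorem elemSym_pnat (n : ℕ+) : elemSym ((n : ℕ) : ℤ) = MvPolynomial.X n := by
  unfold elemSym
  rw [dif_pos (by exact_mod_cast n.pos)]
  rfl

theorem elemSym_homogeneous (n : ℕ) :
    MvPolynomial.IsWeightedHomogeneous (fun k : ℕ+ => (k : ℕ)) (elemSym n) n := by
  rcases Nat.eq_zero_or_pos n with rfl | h
  · simpa [elemSym] using MvPolynomial.isWeightedHomogeneous_one ℤ (fun k : ℕ+ => (k : ℕ))
  · lift n to ℕ+ using h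
    rw [elemSym_pnat]
    exact MvPolynomial.isWeightedHomogeneous_X ℤ (fun k : ℕ+ => (k : ℕ)) n

/-- In Newton's identity the term with e₀ = 1 isolates the n-th coefficient; the other terms are
homogeneous of degree n by induction, the one with p₀ = 0 being trivial. -/
theorem logDer_genericWitt_homogeneous (n : ℕ) :
    MvPolynomial.IsWeightedHomogeneous (fun k : ℕ+ => (k : ℕ))
      (PowerSeries.coeff n (BigWitt.logDer genericWitt)) n := by
  induction n using Nat.strong_induction_on with
  | _ n ih =>
    have h := BigWitt.newton genericWitt n
    rw [← Finset.add_sum_erase _ _ (Finset.HasAntidiagonal.mem_antidiagonal.2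
      (show ((0, n) : ℕ × ℕ).1 + ((0, n) : ℕ × ℕ).2 = n from zero_add n)), BigWitt.coeff_zero,
      one_mul] at h
    rw [eq_sub_of_add_eq h.symm]
    refine MvPolynomial.IsWeightedHomogeneous.sub ?_ ?_
    · have := (elemSym_homogeneous n).C_mul (n : ℤ)
      rw [coeff_genericWitt]
      simpa using this
    · refine MvPolynomial.IsWeightedHomogeneous.sum _ _ _ fun p hp => ?_
      obtain ⟨h1, h2⟩ := Finset.mem_erase.1 hp
      have h3 := Finset.HasAntidiagonal.mem_antidiagonal.1 h2
      have h4 : p.1 ≠ 0 := fun h0 => h1 (Prod.ext h0 (by simpa [h0] using h3))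
      have h5 := (elemSym_homogeneous p.1).mul (ih p.2 (by omega))
      rwa [h3, ← coeff_genericWitt] at h5

theorem powerSum_homogeneous (n : ℕ) :
    MvPolynomial.IsWeightedHomogeneous (fun k : ℕ+ => (k : ℕ)) (powerSum n) n := by
  have := (logDer_genericWitt_homogeneous n).C_mul ((-1) ^ (n + 1))
  simpa [powerSum] using this

variable {I : Type*}

theorem symDegree_eq (m : I × ℕ+ →₀ ℕ) :
    symDegree m = Finsupp.weight (fun s : I × ℕ+ => (s.2 : ℕ)) m := rfl

theorem symDegree_add (m n : I × ℕ+ →₀ ℕ) : symDegree (m + n) = symDegree m + symDegree n := by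
  simp only [symDegree_eq, map_add]

theorem symDegree_zero : symDegree (0 : I × ℕ+ →₀ ℕ) = 0 := by
  simp only [symDegree_eq, map_zero]

theorem symDegree_of_coeff_powerSum_ne_zero {U : I} {l : ℕ} {m : I × ℕ+ →₀ ℕ}
    (h : MvPolynomial.coeff m (inCopy U (powerSum l)) ≠ 0) : symDegree m = l := by
  obtain ⟨u, rfl, hu⟩ := MvPolynomial.coeff_rename_ne_zero _ _ _ h
  rw [← powerSum_homogeneous l hu, symDegree, Finsupp.sum_mapDomain_index]
  · rfl
  · simp
  · intros; ring

/-- A nonconstant monomial can occur only in the copies whose variables it contains. -/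
theorem finite_coeff_inCopy_ne_zero (p : SymFun) {m : I × ℕ+ →₀ ℕ} (hm : m ≠ 0) :
    {U : I | MvPolynomial.coeff m (inCopy U p) ≠ 0}.Finite := by
  classical
  refine (m.support.image Prod.fst).finite_toSet.subset fun U hU => ?_
  obtain ⟨u, rfl, hu⟩ := MvPolynomial.coeff_rename_ne_zero _ _ _ hU
  have hu0 : u ≠ 0 := by
    rintro rfl
    exact hm Finsupp.mapDomain_zero
  obtain ⟨s, hs⟩ := Finsupp.ne_iff.1 hu0
  refine Finset.mem_coe.2 (Finset.mem_image.2 ⟨(U, s), ?_, rfl⟩)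
  rw [Finsupp.mem_support_iff, Finsupp.mapDomain_apply (Prod.mk_right_injective U)]
  exact hs

/-- The basis may be infinite, so this finiteness is what makes the `finsum` in `powerSumSeries` a
true sum instead of the default value 0. At the constant monomial it holds because p_l has positive
degree. -/
theorem finite_coeff_powerSum_ne_zero (l : ℕ+) (m : I × ℕ+ →₀ ℕ) :
    {U : I | MvPolynomial.coeff m (inCopy U (powerSum l)) ≠ 0}.Finite := by
  by_cases hm : m = 0
  · subst hm
    convert Set.finite_empty (α := I)
    ext U
    simp only [Set.mem_ofPred_eq, Set.mem_empty_iff_false, iff_false, not_not]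
    by_contra h
    have := symDegree_of_coeff_powerSum_ne_zero h
    rw [symDegree_zero] at this
    exact l.ne_zero this.symm
  · exact finite_coeff_inCopy_ne_zero _ hm

end Homogeneous

/-! ### The truncated products -/

section PartialProducts

open NCSeries

variable {R : Type*} [Ring R] {I : Type*} (b : Module.Basis I ℤ R)

theorem coeff_powerSumSeries (l : ℕ+) (m : I × ℕ+ →₀ ℕ) :
    MvPowerSeries.coeff m (powerSumSeries b l) =
      ∑ᶠ U, MvPolynomial.coeff m (inCopy U (powerSum l)) • RatLie.of R (b U) := rfl

theorem symDegree_of_coeff_powerSumSeries_ne_zero {l : ℕ+} {m : I × ℕ+ →₀ ℕ}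
    (h : MvPowerSeries.coeff m (powerSumSeries b l) ≠ 0) : symDegree m = l := by
  by_contra hne
  refine h ?_
  rw [coeff_powerSumSeries]
  refine (finsum_congr fun U => ?_).trans finsum_zero
  by_cases h0 : MvPolynomial.coeff m (inCopy U (powerSum l)) = 0
  · rw [h0, zero_smul]
  · exact absurd (symDegree_of_coeff_powerSum_ne_zero h0) hne

theorem constantCoeff_powerSumSeries (l : ℕ+) :
    MvPowerSeries.constantCoeff (powerSumSeries b l) = 0 := by
  rw [← MvPowerSeries.coeff_zero_eq_constantCoeff_apply]
  by_contra h
  have := symDegree_of_coeff_powerSumSeries_ne_zero b (l := l) (m := 0) h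
  rw [symDegree_zero] at this
  exact l.ne_zero this.symm

/-- The monomials of the series have degree at least `l`. -/
def SymOrderGE {S : Type*} [Ring S] (l : ℕ) (F : MvPowerSeries (I × ℕ+) S) : Prop :=
  ∀ m, MvPowerSeries.coeff m F ≠ 0 → l ≤ symDegree m

theorem SymOrderGE.mul {S : Type*} [Ring S] {l : ℕ} {F : MvPowerSeries (I × ℕ+) S}
    (hF : SymOrderGE l F) (G : MvPowerSeries (I × ℕ+) S) : SymOrderGE l (F * G) := by
  classical
  intro m hm
  rw [MvPowerSeries.coeff_mul] at hm
  obtain ⟨p, hp, h⟩ := Finset.exists_ne_zero_of_sum_ne_zero hm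
  have h1 := hF p.1 (left_ne_zero_of_mul h)
  rw [← Finset.HasAntidiagonal.mem_antidiagonal.1 hp, symDegree_add]
  omega

theorem SymOrderGE.pow {S : Type*} [Ring S] {l : ℕ} {F : MvPowerSeries (I × ℕ+) S}
    (hF : SymOrderGE l F) {k : ℕ} (hk : k ≠ 0) : SymOrderGE l (F ^ k) := by
  obtain ⟨k, rfl⟩ := Nat.exists_eq_succ_of_ne_zero hk
  rw [pow_succ']
  exact hF.mul _

/-- The argument starts in degree l, and so do its positive powers, its logarithm and the
nonconstant part of the exponential. Hence the infinite product is locally finite. -/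
theorem coeff_theta_powerSumSeries {l : ℕ+} {m : I × ℕ+ →₀ ℕ} (h : symDegree m < l) (hm : m ≠ 0) :
    MvPowerSeries.coeff m (theta l (powerSumSeries b l)) = 0 := by
  have h1 : SymOrderGE l (powerSumSeries b l) := fun m hm =>
    (symDegree_of_coeff_powerSumSeries_ne_zero b hm).ge
  have h2 : SymOrderGE l (mapLin (tLin l) (logOneAdd (powerSumSeries b l))) := by
    intro m hm
    by_contra hlt
    refine hm ?_
    rw [coeff_mapLin, logOneAdd_eq, coeff_gsum, Finset.sum_eq_zero, map_zero]
    intro k _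
    rcases Nat.eq_zero_or_pos k with rfl | hk
    · simp
    · rw [coeff_smul_rat]
      by_cases h0 : MvPowerSeries.coeff m (powerSumSeries b l ^ k) = 0
      · rw [h0, smul_zero]
      · exact absurd (h1.pow hk.ne' m h0) hlt
  rw [theta_eq, expSeries_eq, egf, coeff_gsum]
  refine Finset.sum_eq_zero fun k _ => ?_
  rw [coeff_smul_rat]
  rcases Nat.eq_zero_or_pos k with rfl | hk
  · classical
    rw [pow_zero, MvPowerSeries.coeff_one, if_neg hm, smul_zero]
  · by_cases h0 : MvPowerSeries.coeff m (mapLin (tLin l) (logOneAdd (powerSumSeries b l)) ^ k) = 0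
    · rw [h0, smul_zero]
    · exact absurd (h2.pow hk.ne' m h0) (not_le.2 h)

theorem constantCoeff_theta {σ : Type*} (l : ℕ+) (x : MvPowerSeries σ (RatLie R)) :
    MvPowerSeries.constantCoeff (theta l x) = 1 :=
  NCSeries.constantCoeff_expSeries _

/-- The product of the first `L` factors of the generating series. -/
noncomputable def partProd (L : ℕ) : MvPowerSeries (I × ℕ+) (GQ R) :=
  ((List.range L).map fun l => theta l.succPNat (powerSumSeries b l.succPNat)).prod

theorem partProd_succ (L : ℕ) : partProd b (L + 1) =
    partProd b L * theta L.succPNat (powerSumSeries b L.succPNat) := by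
  simp [partProd, List.range_succ]

/-- A further factor is 1 plus terms of degree greater than that of m, so it leaves the coefficient
unchanged. -/
theorem coeff_partProd {L : ℕ} {m : I × ℕ+ →₀ ℕ} (h : symDegree m ≤ L) :
    MvPowerSeries.coeff m (partProd b L) = MvPowerSeries.coeff m (genSeries b) := by
  classical
  induction L, h using Nat.le_induction with
  | base => rfl
  | succ L hL ih =>
    rw [← ih, partProd_succ, MvPowerSeries.coeff_mul, Finset.sum_eq_single (m, 0)]
    · rw [MvPowerSeries.coeff_zero_eq_constantCoeff_apply, constantCoeff_theta, mul_one]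
    · intro p hp hne
      have h1 := Finset.HasAntidiagonal.mem_antidiagonal.1 hp
      have h2 : p.2 ≠ 0 := fun h0 => hne (Prod.ext (by rw [h0, add_zero] at h1; exact h1) h0)
      rw [coeff_theta_powerSumSeries b _ h2, mul_zero]
      have h3 : symDegree p.1 + symDegree p.2 = symDegree m := by rw [← symDegree_add, h1]
      rw [Nat.succPNat_coe]
      omega
    · intro h
      exact absurd (Finset.HasAntidiagonal.mem_antidiagonal.2 (add_zero m)) h

theorem coeff_genSeries_zero : MvPowerSeries.coeff 0 (genSeries b) = 1 := by
  rw [← coeff_partProd b (L := 0) (by rw [symDegree_zero])]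
  simp [partProd]

theorem counitQ_coeff_genSeries [DecidableEq I] (m : I × ℕ+ →₀ ℕ) :
    counitQ R (MvPowerSeries.coeff m (genSeries b)) = if m = 0 then 1 else 0 := by
  have h : ∀ L, MvPowerSeries.map (counitQ R : GQ R →+* ℚ) (partProd b L) = 1 := by
    intro L
    induction L with
    | zero => simp [partProd]
    | succ L ih => rw [partProd_succ, map_mul, ih, map_counitQ_theta, one_mul]
  have := congrArg (MvPowerSeries.coeff m) (h (symDegree m))
  rw [MvPowerSeries.coeff_map, coeff_partProd b le_rfl, MvPowerSeries.coeff_one] at this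
  exact this

theorem comulQ_coeff_genSeries [DecidableEq I] (m : I × ℕ+ →₀ ℕ) :
    comulQ R (MvPowerSeries.coeff m (genSeries b)) =
      ∑ p ∈ Finset.HasAntidiagonal.antidiagonal m,
        MvPowerSeries.coeff p.1 (genSeries b) ⊗ₜ MvPowerSeries.coeff p.2 (genSeries b) := by
  have hg : Grouplike (partProd b (symDegree m)) := Grouplike.list_prod fun F hF => by
    obtain ⟨l, _, rfl⟩ := List.mem_map.1 hF
    exact grouplike_theta _ _
  rw [← coeff_partProd b le_rfl, hg.coeff]
  refine Finset.sum_congr rfl fun p hp => ?_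
  have h3 : symDegree p.1 + symDegree p.2 = symDegree m := by
    rw [← symDegree_add, Finset.HasAntidiagonal.mem_antidiagonal.1 hp]
  rw [coeff_partProd b (by omega), coeff_partProd b (by omega)]

/-- A coefficient of a product involves only coefficients of smaller or equal degree, and there the
generating series agrees with a finite product, for which the identities are known. -/
theorem antipodeSeries_genSeries :
    antipodeSeries (genSeries b) * genSeries b = 1 ∧
      genSeries b * antipodeSeries (genSeries b) = 1 := by
  classical
  have h : ∀ L, antipodeSeries (partProd b L) * partProd b L = 1 ∧
      partProd b L * antipodeSeries (partProd b L) = 1 := by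
    intro L
    refine antipodeSeries_list_prod fun F hF => ?_
    obtain ⟨l, _, rfl⟩ := List.mem_map.1 hF
    exact antipodeSeries_theta _ _
  constructor
  · ext m
    rw [← (h (symDegree m)).1, MvPowerSeries.coeff_mul, MvPowerSeries.coeff_mul]
    refine Finset.sum_congr rfl fun p hp => ?_
    have h3 : symDegree p.1 + symDegree p.2 = symDegree m := by
      rw [← symDegree_add, Finset.HasAntidiagonal.mem_antidiagonal.1 hp]
    rw [coeff_antipodeSeries, coeff_antipodeSeries, coeff_partProd b (by omega),
      coeff_partProd b (by omega)]
  · ext m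
    rw [← (h (symDegree m)).2, MvPowerSeries.coeff_mul, MvPowerSeries.coeff_mul]
    refine Finset.sum_congr rfl fun p hp => ?_
    have h3 : symDegree p.1 + symDegree p.2 = symDegree m := by
      rw [← symDegree_add, Finset.HasAntidiagonal.mem_antidiagonal.1 hp]
    rw [coeff_antipodeSeries, coeff_antipodeSeries, coeff_partProd b (by omega),
      coeff_partProd b (by omega)]

/-- All factors but the l-th project to 1, so the representation on ℚ ⊗ R reads off the power sum
series of index l. -/
theorem projQ_coeff_genSeries [DecidableEq I] (l : ℕ+) (m : I × ℕ+ →₀ ℕ) :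
    projQ l (MvPowerSeries.coeff m (genSeries b)) =
      (if m = 0 then 1 else 0) + MvPowerSeries.coeff m (powerSumSeries b l) := by
  have h : ∀ L, MvPowerSeries.map ((projQ l : GQ R →ₐ[ℚ] RatLie R) : GQ R →+* RatLie R)
      (partProd b L) = if (l : ℕ) ≤ L then 1 + powerSumSeries b l else 1 := by
    intro L
    induction L with
    | zero => 
      have : ¬ (l : ℕ) ≤ 0 := not_le.2 l.pos
      rw [if_neg this]; simp [partProd]
    | succ L ih =>
      rw [partProd_succ, map_mul, ih, map_projQ_theta _ _ (constantCoeff_powerSumSeries b _)]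
      by_cases h1 : L.succPNat = l
      · have h2 : (l : ℕ) = L + 1 := by rw [← h1, Nat.succPNat_coe]
        rw [if_pos h1, if_neg (by omega), if_pos (by omega), one_mul, h1]
      · have h2 : (l : ℕ) ≠ L + 1 := fun h => h1 (PNat.eq (by rw [h, Nat.succPNat_coe]))
        rw [if_neg h1, mul_one]
        by_cases h3 : (l : ℕ) ≤ L
        · rw [if_pos h3, if_pos (by omega)]
        · rw [if_neg h3, if_neg (by omega)]
  have := congrArg (MvPowerSeries.coeff m) (h (symDegree m))
  rw [MvPowerSeries.coeff_map, coeff_partProd b le_rfl] at this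
  refine this.trans ?_
  split_ifs with h1 h2 h3
  · rw [map_add, MvPowerSeries.coeff_one, if_pos h2]
  · rw [map_add, MvPowerSeries.coeff_one, if_neg h2]
  · subst h3
    rw [MvPowerSeries.coeff_zero_eq_constantCoeff_apply, map_one,
      MvPowerSeries.coeff_zero_eq_constantCoeff_apply, constantCoeff_powerSumSeries, add_zero]
  · have h4 : MvPowerSeries.coeff m (powerSumSeries b l) = 0 := by
      by_contra h5
      exact h1 (symDegree_of_coeff_powerSumSeries_ne_zero b h5).ge
    rw [MvPowerSeries.coeff_one, if_neg h3, h4, add_zero]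

end PartialProducts

/-! ### Linear independence of the coefficients -/

section Functionals

variable {R : Type*} [Ring R] {I : Type*} (b : Module.Basis I ℤ R)

/-- The coordinate of `ℚ ⊗ R` at a basis element. -/
noncomputable def ratCoord (V : I) : RatLie R →ₗ[ℚ] ℚ :=
  (Algebra.TensorProduct.basis ℚ b).coord V

theorem ratCoord_of [DecidableEq I] (U V : I) :
    ratCoord b V (RatLie.of R (b U)) = if U = V then 1 else 0 := by
  have : RatLie.of R (b U) = Algebra.TensorProduct.basis ℚ b U :=
    (Algebra.TensorProduct.basis_apply b U).symm
  show (Algebra.TensorProduct.basis ℚ b).repr (RatLie.of R (b U)) V = _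
  rw [this, Module.Basis.repr_self, Finsupp.single_apply]

theorem ratCoord_coeff_powerSumSeries (V : I) (l : ℕ+) (m : I × ℕ+ →₀ ℕ) :
    ratCoord b V (MvPowerSeries.coeff m (powerSumSeries b l)) =
      (MvPolynomial.coeff m (inCopy V (powerSum l)) : ℤ) := by
  classical
  have hfin := finite_coeff_powerSum_ne_zero l m
  rw [coeff_powerSumSeries]
  have h1 : (Function.support fun U =>
      MvPolynomial.coeff m (inCopy U (powerSum l)) • RatLie.of R (b U)).Finite :=
    hfin.subset fun U hU h0 => hU (by simp only [h0, zero_smul])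
  rw [← LinearMap.toAddMonoidHom_coe, AddMonoidHom.map_finsum _ h1]
  simp only [LinearMap.toAddMonoidHom_coe, map_zsmul, ratCoord_of]
  rw [finsum_eq_single _ V]
  · simp
  · intro U hU; simp [hU]

/-- The polynomials that arise by applying a functional to the coefficients of the generating
series. -/
noncomputable def functionalSubalgebra : Subalgebra ℚ (MvPolynomial (I × ℕ+) ℚ) where
  carrier := {F | ∃ f : GQ R →ₗ[ℚ] ℚ, ∀ m,
    f (MvPowerSeries.coeff m (genSeries b)) = MvPolynomial.coeff m F}
  algebraMap_mem' r := by
    classical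
    refine ⟨r • (counitQ R).toLinearMap, fun m => ?_⟩
    rw [LinearMap.smul_apply, AlgHom.toLinearMap_apply, counitQ_coeff_genSeries,
      MvPolynomial.algebraMap_eq, MvPolynomial.coeff_C]
    simp [eq_comm]
  add_mem' := by
    rintro F G ⟨f, hf⟩ ⟨g, hg⟩
    exact ⟨f + g, fun m => by rw [LinearMap.add_apply, hf, hg, MvPolynomial.coeff_add]⟩
  mul_mem' := by
    classical
    rintro F G ⟨f, hf⟩ ⟨g, hg⟩
    -- The convolution of the two functionals. The coefficients of the grouplike generating series
    -- form a sequence of divided powers, so convolution corresponds to the product of polynomials.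
    refine ⟨LinearMap.mul' ℚ ℚ ∘ₗ TensorProduct.map f g ∘ₗ (comulQ R).toLinearMap, fun m => ?_⟩
    rw [LinearMap.comp_apply, LinearMap.comp_apply, AlgHom.toLinearMap_apply,
      comulQ_coeff_genSeries, map_sum, map_sum, MvPolynomial.coeff_mul]
    refine Finset.sum_congr rfl fun p _ => ?_
    rw [TensorProduct.map_tmul, LinearMap.mul'_apply, hf, hg]

/-- Projection to the l-th factor followed by the coordinate at U yields p_l^{(U)} plus the
coordinate of 1 at U, and constants already belong to the subalgebra. -/
theorem map_powerSum_mem (U : I) (l : ℕ+) :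
    MvPolynomial.map (Int.castRingHom ℚ) (inCopy U (powerSum l)) ∈ functionalSubalgebra b := by
  classical
  have h1 : MvPolynomial.map (Int.castRingHom ℚ) (inCopy U (powerSum l)) +
      MvPolynomial.C (ratCoord b U 1) ∈ functionalSubalgebra b := by
    refine ⟨ratCoord b U ∘ₗ (projQ l).toLinearMap, fun m => ?_⟩
    rw [LinearMap.comp_apply, AlgHom.toLinearMap_apply, projQ_coeff_genSeries, map_add,
      ratCoord_coeff_powerSumSeries, MvPolynomial.coeff_add, MvPolynomial.coeff_map,
      MvPolynomial.coeff_C, add_comm]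
    congr 1
    by_cases h : m = 0
    · subst h; simp
    · simp [h, Ne.symm h]
  have h2 := (functionalSubalgebra b).sub_mem h1 ((functionalSubalgebra b).algebraMap_mem (ratCoord b U 1))
  rwa [MvPolynomial.algebraMap_eq, add_sub_cancel_right] at h2

/-- Newton's identities express n e_n by power sums and smaller e_k, and n is invertible over ℚ. -/
theorem map_elemSym_mem (U : I) (n : ℕ) :
    MvPolynomial.map (Int.castRingHom ℚ) (inCopy U (elemSym n)) ∈ functionalSubalgebra b := by
  induction n using Nat.strong_induction_on with
  | _ n ih =>
    let h : SymFun →+* MvPolynomial (I × ℕ+) ℚ :=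
      (MvPolynomial.map (Int.castRingHom ℚ)).comp (inCopy U).toRingHom
    show h (elemSym n) ∈ _
    rcases Nat.eq_zero_or_pos n with rfl | hn
    · have : elemSym ((0 : ℕ) : ℤ) = 1 := by simp [elemSym]
      rw [this, map_one]
      exact one_mem _
    have h1 := congrArg h (BigWitt.newton genericWitt n)
    rw [map_mul, map_natCast, map_sum, coeff_genericWitt] at h1
    have h2 : (n : MvPolynomial (I × ℕ+) ℚ) * h (elemSym n) ∈ functionalSubalgebra b := by
      rw [h1]
      refine sum_mem fun p hp => ?_
      have h3 := Finset.HasAntidiagonal.mem_antidiagonal.1 hp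
      rw [map_mul, coeff_genericWitt]
      rcases Nat.eq_zero_or_pos p.2 with h0 | h0
      · rw [h0, BigWitt.coeff_zero_logDer, map_zero, mul_zero]
        exact zero_mem _
      · refine mul_mem (ih p.1 (by omega)) ?_
        have h4 : PowerSeries.coeff p.2 (BigWitt.logDer genericWitt) =
            (-1) ^ (p.2 + 1) * powerSum p.2 := by
          have h5 : ((-1 : SymFun) ^ (p.2 + 1)) * (-1) ^ (p.2 + 1) = 1 := by rw [← mul_pow]; simp
          rw [powerSum, ← mul_assoc, h5, one_mul]
        rw [h4, map_mul, map_pow, map_neg, map_one]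
        exact mul_mem (pow_mem (neg_mem (one_mem _)) _) (map_powerSum_mem b U ⟨p.2, h0⟩)
    have h3 := (functionalSubalgebra b).smul_mem h2 ((n : ℚ)⁻¹)
    have h4 : (n : MvPolynomial (I × ℕ+) ℚ) * h (elemSym n) = (n : ℚ) • h (elemSym n) := by
      rw [← nsmul_eq_mul, Nat.cast_smul_eq_nsmul]
    rwa [h4, smul_smul, inv_mul_cancel₀ (Nat.cast_ne_zero.2 hn.ne'), one_smul] at h3

theorem functionalSubalgebra_eq_top : functionalSubalgebra b = ⊤ := by
  rw [eq_top_iff, ← MvPolynomial.adjoin_range_X, Algebra.adjoin_le_iff]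
  rintro _ ⟨⟨U, n⟩, rfl⟩
  have := map_elemSym_mem b U n
  rw [elemSym_pnat] at this
  rw [inCopy, MvPolynomial.rename_X, MvPolynomial.map_X] at this
  exact this

/-- Every monomial arises from a functional. These functionals are dual to the coefficients of the
generating series, which makes the coefficients linearly independent; their tensor products do the
same in the tensor square. -/
theorem exists_dual_functional [DecidableEq I] (k : I × ℕ+ →₀ ℕ) : ∃ f : GQ R →ₗ[ℚ] ℚ, ∀ m,
    f (MvPowerSeries.coeff m (genSeries b)) = if k = m then 1 else 0 := by
  have h : MvPolynomial.monomial k (1 : ℚ) ∈ functionalSubalgebra b := by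
    rw [functionalSubalgebra_eq_top]; exact Algebra.mem_top
  obtain ⟨f, hf⟩ := h
  exact ⟨f, fun m => by rw [hf, MvPolynomial.coeff_monomial]⟩

end Functionals

/-! ### Evaluation of power series at finite families of nilpotent elements -/

section FormalFamily

variable {τ A : Type*} [CommRing A]

open Classical in
/-- The monomials that divide a given one. -/
noncomputable def monoIic {τ : Type*} (n : τ →₀ ℕ) : Finset (τ →₀ ℕ) := Finset.Icc 0 n

theorem mem_monoIic {τ : Type*} {m n : τ →₀ ℕ} : m ∈ monoIic n ↔ m ≤ n := by
  simp [monoIic]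

/-- A family of nilpotent elements, almost all of them zero. -/
structure IsFormalFamily (c : τ → A) : Prop where
  nilpotent : ∀ s, IsNilpotent (c s)
  finite : {s | c s ≠ 0}.Finite

/-- The value of a monomial at a family. -/
def famPow (c : τ → A) (m : τ →₀ ℕ) : A := m.prod fun s k => c s ^ k

theorem famPow_zero (c : τ → A) : famPow c 0 = 1 := Finsupp.prod_zero_index

theorem famPow_add (c : τ → A) (m n : τ →₀ ℕ) : famPow c (m + n) = famPow c m * famPow c n :=
  Finsupp.prod_add_index' (fun _ => pow_zero _) (fun _ _ _ => pow_add _ _ _)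

theorem famPow_eq_zero {c : τ → A} {m : τ →₀ ℕ} {s : τ} (h : c s ^ m s = 0) (hs : m s ≠ 0) :
    famPow c m = 0 :=
  Finset.prod_eq_zero (Finsupp.mem_support_iff.2 hs) h

theorem map_famPow {B : Type*} [CommRing B] (f : A →+* B) (c : τ → A) (m : τ →₀ ℕ) :
    f (famPow c m) = famPow (fun s => f (c s)) m := by
  simp only [famPow, map_finsuppProd, map_pow]

/-- The monomials that do not vanish at the family are bounded by `n`. -/
def FamBound (c : τ → A) (n : τ →₀ ℕ) : Prop := ∀ m, famPow c m ≠ 0 → m ≤ n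

/-- If the N(s)-th power of c s is zero, then a nonvanishing monomial has exponent less than N(s) at
s, and exponent 0 wherever c s = 0. -/
theorem IsFormalFamily.exists_bound {c : τ → A} (hc : IsFormalFamily c) : ∃ n, FamBound c n := by
  classical
  choose N hN using hc.nilpotent
  refine ⟨Finsupp.onFinset hc.finite.toFinset (fun s => if c s = 0 then 0 else N s) ?_, ?_⟩
  · intro s hs
    rw [Set.Finite.mem_toFinset]
    intro h0
    exact hs (if_pos h0)
  · intro m hm s
    rw [Finsupp.onFinset_apply]
    by_contra hlt
    have hs : m s ≠ 0 := by omega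
    refine hm (famPow_eq_zero ?_ hs)
    split_ifs at hlt with h0
    · rw [h0, zero_pow hs]
    · exact pow_eq_zero_of_le (by omega) (hN s)

theorem FamBound.mono {c : τ → A} {n n' : τ →₀ ℕ} (h : FamBound c n) (hn : n ≤ n') :
    FamBound c n' := fun m hm => (h m hm).trans hn

theorem IsFormalFamily.map {B : Type*} [CommRing B] (f : A →+* B) {c : τ → A}
    (hc : IsFormalFamily c) : IsFormalFamily fun s => f (c s) :=
  ⟨fun s => (hc.nilpotent s).map f, hc.finite.subset fun s hs h0 => hs (by rw [h0, map_zero])⟩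

theorem FamBound.map {B : Type*} [CommRing B] (f : A →+* B) {c : τ → A} {n : τ →₀ ℕ}
    (h : FamBound c n) : FamBound (fun s => f (c s)) n := fun m hm =>
  h m fun h0 => hm (by rw [← map_famPow, h0, map_zero])

theorem FamBound.sum_coeff {c : τ → A} {n : τ →₀ ℕ} (h : FamBound c n) (P : MvPolynomial τ ℤ) :
    ∑ m ∈ monoIic n, ((MvPolynomial.coeff m P : ℤ) : A) * famPow c m = MvPolynomial.aeval c P := by
  classical
  rw [MvPolynomial.aeval_def, MvPolynomial.eval₂_eq]
  -- Any finite set that contains all contributing monomials gives the same sum; this is used for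
  -- the divisors of n and for the support of P.
  have h1 : ∀ s : Finset (τ →₀ ℕ), (∀ m, MvPolynomial.coeff m P ≠ 0 → famPow c m ≠ 0 → m ∈ s) →
      ∑ m ∈ s, ((MvPolynomial.coeff m P : ℤ) : A) * famPow c m =
        ∑ m ∈ monoIic n ∪ P.support, ((MvPolynomial.coeff m P : ℤ) : A) * famPow c m := by
    intro s hs
    have h2 : ∀ t : Finset (τ →₀ ℕ), s ⊆ t → ∑ m ∈ s, ((MvPolynomial.coeff m P : ℤ) : A) * famPow c m =
        ∑ m ∈ t, ((MvPolynomial.coeff m P : ℤ) : A) * famPow c m := by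
      intro t ht
      refine Finset.sum_subset ht fun m _ hm => ?_
      by_contra h0
      exact hm (hs m (fun h => h0 (by rw [h, Int.cast_zero, zero_mul])) (right_ne_zero_of_mul h0))
    have h3 := h2 (s ∪ (monoIic n ∪ P.support)) Finset.subset_union_left
    rw [h3]
    refine (Finset.sum_subset Finset.subset_union_right fun m _ hm => ?_).symm
    by_contra h0
    exact hm (Finset.mem_union_left _ (mem_monoIic.2 (h m (right_ne_zero_of_mul h0))))
  rw [h1 _ fun m _ hm => mem_monoIic.2 (h m hm)]
  exact (h1 _ fun m hm _ => MvPolynomial.mem_support_iff.2 hm).symm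

end FormalFamily

/-! ### Values of power series with noncommutative coefficients -/

section EvalSeries

variable {τ A S : Type*} [CommRing A] [Ring S]

/-- The sum `∑ cᵐ ⊗ Fₘ`. -/
noncomputable def evalFun (c : τ → A) (F : MvPowerSeries τ S) : A ⊗[ℤ] S :=
  ∑ᶠ m, famPow c m ⊗ₜ MvPowerSeries.coeff m F

theorem FamBound.evalFun_eq {c : τ → A} {n : τ →₀ ℕ} (h : FamBound c n) (F : MvPowerSeries τ S) :
    evalFun c F = ∑ m ∈ monoIic n, famPow c m ⊗ₜ[ℤ] MvPowerSeries.coeff m F := by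
  refine finsum_eq_sum_of_support_subset _ fun m hm => ?_
  refine Finset.mem_coe.2 (mem_monoIic.2 (h m fun h0 => hm ?_))
  simp only [h0, TensorProduct.zero_tmul]

/-- With bound n, the product of the two values runs over pairs of divisors of n. The pairs missing
from the convolution are those whose product does not divide n, and there the monomial vanishes at
c. -/
theorem evalFun_mul {c : τ → A} (hc : IsFormalFamily c) (F G : MvPowerSeries τ S) :
    evalFun c (F * G) = evalFun c F * evalFun c G := by
  classical
  obtain ⟨n, hn⟩ := hc.exists_bound
  rw [hn.evalFun_eq, hn.evalFun_eq, hn.evalFun_eq, Finset.sum_mul_sum, ← Finset.sum_product']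
  simp only [MvPowerSeries.coeff_mul, TensorProduct.tmul_sum, Algebra.TensorProduct.tmul_mul_tmul,
    ← famPow_add]
  rw [Finset.sum_sigma']
  refine Finset.sum_of_injOn (fun x => x.2) ?_ ?_ ?_ ?_
  · rintro ⟨a, p⟩ h ⟨a', p'⟩ h' hb
    simp only [Finset.coe_sigma, Finset.mem_coe, Set.mem_sigma_iff,
      Finset.HasAntidiagonal.mem_antidiagonal] at h h' hb
    subst hb
    have : a = a' := by rw [← h.2, ← h'.2]
    subst this; rfl
  · rintro ⟨a, p⟩ h
    simp only [Finset.coe_sigma, Finset.mem_coe, Set.mem_sigma_iff, mem_monoIic,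
      Finset.HasAntidiagonal.mem_antidiagonal] at h
    simp only [Finset.coe_product, Set.mem_prod, Finset.mem_coe, mem_monoIic]
    exact ⟨le_trans (h.2 ▸ le_self_add) h.1, le_trans (h.2 ▸ le_add_self) h.1⟩
  · rintro ⟨a, p⟩ _ h2
    by_cases h0 : famPow c (a + p) = 0
    · dsimp only
      rw [h0, TensorProduct.zero_tmul]
    · refine absurd ⟨⟨a + p, (a, p)⟩, ?_, rfl⟩ h2
      simp only [Finset.coe_sigma, Set.mem_sigma_iff, Finset.mem_coe, mem_monoIic,
        Finset.HasAntidiagonal.mem_antidiagonal, and_true]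
      exact hn _ h0
  · rintro ⟨a, p⟩ h
    simp only [Finset.mem_sigma, Finset.HasAntidiagonal.mem_antidiagonal] at h
    dsimp only
    rw [h.2]

/-- Evaluation of power series at a formal family, as a ring homomorphism. -/
noncomputable def evalSeries {c : τ → A} (hc : IsFormalFamily c) :
    MvPowerSeries τ S →+* A ⊗[ℤ] S where
  toFun := evalFun c
  map_one' := by
    classical
    rw [evalFun, finsum_eq_single _ 0]
    · rw [famPow_zero, MvPowerSeries.coeff_zero_one]; rfl
    · intro m hm
      rw [MvPowerSeries.coeff_one, if_neg hm, TensorProduct.tmul_zero]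
  map_mul' := evalFun_mul hc
  map_zero' := by simp [evalFun]
  map_add' F G := by
    obtain ⟨n, hn⟩ := hc.exists_bound
    rw [hn.evalFun_eq, hn.evalFun_eq, hn.evalFun_eq, ← Finset.sum_add_distrib]
    simp only [map_add, TensorProduct.tmul_add]

theorem evalSeries_eq {c : τ → A} (hc : IsFormalFamily c) {n : τ →₀ ℕ} (h : FamBound c n)
    (F : MvPowerSeries τ S) : evalSeries hc F =
      ∑ m ∈ monoIic n, famPow c m ⊗ₜ[ℤ] MvPowerSeries.coeff m F := h.evalFun_eq F

theorem evalSeries_congr {c : τ → A} (hc : IsFormalFamily c) {F G : MvPowerSeries τ S}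
    (h : ∀ m, famPow c m ≠ 0 → MvPowerSeries.coeff m F = MvPowerSeries.coeff m G) :
    evalSeries hc F = evalSeries hc G := by
  refine finsum_congr fun m => ?_
  by_cases h0 : famPow c m = 0
  · rw [h0, TensorProduct.zero_tmul, TensorProduct.zero_tmul]
  · rw [h m h0]

theorem degree_le_degree {m n : τ →₀ ℕ} (h : m ≤ n) : m.degree ≤ n.degree := by
  rw [← tsub_add_cancel_of_le h, map_add]
  exact le_add_self

open NCSeries

/-- The bound is stated for all large K, so that two evaluations, possibly in different variables,
can be cut at a common index. -/
theorem evalSeries_gsum {c : τ → A} (hc : IsFormalFamily c) {f : ℕ → MvPowerSeries τ S}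
    (hf : IsGraded f) : ∃ K₀, ∀ K, K₀ ≤ K →
      evalSeries hc (gsum f) = ∑ k ∈ Finset.range (K + 1), evalSeries hc (f k) := by
  obtain ⟨n, hn⟩ := hc.exists_bound
  refine ⟨n.degree, fun K hK => ?_⟩
  simp only [evalSeries_eq hc hn]
  rw [Finset.sum_comm]
  refine Finset.sum_congr rfl fun m hm => ?_
  rw [hf.coeff_gsum ((degree_le_degree (mem_monoIic.1 hm)).trans hK), TensorProduct.tmul_sum]

variable [Algebra ℚ S]

variable (A S) in
/-- Multiplication by a rational number on the second tensor factor. -/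
noncomputable def ratScale (q : ℚ) : A ⊗[ℤ] S →ₗ[ℤ] A ⊗[ℤ] S :=
  LinearMap.lTensor A ((q • (LinearMap.id : S →ₗ[ℚ] S)).restrictScalars ℤ)

theorem evalSeries_smul {c : τ → A} (hc : IsFormalFamily c) (q : ℚ) (F : MvPowerSeries τ S) :
    evalSeries hc (q • F) = ratScale A S q (evalSeries hc F) := by
  obtain ⟨n, hn⟩ := hc.exists_bound
  rw [evalSeries_eq hc hn, evalSeries_eq hc hn, map_sum]
  rfl

theorem evalSeries_mapLin {S' : Type*} [Ring S'] [Algebra ℚ S'] {c : τ → A} (hc : IsFormalFamily c)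
    (T : S →ₗ[ℚ] S') (F : MvPowerSeries τ S) :
    evalSeries hc (mapLin T F) = LinearMap.lTensor A (T.restrictScalars ℤ) (evalSeries hc F) := by
  obtain ⟨n, hn⟩ := hc.exists_bound
  rw [evalSeries_eq hc hn, evalSeries_eq hc hn, map_sum]
  rfl

theorem evalSeries_gsum_pow {c : τ → A} (hc : IsFormalFamily c) {x : MvPowerSeries τ S}
    (hx : MvPowerSeries.constantCoeff x = 0) (q : ℕ → ℚ) : ∃ K₀, ∀ K, K₀ ≤ K →
      evalSeries hc (gsum fun k => q k • x ^ k) =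
        ∑ k ∈ Finset.range (K + 1), ratScale A S (q k) (evalSeries hc x ^ k) := by
  obtain ⟨K₀, h⟩ := evalSeries_gsum hc ((isGraded_pow hx).smul q)
  refine ⟨K₀, fun K hK => (h K hK).trans (Finset.sum_congr rfl fun k _ => ?_)⟩
  rw [evalSeries_smul, map_pow]

/-- The value of a rational power series in x is a finite sum of scaled powers of the value of x.
Rational scalars act through S, since A itself may have torsion. The two series may live in
different sets of variables. -/
theorem evalSeries_gsum_pow_congr {τ' : Type*} {c : τ → A} (hc : IsFormalFamily c) {d : τ' → A}
    (hd : IsFormalFamily d) {x : MvPowerSeries τ S} {y : MvPowerSeries τ' S}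
    (hx : MvPowerSeries.constantCoeff x = 0) (hy : MvPowerSeries.constantCoeff y = 0)
    (h : evalSeries hc x = evalSeries hd y) (q : ℕ → ℚ) :
    evalSeries hc (gsum fun k => q k • x ^ k) = evalSeries hd (gsum fun k => q k • y ^ k) := by
  obtain ⟨K₁, h₁⟩ := evalSeries_gsum_pow hc hx q
  obtain ⟨K₂, h₂⟩ := evalSeries_gsum_pow hd hy q
  rw [h₁ (max K₁ K₂) (le_max_left _ _), h₂ (max K₁ K₂) (le_max_right _ _), h]

end EvalSeries

/-! ### Values of the generating series -/

section EvalTheta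

open NCSeries

variable {τ τ' A R : Type*} [CommRing A] [Ring R]

/-- The value of `Θₗ(1 + x)` at a formal family depends only on the value of `x`. -/
theorem evalSeries_theta_congr (l : ℕ+) {c : τ → A} (hc : IsFormalFamily c) {d : τ' → A}
    (hd : IsFormalFamily d) {x : MvPowerSeries τ (RatLie R)} {y : MvPowerSeries τ' (RatLie R)}
    (hx : MvPowerSeries.constantCoeff x = 0) (hy : MvPowerSeries.constantCoeff y = 0)
    (h : evalSeries hc x = evalSeries hd y) :
    evalSeries hc (theta l x) = evalSeries hd (theta l y) := by
  rw [theta_eq, theta_eq]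
  refine evalSeries_gsum_pow_congr hc hd (constantCoeff_mapLin_logOneAdd l x)
    (constantCoeff_mapLin_logOneAdd l y) ?_ _
  rw [evalSeries_mapLin, evalSeries_mapLin, logOneAdd_eq, logOneAdd_eq,
    evalSeries_gsum_pow_congr hc hd hx hy h]

variable {I : Type*} (b : Module.Basis I ℤ R)

theorem evalSeries_genSeries {c : I × ℕ+ → A} (hc : IsFormalFamily c) : ∃ L₀, ∀ L, L₀ ≤ L →
    evalSeries hc (genSeries b) = ((List.range L).map fun l =>
      evalSeries hc (theta l.succPNat (powerSumSeries b l.succPNat))).prod := by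
  obtain ⟨n, hn⟩ := hc.exists_bound
  refine ⟨symDegree n, fun L hL => ?_⟩
  have h1 : evalSeries hc (genSeries b) = evalSeries hc (partProd b L) := by
    refine evalSeries_congr hc fun m hm => (coeff_partProd b ?_).symm
    refine le_trans ?_ hL
    rw [← tsub_add_cancel_of_le (hn m hm), symDegree_add]
    exact le_add_self
  rw [h1, partProd, map_list_prod, List.map_map]
  rfl

/-- The power series in more variables obtained by an injection of the variables. -/
noncomputable def extendVars {S : Type*} [Ring S] (g : τ → τ') (F : MvPowerSeries τ S) :
    MvPowerSeries τ' S := Function.extend (Finsupp.mapDomain g) F 0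

theorem coeff_extendVars {S : Type*} [Ring S] {g : τ → τ'} (hg : Function.Injective g)
    (F : MvPowerSeries τ S) (m : τ →₀ ℕ) :
    MvPowerSeries.coeff (m.mapDomain g) (extendVars g F) = MvPowerSeries.coeff m F :=
  (Finsupp.mapDomain_injective hg).extend_apply F 0 m

theorem constantCoeff_extendVars {S : Type*} [Ring S] {g : τ → τ'} (hg : Function.Injective g)
    (F : MvPowerSeries τ S) :
    MvPowerSeries.constantCoeff (extendVars g F) = MvPowerSeries.constantCoeff F := by
  have := coeff_extendVars hg F 0
  rwa [Finsupp.mapDomain_zero] at this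

theorem famPow_mapDomain (g : τ → τ') (f : τ' → A) (m : τ →₀ ℕ) :
    famPow f (m.mapDomain g) = famPow (fun s => f (g s)) m :=
  Finsupp.prod_mapDomain_index (fun _ => pow_zero _) fun _ _ _ => pow_add _ _ _

/-- Monomials that involve a variable outside the image of g have coefficient zero, and on the
others the two families agree. -/
theorem evalSeries_extendVars {S : Type*} [Ring S] {g : τ → τ'} (hg : Function.Injective g)
    {f : τ' → A} (hf : IsFormalFamily f) {c : τ → A} (hc : IsFormalFamily c)
    (h : ∀ s, f (g s) = c s) (F : MvPowerSeries τ S) :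
    evalSeries hf (extendVars g F) = evalSeries hc F := by
  classical
  show ∑ᶠ m, famPow f m ⊗ₜ[ℤ] MvPowerSeries.coeff m (extendVars g F) =
    ∑ᶠ m, famPow c m ⊗ₜ[ℤ] MvPowerSeries.coeff m F
  have h1 := finsum_mem_range (f := fun m => famPow f m ⊗ₜ[ℤ] MvPowerSeries.coeff m (extendVars g F))
    (Finsupp.mapDomain_injective (M := ℕ) hg)
  have h2 : (fun s => f (g s)) = c := funext h
  simp only [coeff_extendVars hg, famPow_mapDomain, h2] at h1
  rw [← h1, finsum_mem_def]
  refine finsum_congr fun m => ?_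
  rw [Set.indicator_apply]
  split_ifs with hm
  · rfl
  · have : MvPowerSeries.coeff m (extendVars g F) = 0 := by
      refine Function.extend_apply' _ _ _ ?_
      rintro ⟨k, hk⟩
      exact hm ⟨k, hk⟩
    rw [this, TensorProduct.tmul_zero]

theorem IsFormalFamily.sumElim {c : τ → A} {d : τ' → A} (hc : IsFormalFamily c)
    (hd : IsFormalFamily d) : IsFormalFamily (Sum.elim c d) where
  nilpotent := by
    rintro (s | s)
    · exact hc.nilpotent s
    · exact hd.nilpotent s
  finite := by
    refine ((hc.finite.image Sum.inl).union (hd.finite.image Sum.inr)).subset ?_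
    rintro (s | s) hs
    · exact Or.inl ⟨s, hs, rfl⟩
    · exact Or.inr ⟨s, hs, rfl⟩

/-- Multiplicativity of the product of the `Θₗ`. -/
theorem evalSeries_genSeries_mul {c d e : I × ℕ+ → A} (hc : IsFormalFamily c)
    (hd : IsFormalFamily d) (he : IsFormalFamily e)
    (h : ∀ l : ℕ+, (1 + evalSeries hc (powerSumSeries b l)) *
      (1 + evalSeries hd (powerSumSeries b l)) = 1 + evalSeries he (powerSumSeries b l)) :
    evalSeries hc (genSeries b) * evalSeries hd (genSeries b) = evalSeries he (genSeries b) := by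
  -- Multiplicativity of Θ_l is an identity of power series, so the two families are placed on
  -- disjoint copies of the variables, where both arguments live in one ring.
  have hf := hc.sumElim hd
  obtain ⟨L₁, h₁⟩ := evalSeries_genSeries b hc
  obtain ⟨L₂, h₂⟩ := evalSeries_genSeries b hd
  obtain ⟨L₃, h₃⟩ := evalSeries_genSeries b he
  set L := max L₁ (max L₂ L₃)
  rw [h₁ L (le_max_left _ _), h₂ L (le_max_of_le_right (le_max_left _ _)),
    h₃ L (le_max_of_le_right (le_max_right _ _))]
  let x := fun l : ℕ+ => extendVars (Sum.inl : _ → (I × ℕ+) ⊕ (I × ℕ+)) (powerSumSeries b l)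
  let y := fun l : ℕ+ => extendVars (Sum.inr : _ → (I × ℕ+) ⊕ (I × ℕ+)) (powerSumSeries b l)
  have hx0 : ∀ l, MvPowerSeries.constantCoeff (x l) = 0 := fun l => by
    rw [constantCoeff_extendVars Sum.inl_injective, constantCoeff_powerSumSeries]
  have hy0 : ∀ l, MvPowerSeries.constantCoeff (y l) = 0 := fun l => by
    rw [constantCoeff_extendVars Sum.inr_injective, constantCoeff_powerSumSeries]
  have hx : ∀ l, evalSeries hf (x l) = evalSeries hc (powerSumSeries b l) := fun l =>
    evalSeries_extendVars Sum.inl_injective hf hc (fun _ => rfl) _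
  have hy : ∀ l, evalSeries hf (y l) = evalSeries hd (powerSumSeries b l) := fun l =>
    evalSeries_extendVars Sum.inr_injective hf hd (fun _ => rfl) _
  have hp := fun l => constantCoeff_powerSumSeries b l
  have h1 : ∀ l : ℕ, evalSeries hc (theta l.succPNat (powerSumSeries b l.succPNat)) =
      evalSeries hf (theta l.succPNat (x l.succPNat)) := fun l =>
    evalSeries_theta_congr _ hc hf (hp _) (hx0 _) (hx _).symm
  have h2 : ∀ l : ℕ, evalSeries hd (theta l.succPNat (powerSumSeries b l.succPNat)) =
      evalSeries hf (theta l.succPNat (y l.succPNat)) := fun l =>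
    evalSeries_theta_congr _ hd hf (hp _) (hy0 _) (hy _).symm
  have h3 : ∀ l : ℕ, evalSeries hf (theta l.succPNat (x l.succPNat)) *
      evalSeries hf (theta l.succPNat (y l.succPNat)) =
        evalSeries he (theta l.succPNat (powerSumSeries b l.succPNat)) := by
    intro l
    rw [← map_mul, theta_mul _ (hx0 _) (hy0 _)]
    -- As a series, (1 + x)(1 + y) is not of the form 1 + ∑ p_l U; only its value is. This suffices,
    -- since the value of Θ_l depends only on the value of its argument.
    refine evalSeries_theta_congr _ hf he ?_ (hp _) ?_
    · simp [hx0, hy0]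
    · have h4 := h l.succPNat
      rw [map_add, map_add, map_mul, hx, hy]
      refine add_left_cancel (a := 1) (Eq.trans ?_ h4)
      noncomm_ring
  simp only [h1, h2, ← h3]
  refine list_prod_mul_prod _ _ (fun i j hij => ?_) L
  exact (theta_commute (fun h => hij (Nat.succPNat_injective h)) _ _).map (evalSeries hf)

end EvalTheta

/-! ### The universal ring with a bounded formal family -/

section TruncRing

variable {τ : Type*} (n : τ →₀ ℕ)

/-- The polynomials without monomials dividing `n`. -/
def truncIdeal : Ideal (MvPolynomial τ ℤ) where
  carrier := {f | ∀ m ≤ n, MvPolynomial.coeff m f = 0}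
  zero_mem' := fun m _ => MvPolynomial.coeff_zero m
  add_mem' := fun {f g} hf hg m hm => by rw [MvPolynomial.coeff_add, hf m hm, hg m hm, add_zero]
  smul_mem' := fun c f hf m hm => by
    classical
    rw [smul_eq_mul, MvPolynomial.coeff_mul]
    refine Finset.sum_eq_zero fun p hp => ?_
    have h := Finset.HasAntidiagonal.mem_antidiagonal.1 hp
    rw [hf p.2 ((h ▸ le_add_self).trans hm), mul_zero]

/-- The quotient of the polynomial ring in which only the monomials dividing `n` survive. -/
abbrev TruncRing : Type _ := MvPolynomial τ ℤ ⧸ truncIdeal n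

/-- The coefficient at a monomial dividing `n`. -/
noncomputable def truncCoeff (m : {m // m ≤ n}) : TruncRing n →+ ℤ :=
  QuotientAddGroup.lift (truncIdeal n).toAddSubgroup (MvPolynomial.lcoeff ℤ m.1).toAddMonoidHom
    fun _ hf => hf m.1 m.2

theorem truncCoeff_mk (m : {m // m ≤ n}) (f : MvPolynomial τ ℤ) :
    truncCoeff n m (Ideal.Quotient.mk (truncIdeal n) f) = MvPolynomial.coeff m.1 f := rfl

variable {n}

theorem truncRing_ext {x y : TruncRing n} (h : ∀ m, truncCoeff n m x = truncCoeff n m y) :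
    x = y := by
  obtain ⟨f, rfl⟩ := Ideal.Quotient.mk_surjective x
  obtain ⟨g, rfl⟩ := Ideal.Quotient.mk_surjective y
  rw [Ideal.Quotient.eq]
  intro m hm
  have := h ⟨m, hm⟩
  rw [truncCoeff_mk, truncCoeff_mk] at this
  rw [MvPolynomial.coeff_sub, this, sub_self]

theorem truncRing_torsionFree {k : ℕ} (hk : k ≠ 0) {x : TruncRing n} (h : (k : TruncRing n) * x = 0) :
    x = 0 := by
  refine truncRing_ext fun m => ?_
  have h1 := congrArg (truncCoeff n m) h
  rw [← nsmul_eq_mul, map_nsmul, map_zero] at h1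
  rw [map_zero]
  exact (smul_eq_zero.1 h1).resolve_left hk

/-- An element is given by integers at the finitely many divisors of n. Countability provides a copy
of the ring in every universe, so that it can serve as a test ring. -/
instance : Countable (TruncRing n) := by
  have : Finite {m // m ≤ n} :=
    Set.Finite.subset (monoIic n).finite_toSet fun m hm => Finset.mem_coe.2 (mem_monoIic.2 hm)
  refine Function.Injective.countable (f := fun (x : TruncRing n) m => truncCoeff n m x) fun x y h => ?_
  exact truncRing_ext fun m => congrFun h m

variable (n) in
/-- The universal family bounded by `n`. -/
noncomputable def truncVar (s : τ) : TruncRing n := Ideal.Quotient.mk _ (MvPolynomial.X s)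

theorem famPow_single {τ A : Type*} [CommRing A] (c : τ → A) (s : τ) (k : ℕ) :
    famPow c (Finsupp.single s k) = c s ^ k := Finsupp.prod_single_index (pow_zero _)

theorem famPow_truncVar (m : τ →₀ ℕ) :
    famPow (truncVar n) m = Ideal.Quotient.mk _ (MvPolynomial.monomial m 1) := by
  rw [show truncVar n = fun s => Ideal.Quotient.mk (truncIdeal n) (MvPolynomial.X s) from rfl,
    ← map_famPow]
  congr 1
  rw [MvPolynomial.monomial_eq, MvPolynomial.C_1, one_mul]
  rfl

theorem truncCoeff_famPow [DecidableEq τ] (m : {m // m ≤ n}) (k : τ →₀ ℕ) :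
    truncCoeff n m (famPow (truncVar n) k) = if k = m.1 then 1 else 0 := by
  rw [famPow_truncVar, truncCoeff_mk, MvPolynomial.coeff_monomial]

theorem famBound_truncVar : FamBound (truncVar n) n := by
  classical
  intro m hm
  by_contra h
  refine hm (truncRing_ext fun k => ?_)
  rw [truncCoeff_famPow, map_zero, if_neg]
  rintro rfl
  exact h k.2

theorem isFormalFamily_truncVar : IsFormalFamily (truncVar n) where
  nilpotent s := by
    refine ⟨n s + 1, ?_⟩
    have h : famPow (truncVar n) (Finsupp.single s (n s + 1)) = 0 := by
      by_contra h0
      have := famBound_truncVar _ h0 s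
      simp at this
    rwa [famPow_single] at h
  finite := by
    refine n.support.finite_toSet.subset fun s hs => ?_
    rw [Finset.mem_coe, Finsupp.mem_support_iff]
    intro h0
    refine hs ?_
    have h : famPow (truncVar n) (Finsupp.single s 1) = 0 := by
      by_contra h1
      have := famBound_truncVar _ h1 s
      rw [h0] at this
      simp at this
    rwa [famPow_single, pow_one] at h

variable {A : Type*} [CommRing A]

/-- The homomorphism from the universal ring given by a family bounded by `n`. -/
noncomputable def truncLift {c : τ → A} (hc : FamBound c n) : TruncRing n →+* A :=
  Ideal.Quotient.lift (truncIdeal n) (MvPolynomial.aeval c).toRingHom fun f hf => by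
    show MvPolynomial.aeval c f = 0
    rw [← hc.sum_coeff f]
    refine Finset.sum_eq_zero fun m hm => ?_
    rw [hf m (mem_monoIic.1 hm), Int.cast_zero, zero_mul]

theorem truncLift_truncVar {c : τ → A} (hc : FamBound c n) (s : τ) :
    truncLift hc (truncVar n s) = c s := by
  show MvPolynomial.aeval c (MvPolynomial.X s) = c s
  exact MvPolynomial.aeval_X c s

variable (n) in
/-- The coefficient at a monomial dividing `n` of an element of the tensor product. -/
noncomputable def tensorCoeff (S : Type*) [AddCommGroup S] (m : {m // m ≤ n}) :
    TruncRing n ⊗[ℤ] S →+ S :=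
  (TensorProduct.lid ℤ S).toLinearMap.toAddMonoidHom.comp
    (LinearMap.rTensor S (truncCoeff n m).toIntLinearMap).toAddMonoidHom

theorem tensorCoeff_tmul {S : Type*} [AddCommGroup S] (m : {m // m ≤ n}) (x : TruncRing n) (s : S) :
    tensorCoeff n S m (x ⊗ₜ s) = truncCoeff n m x • s := by
  show TensorProduct.lid ℤ S (truncCoeff n m x ⊗ₜ s) = _
  rw [TensorProduct.lid_tmul]

end TruncRing

/-! ### Ghost components -/

namespace BigWitt

variable {A B : Type*} [CommRing A] [CommRing B]

theorem logDer_mapFun (f : A →+* B) (x : BigWitt A) :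
    logDer (mapFun f x) = PowerSeries.map f (logDer x) := by
  refine logDer_eq _ _ ?_
  show _ = PowerSeries.map f x.series * _
  rw [← map_mul, series_mul_logDer]
  ext n
  rw [PowerSeries.coeff_map, coeff_X_mul_der, coeff_X_mul_der, map_mul, map_natCast]
  rfl

theorem neg_one_pow_mul_self (k : ℕ) : ((-1 : A) ^ k) * (-1) ^ k = 1 := by
  rw [← mul_pow]; simp

/-- The identity is known over domains of characteristic zero; it holds for lifts to ℤ[A] and is
carried to A by the canonical surjection. -/
theorem coeff_logDer_mul' (x y : BigWitt A) (n : ℕ) :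
    PowerSeries.coeff n (logDer (x * y)) =
      PowerSeries.coeff n (logDer (1 : BigWitt A)) * PowerSeries.coeff n (logDer x) *
        PowerSeries.coeff n (logDer y) := by
  have h := congrArg (polyEval A) (coeff_logDer_mul (liftPoly x) (liftPoly y) n)
  simp only [map_mul, ← PowerSeries.coeff_map, ← logDer_mapFun, mapFun_mul, mapFun_liftPoly,
    mapFun_one] at h
  exact h

/-- The `l`-th ghost component, the value of the power sum `pₗ`. -/
noncomputable def ghost (l : ℕ+) : BigWitt A →+* A where
  toFun x := (-1) ^ ((l : ℕ) + 1) * PowerSeries.coeff l (logDer x)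
  map_one' := by rw [logDer_one _ l.ne_zero, neg_one_pow_mul_self]
  map_mul' x y := by
    rw [coeff_logDer_mul', logDer_one _ l.ne_zero]
    ring
  map_zero' := by
    have : logDer (0 : BigWitt A) = 0 := logDer_eq _ _ (by simp [series_zero])
    rw [this, map_zero, mul_zero]
  map_add' x y := by rw [logDer_add, map_add, mul_add]

theorem ghost_apply (l : ℕ+) (x : BigWitt A) :
    ghost l x = (-1) ^ ((l : ℕ) + 1) * PowerSeries.coeff l (logDer x) := rfl

/-- The homomorphism Λ → A that classifies x carries the universal Witt vector to x, and logarithmic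
derivatives are natural. -/
theorem ghost_eq_aeval (l : ℕ+) (x : BigWitt A) :
    ghost l x = MvPolynomial.aeval (fun k : ℕ+ => coeff k x) (powerSum l) := by
  set f : SymFun →+* A := (MvPolynomial.aeval (fun k : ℕ+ => coeff k x)).toRingHom with hf
  have h : mapFun f genericWitt = x := by
    refine ext_coeff fun n => ?_
    rw [coeff_mapFun, coeff_genericWitt]
    rcases Nat.eq_zero_or_pos n with rfl | hn
    · rw [coeff_zero]; simp [elemSym]
    · lift n to ℕ+ using hn
      rw [elemSym_pnat]
      exact MvPolynomial.aeval_X _ _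
  show _ = f (powerSum l)
  rw [powerSum, map_mul, map_pow, map_neg, map_one, ← PowerSeries.coeff_map, ← logDer_mapFun, h,
    ghost_apply]

/-- The big Witt vector with given components. -/
noncomputable def ofFamily (c : ℕ+ → A) : BigWitt A :=
  ⟨PowerSeries.mk fun n => if h : 0 < n then c ⟨n, h⟩ else 1, by
    rw [← PowerSeries.coeff_zero_eq_constantCoeff_apply, PowerSeries.coeff_mk]; simp⟩

theorem coeff_ofFamily (c : ℕ+ → A) (k : ℕ+) : coeff k (ofFamily c) = c k := by
  rw [coeff, ofFamily, PowerSeries.coeff_mk, dif_pos k.pos]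
  rfl

theorem ext_pnat {x y : BigWitt A} (h : ∀ k : ℕ+, coeff k x = coeff k y) : x = y := by
  refine ext_coeff fun n => ?_
  rcases Nat.eq_zero_or_pos n with rfl | hn
  · rw [coeff_zero, coeff_zero]
  · exact h ⟨n, hn⟩

theorem coeff_pnat_zero (k : ℕ+) : coeff k (0 : BigWitt A) = 0 := by
  rw [coeff, series_zero, PowerSeries.coeff_one, if_neg k.ne_zero]

theorem mem_formalIdeal_iff {x : BigWitt A} :
    x ∈ formalIdeal A ↔ IsFormalFamily fun k : ℕ+ => coeff k x := by
  constructor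
  · rintro ⟨h1, h2⟩
    exact ⟨fun k => h1 k k.ne_zero, h2.preimage (f := fun k : ℕ+ => (k : ℕ)) (fun _ _ _ _ h => PNat.eq h)⟩
  · rintro ⟨h1, h2⟩
    refine ⟨fun n hn => h1 ⟨n, Nat.pos_of_ne_zero hn⟩, ?_⟩
    refine ((h2.image fun k : ℕ+ => (k : ℕ)).union (Set.finite_singleton 0)).subset fun n hn => ?_
    rcases Nat.eq_zero_or_pos n with rfl | h
    · exact Or.inr rfl
    · exact Or.inl ⟨⟨n, h⟩, hn, rfl⟩

theorem isNilpotent_coeff_logDer {x : BigWitt A} (hx : x ∈ formalIdeal A) (n : ℕ) :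
    IsNilpotent (PowerSeries.coeff n (logDer x)) := by
  rw [← mem_nilradical, logDer, PowerSeries.coeff_mul]
  refine Ideal.sum_mem _ fun p _ => Ideal.mul_mem_left _ _ ?_
  rw [coeff_X_mul_der]
  rcases Nat.eq_zero_or_pos p.2 with h | h
  · rw [h, Nat.cast_zero, zero_mul]; exact zero_mem _
  · exact Ideal.mul_mem_left _ _ (mem_nilradical.2 (hx.1 p.2 h.ne'))

/-- The series of an element of Ŵ(A) is a polynomial with polynomial inverse, so its logarithmic
derivative is a polynomial. -/
theorem exists_coeff_logDer_eq_zero {x : BigWitt A} (hx : x ∈ formalIdeal A) :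
    ∃ N, ∀ n, N < n → PowerSeries.coeff n (logDer x) = 0 := by
  obtain ⟨f, hf, hfx⟩ := (isFormal_iff x).1 hx
  obtain ⟨g, hg⟩ := hf.exists_left_inv
  have h1 : (-x).series = (g : A⟦X⟧) := by
    refine (left_inv_eq_right_inv (a := x.series) ?_ (series_neg x)).symm
    rw [← hfx, ← Polynomial.coe_mul, hg, Polynomial.coe_one]
  have h2 : logDer x = ((g * (Polynomial.X * Polynomial.derivative f) : Polynomial A) : A⟦X⟧) := by
    rw [logDer, h1, ← hfx, PowerSeries.derivative_coe, Polynomial.coe_mul, Polynomial.coe_mul,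
      Polynomial.coe_X]
  refine ⟨(g * (Polynomial.X * Polynomial.derivative f)).natDegree, fun n hn => ?_⟩
  rw [h2, Polynomial.coeff_coe, Polynomial.coeff_eq_zero_of_natDegree_lt hn]

theorem eq_zero_of_ghost_eq_zero (ht : ∀ k : ℕ, k ≠ 0 → ∀ a : A, (k : A) * a = 0 → a = 0)
    {x : BigWitt A} (h : ∀ l, ghost l x = 0) : x = 0 := by
  refine ext_pnat fun k => ?_
  rw [coeff_pnat_zero]
  refine ht k k.ne_zero _ ?_
  rw [newton]
  refine Finset.sum_eq_zero fun p _ => ?_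
  rcases Nat.eq_zero_or_pos p.2 with h0 | h0
  · rw [h0, coeff_zero_logDer, mul_zero]
  · have h1 : (-1) ^ (p.2 + 1) * PowerSeries.coeff p.2 (logDer x) = 0 := h ⟨p.2, h0⟩
    rw [← one_mul (PowerSeries.coeff p.2 (logDer x)), ← neg_one_pow_mul_self (p.2 + 1), mul_assoc, h1,
      mul_zero, mul_zero]

/-- Without torsion the ghost components are jointly injective. They are nilpotent and vanish from
some index on, so a common exponent annihilates all of them. -/
theorem isNilpotent_of_torsionFree (ht : ∀ k : ℕ, k ≠ 0 → ∀ a : A, (k : A) * a = 0 → a = 0)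
    {x : BigWitt A} (hx : x ∈ formalIdeal A) : IsNilpotent x := by
  choose K hK using isNilpotent_coeff_logDer hx
  obtain ⟨N, hN⟩ := exists_coeff_logDer_eq_zero hx
  -- The sum dominates every single exponent; the summand 1 keeps the exponent positive, as is
  -- needed for the components that are zero.
  refine ⟨∑ n ∈ Finset.range (N + 1), K n + 1, eq_zero_of_ghost_eq_zero ht fun l => ?_⟩
  rw [map_pow, ghost_apply, mul_pow]
  rcases lt_or_ge N (l : ℕ) with h | h
  · rw [hN _ h, zero_pow (Nat.succ_ne_zero _), mul_zero]
  · have h1 : K l ≤ ∑ n ∈ Finset.range (N + 1), K n :=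
      Finset.single_le_sum (fun _ _ => Nat.zero_le _) (Finset.mem_range.2 (by omega))
    rw [pow_eq_zero_of_le (by omega) (hK l), mul_zero]

/-- The elements of `Ŵ(A)` are nilpotent. -/
theorem isNilpotent_of_mem_formalIdeal {x : BigWitt A} (hx : x ∈ formalIdeal A) :
    IsNilpotent x := by
  -- Torsion in A is avoided by passing to the universal bounded family: it lives over a
  -- torsion-free ring, and x is an image of it.
  obtain ⟨n, hn⟩ := (mem_formalIdeal_iff.1 hx).exists_bound
  have h1 : ofFamily (truncVar n) ∈ formalIdeal (TruncRing n) := by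
    rw [mem_formalIdeal_iff]
    simp only [coeff_ofFamily]
    exact isFormalFamily_truncVar
  have h2 : map (truncLift hn) (ofFamily (truncVar n)) = x := by
    refine ext_pnat fun k => ?_
    exact (coeff_mapFun _ _ _).trans (by rw [coeff_ofFamily, truncLift_truncVar])
  rw [← h2]
  exact (isNilpotent_of_torsionFree (fun k hk a => truncRing_torsionFree hk) h1).map _

end BigWitt

/-! ### Coordinates of the formal neighbourhood -/

theorem IsFormalFamily.prod {I J A : Type*} [CommRing A] {c : I × J → A}
    (h : ∀ U, IsFormalFamily fun k => c (U, k)) (hfin : {U | ∃ k, c (U, k) ≠ 0}.Finite) :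
    IsFormalFamily c where
  nilpotent s := (h s.1).nilpotent s.2
  finite := by
    refine (hfin.biUnion fun U _ => (h U).finite.image (Prod.mk U)).subset ?_
    rintro ⟨U, k⟩ hs
    exact Set.mem_biUnion ⟨k, hs⟩ ⟨k, hs, rfl⟩

/-! ### Nilpotency of sums with nilpotent scalar coefficients -/

section NilpotentSpan

variable {B M : Type*} [CommRing B] [Ring M] [Algebra B M]

theorem pow_mem_ideal_smul_top {J : Ideal B} {z : M} (hz : z ∈ J • (⊤ : Submodule B M)) (k : ℕ) :
    z ^ k ∈ J ^ k • (⊤ : Submodule B M) := by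
  induction k with
  | zero => simp
  | succ k ih =>
    rw [pow_succ z, pow_succ' J, Submodule.mul_smul]
    have h1 : ∀ y, z ^ k * y ∈ J ^ k • (⊤ : Submodule B M) := by
      intro y
      refine Submodule.smul_induction_on ih (fun a ha v _ => ?_) fun v w hv hw => ?_
      · rw [smul_mul_assoc]
        exact Submodule.smul_mem_smul ha Submodule.mem_top
      · rw [add_mul]; exact add_mem hv hw
    generalize z ^ k = w at h1 ⊢
    refine Submodule.smul_induction_on hz (fun a ha y _ => ?_) fun v v' hv hv' => ?_
    · rw [mul_smul_comm]
      exact Submodule.smul_mem_smul ha (h1 y)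
    · rw [mul_add]; exact add_mem hv hv'

/-- Finitely many nilpotent scalars generate a nilpotent ideal J, and the k-th power of the sum lies
in Jᵏ M. The vectors y need not commute, because the scalars are central. -/
theorem isNilpotent_sum_smul {ι : Type*} (s : Finset ι) (x : ι → B) (hx : ∀ i ∈ s, IsNilpotent (x i))
    (y : ι → M) : IsNilpotent (∑ i ∈ s, x i • y i) := by
  set J : Ideal B := Ideal.span (x '' s)
  have hJ : IsNilpotent J := by
    rw [Ideal.FG.isNilpotent_iff_le_nilradical
      (Submodule.fg_span (s.finite_toSet.image x)), Ideal.span_le]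
    rintro _ ⟨i, hi, rfl⟩
    exact mem_nilradical.2 (hx i hi)
  obtain ⟨k, hk⟩ := hJ
  refine ⟨k, ?_⟩
  have h : ∑ i ∈ s, x i • y i ∈ J • (⊤ : Submodule B M) := Submodule.sum_mem _ fun i hi =>
    Submodule.smul_mem_smul (Ideal.subset_span ⟨i, hi, rfl⟩) Submodule.mem_top
  have h1 := pow_mem_ideal_smul_top h k
  rwa [hk, Submodule.zero_eq_bot, Submodule.bot_smul, Submodule.mem_bot] at h1

end NilpotentSpan

section Coordinates

variable {R I A : Type*} [Ring R] [CommRing A] (b : Module.Basis I ℤ R)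

/-- The coefficient of `U` of an element of `W(A) ⊗ R`. -/
noncomputable def wittCoord (z : BigWitt A ⊗[ℤ] R) : I →₀ BigWitt A :=
  (Algebra.TensorProduct.basis (BigWitt A) b).repr z

theorem wittCoord_add (y z : BigWitt A ⊗[ℤ] R) :
    wittCoord b (y + z) = wittCoord b y + wittCoord b z := map_add _ _ _

theorem wittCoord_zero : wittCoord b (0 : BigWitt A ⊗[ℤ] R) = 0 := map_zero _

theorem wittCoord_tmul (x : BigWitt A) (r : R) (U : I) :
    wittCoord b (x ⊗ₜ r) U = b.repr r U • x := by
  rw [wittCoord, Algebra.TensorProduct.basis_repr_tmul, Finsupp.smul_apply, Finsupp.mapRange_apply,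
    smul_eq_mul, zsmul_eq_mul, mul_comm]
  rfl

theorem sum_wittCoord (z : BigWitt A ⊗[ℤ] R) :
    ∑ U ∈ (wittCoord b z).support, wittCoord b z U ⊗ₜ b U = z := by
  have h := (Algebra.TensorProduct.basis (BigWitt A) b).linearCombination_repr z
  rw [Finsupp.linearCombination_apply, Finsupp.sum] at h
  refine Eq.trans (Finset.sum_congr rfl fun U _ => ?_) h
  rw [Algebra.TensorProduct.basis_apply, TensorProduct.smul_tmul', smul_eq_mul, mul_one]
  rfl

theorem mem_formalTensor_iff {z : BigWitt A ⊗[ℤ] R} :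
    z ∈ formalTensor R A ↔ ∀ U, wittCoord b z U ∈ BigWitt.formalIdeal A := by
  constructor
  · intro hz U
    induction hz using AddSubmonoid.closure_induction with
    | mem z hz =>
      obtain ⟨x, hx, r, rfl⟩ := hz
      rw [wittCoord_tmul]
      exact zsmul_mem hx _
    | zero => rw [wittCoord_zero]; exact zero_mem _
    | add y z _ _ hy hz => rw [wittCoord_add]; exact add_mem hy hz
  · intro h
    rw [← sum_wittCoord b z]
    exact sum_mem fun U _ => AddSubmonoid.subset_closure ⟨_, h U, _, rfl⟩

theorem isNilpotent_of_mem_formalTensor (b : Module.Basis I ℤ R) {z : BigWitt A ⊗[ℤ] R} (hz : z ∈ formalTensor R A) :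
    IsNilpotent z := by
  rw [← sum_wittCoord b z]
  have h := isNilpotent_sum_smul (wittCoord b z).support (fun U => wittCoord b z U)
    (fun U _ => BigWitt.isNilpotent_of_mem_formalIdeal ((mem_formalTensor_iff b).1 hz U))
    (fun U => (1 : BigWitt A) ⊗ₜ[ℤ] b U)
  simpa only [TensorProduct.smul_tmul', smul_eq_mul, mul_one] using h

theorem wittCoord_wittTensorMap {B : Type*} [CommRing B] (f : A →+* B) (z : BigWitt A ⊗[ℤ] R) (U : I) :
    wittCoord b (wittTensorMap R f z) U = BigWitt.map f (wittCoord b z U) := by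
  induction z using TensorProduct.induction_on with
  | zero => rw [map_zero, wittCoord_zero, wittCoord_zero]; exact (map_zero _).symm
  | add y z hy hz => rw [map_add, wittCoord_add, wittCoord_add, Finsupp.add_apply, hy, hz,
      Finsupp.add_apply, map_add]
  | tmul x r =>
    have : wittTensorMap R f (x ⊗ₜ r) = BigWitt.map f x ⊗ₜ r := by simp [wittTensorMap]
    rw [this, wittCoord_tmul, wittCoord_tmul, map_zsmul]

theorem nbhdCoord_eq (u : formalNbhd R A) (s : I × ℕ+) :
    nbhdCoord b u s =
      BigWitt.coeff s.2 (wittCoord b (((u : (BigWitt A ⊗[ℤ] R)ˣ) : BigWitt A ⊗[ℤ] R) - 1) s.1) := rfl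

theorem isFormalFamily_nbhdCoord (u : formalNbhd R A) : IsFormalFamily (nbhdCoord b u) := by
  refine IsFormalFamily.prod (fun U => BigWitt.mem_formalIdeal_iff.1
    ((mem_formalTensor_iff b).1 u.2 U)) ?_
  refine (wittCoord b (((u : (BigWitt A ⊗[ℤ] R)ˣ) : BigWitt A ⊗[ℤ] R) - 1)).support.finite_toSet.subset ?_
  rintro U ⟨k, hk⟩
  rw [Finset.mem_coe, Finsupp.mem_support_iff]
  intro h
  exact hk (by rw [nbhdCoord_eq, h, BigWitt.coeff_pnat_zero])

theorem nbhdCoord_injective : Function.Injective (nbhdCoord b : formalNbhd R A → I × ℕ+ → A) := by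
  intro u v h
  refine Subtype.ext (Units.ext (sub_left_injective (b := 1) ?_))
  refine (Algebra.TensorProduct.basis (BigWitt A) b).repr.injective (Finsupp.ext fun U => ?_)
  exact BigWitt.ext_pnat fun k => congrFun h (U, k)

theorem nbhdCoord_map {B : Type*} [CommRing B] (f : A →+* B) (u : formalNbhd R A) (s : I × ℕ+) :
    nbhdCoord b (formalNbhdMap R f u) s = f (nbhdCoord b u s) := by
  rw [nbhdCoord_eq, nbhdCoord_eq]
  have h : (((formalNbhdMap R f u : formalNbhd R B) : (BigWitt B ⊗[ℤ] R)ˣ) : BigWitt B ⊗[ℤ] R) - 1 =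
      wittTensorMap R f (((u : (BigWitt A ⊗[ℤ] R)ˣ) : BigWitt A ⊗[ℤ] R) - 1) := by
    rw [map_sub, map_one]; rfl
  rw [h, wittCoord_wittTensorMap]
  exact BigWitt.coeff_mapFun _ _ _

theorem nbhdCoord_one (s : I × ℕ+) : nbhdCoord b (1 : formalNbhd R A) s = 0 := by
  rw [nbhdCoord_eq]
  have h : (((1 : formalNbhd R A) : (BigWitt A ⊗[ℤ] R)ˣ) : BigWitt A ⊗[ℤ] R) - 1 = 0 := sub_self _
  rw [h, wittCoord_zero]
  exact BigWitt.coeff_pnat_zero _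

/-- The element z with the prescribed coefficients is a finite sum with nilpotent scalars, hence
nilpotent, and 1 + z is a unit. Invertibility therefore imposes no condition on the coordinates. -/
theorem exists_nbhdCoord_eq {c : I × ℕ+ → A} (hc : IsFormalFamily c) :
    ∃ u : formalNbhd R A, nbhdCoord b u = c := by
  classical
  let x : I →₀ BigWitt A := Finsupp.onFinset (hc.finite.toFinset.image Prod.fst)
    (fun U => BigWitt.ofFamily fun k => c (U, k)) fun U hU => by
      by_contra h
      refine hU (BigWitt.ext_pnat fun k => ?_)
      rw [BigWitt.coeff_ofFamily, BigWitt.coeff_pnat_zero]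
      by_contra hk
      exact h (Finset.mem_image.2 ⟨(U, k), hc.finite.mem_toFinset.2 hk, rfl⟩)
  set z := (Algebra.TensorProduct.basis (BigWitt A) b).repr.symm x with hz
  have hx : wittCoord b z = x := LinearEquiv.apply_symm_apply _ _
  have hzf : z ∈ formalTensor R A := by
    rw [mem_formalTensor_iff b]
    intro U
    rw [hx, BigWitt.mem_formalIdeal_iff]
    show IsFormalFamily fun k : ℕ+ => BigWitt.coeff k (BigWitt.ofFamily fun k => c (U, k))
    simp only [BigWitt.coeff_ofFamily]
    exact ⟨fun k => hc.nilpotent _, hc.finite.preimage (Prod.mk_right_injective U).injOn⟩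
  obtain ⟨w, hw⟩ := (isNilpotent_of_mem_formalTensor b hzf).isUnit_one_add
  have hw1 : (w : BigWitt A ⊗[ℤ] R) - 1 = z := by rw [hw, add_sub_cancel_left]
  refine ⟨⟨w, show (w : BigWitt A ⊗[ℤ] R) - 1 ∈ _ from hw1 ▸ hzf⟩, funext fun s => ?_⟩
  rw [nbhdCoord_eq]
  show BigWitt.coeff s.2 (wittCoord b ((w : BigWitt A ⊗[ℤ] R) - 1) s.1) = _
  rw [hw1, hx]
  exact BigWitt.coeff_ofFamily _ _

variable (R) in
/-- The ring homomorphism `r ↦ 1 ⊗ r`. -/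
noncomputable def ratOf : R →+* RatLie R :=
  (Algebra.TensorProduct.includeRight : R →ₐ[ℤ] ℚ ⊗[ℤ] R).toRingHom

variable (R A) in
/-- The homomorphism given by the `l`-th ghost component on the first factor. -/
noncomputable def ghostTensor (l : ℕ+) : BigWitt A ⊗[ℤ] R →+* A ⊗[ℤ] RatLie R :=
  (Algebra.TensorProduct.map (BigWitt.ghost l).toIntAlgHom (ratOf R).toIntAlgHom).toRingHom

theorem ghostTensor_tmul (l : ℕ+) (x : BigWitt A) (r : R) :
    ghostTensor R A l (x ⊗ₜ r) = BigWitt.ghost l x ⊗ₜ RatLie.of R r :=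
  Algebra.TensorProduct.map_tmul _ _ _ _

/-- The ghost component of the coefficient at U is p_l evaluated at its entries, so the ghost map
sends u to the argument of the l-th factor of the generating series. As the ghost map is
multiplicative, so is this expression. -/
theorem ghostTensor_nbhd (l : ℕ+) (u : formalNbhd R A) :
    ghostTensor R A l ((u : (BigWitt A ⊗[ℤ] R)ˣ) : BigWitt A ⊗[ℤ] R) =
      1 + evalSeries (isFormalFamily_nbhdCoord b u) (powerSumSeries b l) := by
  classical
  set z := ((u : (BigWitt A ⊗[ℤ] R)ˣ) : BigWitt A ⊗[ℤ] R) - 1 with hz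
  set c := nbhdCoord b u with hcdef
  have hu : ((u : (BigWitt A ⊗[ℤ] R)ˣ) : BigWitt A ⊗[ℤ] R) = 1 + z := by rw [hz]; abel
  rw [hu, map_add, map_one]
  congr 1
  have hc := isFormalFamily_nbhdCoord b u
  obtain ⟨n, hn⟩ := hc.exists_bound
  -- Large enough for both expansions: the support of z, and all U for which p_l^{(U)} contains one
  -- of the divisors of n.
  set T : Finset I := (wittCoord b z).support ∪
    (monoIic n).biUnion fun m => (finite_coeff_powerSum_ne_zero l m).toFinset with hT
  have h1 : ghostTensor R A l z = ∑ U ∈ T, BigWitt.ghost l (wittCoord b z U) ⊗ₜ[ℤ] RatLie.of R (b U) := by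
    conv_lhs => rw [← sum_wittCoord b z, map_sum]
    simp only [ghostTensor_tmul]
    refine Finset.sum_subset Finset.subset_union_left fun U _ hU => ?_
    rw [Finsupp.notMem_support_iff.1 hU, map_zero, TensorProduct.zero_tmul]
  rw [h1, evalSeries_eq hc hn]
  have h2 : ∀ m ∈ monoIic n, MvPowerSeries.coeff m (powerSumSeries b l) =
      ∑ U ∈ T, MvPolynomial.coeff m (inCopy U (powerSum l)) • RatLie.of R (b U) := by
    intro m hm
    rw [coeff_powerSumSeries]
    refine finsum_eq_sum_of_support_subset _ fun U hU => ?_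
    refine Finset.mem_coe.2 (Finset.mem_union_right _ (Finset.mem_biUnion.2 ⟨m, hm, ?_⟩))
    rw [Set.Finite.mem_toFinset]
    exact fun h => hU (by simp only [h, zero_smul])
  have h3 : ∀ U, BigWitt.ghost l (wittCoord b z U) =
      ∑ m ∈ monoIic n, ((MvPolynomial.coeff m (inCopy U (powerSum l)) : ℤ) : A) * famPow c m := by
    intro U
    rw [hn.sum_coeff, BigWitt.ghost_eq_aeval, inCopy, MvPolynomial.aeval_rename]
    rfl
  have h4 : ∑ m ∈ monoIic n, famPow c m ⊗ₜ[ℤ] MvPowerSeries.coeff m (powerSumSeries b l) =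
      ∑ m ∈ monoIic n, ∑ U ∈ T,
        famPow c m ⊗ₜ[ℤ] (MvPolynomial.coeff m (inCopy U (powerSum l)) • RatLie.of R (b U)) :=
    Finset.sum_congr rfl fun m hm => by rw [h2 m hm, TensorProduct.tmul_sum]
  rw [h4, Finset.sum_comm]
  refine Finset.sum_congr rfl fun U _ => ?_
  rw [h3, TensorProduct.sum_tmul]
  refine Finset.sum_congr rfl fun m _ => ?_
  rw [← zsmul_eq_mul]
  exact TensorProduct.smul_tmul _ _ _

/-- Products of points correspond to products of values of the generating series. -/
theorem evalSeries_nbhd_mul (u v : formalNbhd R A) :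
    evalSeries (isFormalFamily_nbhdCoord b u) (genSeries b) *
      evalSeries (isFormalFamily_nbhdCoord b v) (genSeries b) =
        evalSeries (isFormalFamily_nbhdCoord b (u * v)) (genSeries b) := by
  refine evalSeries_genSeries_mul b _ _ _ fun l => ?_
  rw [← ghostTensor_nbhd, ← ghostTensor_nbhd, ← ghostTensor_nbhd, ← map_mul]
  rfl

end Coordinates

/-! ### Base change, and tensor products with the universal ring -/

section TensorMap

variable {τ A B S S' : Type*} [CommRing A] [CommRing B] [Ring S] [Ring S']

/-- The ring homomorphism `f ⊗ g`. -/
noncomputable def tensorMap (f : A →+* B) (g : S →+* S') : A ⊗[ℤ] S →+* B ⊗[ℤ] S' :=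
  (Algebra.TensorProduct.map f.toIntAlgHom g.toIntAlgHom).toRingHom

theorem tensorMap_tmul (f : A →+* B) (g : S →+* S') (a : A) (s : S) :
    tensorMap f g (a ⊗ₜ s) = f a ⊗ₜ g s := Algebra.TensorProduct.map_tmul _ _ _ _

theorem tensorMap_evalSeries (f : A →+* B) (g : S →+* S') {c : τ → A} {d : τ → B}
    (hc : IsFormalFamily c) (hd : IsFormalFamily d) (h : ∀ s, d s = f (c s)) (F : MvPowerSeries τ S) :
    tensorMap f g (evalSeries hc F) = evalSeries hd (MvPowerSeries.map g F) := by
  obtain rfl : d = fun s => f (c s) := funext h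
  obtain ⟨n, hn⟩ := hc.exists_bound
  rw [evalSeries_eq hc hn, evalSeries_eq hd (hn.map f), map_sum]
  refine Finset.sum_congr rfl fun m _ => ?_
  rw [tensorMap_tmul, map_famPow, MvPowerSeries.coeff_map]

variable {n : τ →₀ ℕ}

theorem tensorCoeff_tensorMap (g : S →+* S') (m : {m // m ≤ n}) (x : TruncRing n ⊗[ℤ] S) :
    tensorCoeff n S' m (tensorMap (RingHom.id _) g x) = g (tensorCoeff n S m x) := by
  induction x using TensorProduct.induction_on with
  | zero => simp only [map_zero]
  | add x y hx hy => simp only [map_add, hx, hy]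
  | tmul a s => rw [tensorMap_tmul, tensorCoeff_tmul, tensorCoeff_tmul, map_zsmul]; rfl

theorem truncRing_eq_sum (x : TruncRing n) :
    x = ∑ m ∈ (monoIic n).attach,
      truncCoeff n ⟨m.1, mem_monoIic.1 m.2⟩ x • famPow (truncVar n) m.1 := by
  classical
  refine truncRing_ext fun k => ?_
  rw [map_sum, Finset.sum_eq_single ⟨k.1, mem_monoIic.2 k.2⟩]
  · rw [map_zsmul, truncCoeff_famPow, if_pos rfl, smul_eq_mul, mul_one]
  · intro m _ hm
    rw [map_zsmul, truncCoeff_famPow, if_neg fun h => hm (Subtype.ext h), smul_zero]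
  · exact fun h => absurd (Finset.mem_attach _ _) h

theorem tensor_eq_sum (x : TruncRing n ⊗[ℤ] S) :
    x = ∑ m ∈ (monoIic n).attach,
      famPow (truncVar n) m.1 ⊗ₜ tensorCoeff n S ⟨m.1, mem_monoIic.1 m.2⟩ x := by
  induction x using TensorProduct.induction_on with
  | zero => simp only [map_zero, TensorProduct.tmul_zero, Finset.sum_const_zero]
  | add x y hx hy =>
    simp only [map_add, TensorProduct.tmul_add, Finset.sum_add_distrib]
    rw [← hx, ← hy]
  | tmul a s =>
    conv_lhs => rw [truncRing_eq_sum a, TensorProduct.sum_tmul]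
    refine Finset.sum_congr rfl fun m _ => ?_
    rw [tensorCoeff_tmul, TensorProduct.smul_tmul]

theorem tensorCoeff_ext {x y : TruncRing n ⊗[ℤ] S}
    (h : ∀ m, tensorCoeff n S m x = tensorCoeff n S m y) : x = y := by
  rw [tensor_eq_sum x, tensor_eq_sum y]
  simp only [h]

/-- The truncated ring is free over ℤ on the divisors of n, so the coefficients in S determine an
element of the tensor product. -/
theorem tensorMap_injective {g : S →+* S'} (hg : Function.Injective g) :
    Function.Injective (tensorMap (RingHom.id (TruncRing n)) g) := by
  intro x y h
  refine tensorCoeff_ext fun m => hg ?_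
  rw [← tensorCoeff_tensorMap, ← tensorCoeff_tensorMap, h]

end TensorMap

/-! ### The universal pair of formal families -/

section UniversalPair

variable {τ τ' A : Type*} [CommRing A]

theorem IsFormalFamily.comp {c : τ' → A} (hc : IsFormalFamily c) {g : τ → τ'}
    (hg : Function.Injective g) : IsFormalFamily fun s => c (g s) :=
  ⟨fun _ => hc.nilpotent _, hc.finite.preimage hg.injOn⟩

theorem famPow_sumElim (c : τ ⊕ τ' → A) (i : τ →₀ ℕ) (j : τ' →₀ ℕ) :
    famPow c (i.sumElim j) = famPow (fun s => c (Sum.inl s)) i * famPow (fun s => c (Sum.inr s)) j :=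
  Finsupp.prod_sumElim _ _ _

theorem sumElim_le_sumElim {i i' : τ →₀ ℕ} {j j' : τ' →₀ ℕ} :
    i.sumElim j ≤ i'.sumElim j' ↔ i ≤ i' ∧ j ≤ j' :=
  ⟨fun h => ⟨fun s => h (Sum.inl s), fun s => h (Sum.inr s)⟩,
    fun h => Sum.rec h.1 h.2⟩

theorem sumElim_inj {i i' : τ →₀ ℕ} {j j' : τ' →₀ ℕ} :
    i.sumElim j = i'.sumElim j' ↔ i = i' ∧ j = j' := by
  simp only [le_antisymm_iff, sumElim_le_sumElim]
  tauto

theorem FamBound.inl {c : τ ⊕ τ' → A} {i : τ →₀ ℕ} {j : τ' →₀ ℕ} (h : FamBound c (i.sumElim j)) :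
    FamBound (fun s => c (Sum.inl s)) i := fun m hm => by
  refine (sumElim_le_sumElim.1 (h (m.sumElim 0) ?_)).1
  rwa [famPow_sumElim, famPow_zero, mul_one]

theorem FamBound.inr {c : τ ⊕ τ' → A} {i : τ →₀ ℕ} {j : τ' →₀ ℕ} (h : FamBound c (i.sumElim j)) :
    FamBound (fun s => c (Sum.inr s)) j := fun m hm => by
  refine (sumElim_le_sumElim.1 (h (Finsupp.sumElim 0 m) ?_)).2
  rwa [famPow_sumElim, famPow_zero, one_mul]

/-- The two halves of the universal family involve disjoint variables, so the monomial (i, j) arises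
only as the product of i and j. -/
theorem tensorCoeff_evalSeries_mul {S : Type*} [Ring S] (i : τ →₀ ℕ) (j : τ' →₀ ℕ)
    (hc : IsFormalFamily fun s => truncVar (i.sumElim j) (Sum.inl s))
    (hd : IsFormalFamily fun s => truncVar (i.sumElim j) (Sum.inr s))
    (F : MvPowerSeries τ S) (G : MvPowerSeries τ' S) :
    tensorCoeff (i.sumElim j) S ⟨i.sumElim j, le_rfl⟩ (evalSeries hc F * evalSeries hd G) =
      MvPowerSeries.coeff i F * MvPowerSeries.coeff j G := by
  classical
  rw [evalSeries_eq hc famBound_truncVar.inl, evalSeries_eq hd famBound_truncVar.inr,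
    Finset.sum_mul_sum, ← Finset.sum_product', map_sum, Finset.sum_eq_single (i, j)]
  · rw [Algebra.TensorProduct.tmul_mul_tmul, ← famPow_sumElim, tensorCoeff_tmul, truncCoeff_famPow,
      if_pos rfl, one_smul]
  · rintro ⟨a, e⟩ _ hne
    rw [Algebra.TensorProduct.tmul_mul_tmul, ← famPow_sumElim, tensorCoeff_tmul, truncCoeff_famPow,
      if_neg, zero_smul]
    intro h
    exact hne (Prod.ext (sumElim_inj.1 h).1 (sumElim_inj.1 h).2)
  · intro h
    refine absurd ?_ h
    rw [Finset.mem_product]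
    exact ⟨mem_monoIic.2 (le_refl i), mem_monoIic.2 (le_refl j)⟩

end UniversalPair

/-! ### The lattice spanned by the coefficients of the generating series -/

section Lattice

variable {R I : Type*} [Ring R] (b : Module.Basis I ℤ R)

/-- Take points p and q whose coordinates are the two halves of the universal family. At the
monomial (i, j) the product of the two values of the generating series has the coefficient ξ_i ξ_j.
The value at p q has there an integral combination of the ξ_m, because the coordinates of p q lie in
a ring with integral coefficients. -/
theorem coeff_mul_coeff_mem_span (i j : I × ℕ+ →₀ ℕ) :
    MvPowerSeries.coeff i (genSeries b) * MvPowerSeries.coeff j (genSeries b) ∈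
      Submodule.span ℤ (Set.range fun m => MvPowerSeries.coeff m (genSeries b)) := by
  have ht := isFormalFamily_truncVar (n := i.sumElim j)
  obtain ⟨p, hp⟩ := exists_nbhdCoord_eq b (ht.comp Sum.inl_injective)
  obtain ⟨q, hq⟩ := exists_nbhdCoord_eq b (ht.comp Sum.inr_injective)
  have h := evalSeries_nbhd_mul b p q
  have h1 := tensorCoeff_evalSeries_mul i j (ht.comp Sum.inl_injective) (ht.comp Sum.inr_injective)
    (genSeries b) (genSeries b)
  simp only [← hp, ← hq] at h1
  rw [← h1, h]
  obtain ⟨n, hn⟩ := (isFormalFamily_nbhdCoord b (p * q)).exists_bound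
  rw [evalSeries_eq _ hn, map_sum]
  refine Submodule.sum_mem _ fun m _ => ?_
  rw [tensorCoeff_tmul]
  exact Submodule.smul_mem _ _ (Submodule.subset_span ⟨m, rfl⟩)

/-- The subring with `ℤ`-basis the coefficients of the generating series. -/
noncomputable def genRing : Subring (GQ R) where
  carrier := Submodule.span ℤ (Set.range fun m => MvPowerSeries.coeff m (genSeries b))
  zero_mem' := zero_mem _
  one_mem' := Submodule.subset_span ⟨0, coeff_genSeries_zero b⟩
  add_mem' := add_mem
  neg_mem' := neg_mem
  mul_mem' := by
    intro x y hx hy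
    induction hx, hy using Submodule.span_induction₂ with
    | mem_mem x y hx hy =>
      obtain ⟨i, rfl⟩ := hx
      obtain ⟨j, rfl⟩ := hy
      exact coeff_mul_coeff_mem_span b i j
    | zero_left y _ => rw [zero_mul]; exact zero_mem _
    | zero_right x _ => rw [mul_zero]; exact zero_mem _
    | add_left x y z _ _ _ hx hy => rw [add_mul]; exact add_mem hx hy
    | add_right x y z _ _ _ hx hy => rw [mul_add]; exact add_mem hx hy
    | smul_left r x y _ _ h => rw [smul_mul_assoc]; exact Submodule.smul_mem _ _ h
    | smul_right r x y _ _ h => rw [mul_smul_comm]; exact Submodule.smul_mem _ _ h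

theorem coeff_genSeries_mem (m : I × ℕ+ →₀ ℕ) :
    MvPowerSeries.coeff m (genSeries b) ∈ genRing b := Submodule.subset_span ⟨m, rfl⟩

/-- The generating series, with coefficients in the lattice. -/
noncomputable def genSeriesInt : MvPowerSeries (I × ℕ+) (genRing b) :=
  fun m => ⟨MvPowerSeries.coeff m (genSeries b), coeff_genSeries_mem b m⟩

theorem coe_coeff_genSeriesInt (m : I × ℕ+ →₀ ℕ) :
    ((MvPowerSeries.coeff m (genSeriesInt b) : genRing b) : GQ R) = MvPowerSeries.coeff m (genSeries b) := rfl

theorem linearIndependent_genSeriesInt :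
    LinearIndependent ℤ fun m => MvPowerSeries.coeff m (genSeriesInt b) := by
  classical
  rw [linearIndependent_iff']
  intro s g hg k hk
  obtain ⟨f, hf⟩ := exists_dual_functional b k
  have h1 := congrArg (fun x : genRing b => f (x : GQ R)) hg
  simp only [AddSubmonoidClass.coe_finsetSum, map_sum, ZeroMemClass.coe_zero, map_zero] at h1
  have h2 : ∀ m, f ((g m • MvPowerSeries.coeff m (genSeriesInt b) : genRing b) : GQ R) =
      g m * if k = m then 1 else 0 := by
    intro m
    rw [← hf m, ← coe_coeff_genSeriesInt, ← zsmul_eq_mul]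
    exact map_zsmul f (g m) _
  simp only [h2, mul_ite, mul_one, mul_zero, Finset.sum_ite_eq, hk, if_true] at h1
  exact_mod_cast h1

theorem span_genSeriesInt :
    ⊤ ≤ Submodule.span ℤ (Set.range fun m => MvPowerSeries.coeff m (genSeriesInt b)) := by
  rintro ⟨x, hx⟩ -
  induction hx using Submodule.span_induction with
  | mem x h =>
    obtain ⟨m, rfl⟩ := h
    exact Submodule.subset_span ⟨m, rfl⟩
  | zero => exact zero_mem _
  | add x y hx hy h1 h2 => exact add_mem h1 h2
  | smul r x hx h => exact Submodule.smul_mem _ r h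

/-- The coefficients of the generating series as a basis of the lattice. -/
noncomputable def genBasis : Module.Basis (I × ℕ+ →₀ ℕ) ℤ (genRing b) :=
  Module.Basis.mk (linearIndependent_genSeriesInt b) (span_genSeriesInt b)

theorem genBasis_apply (m : I × ℕ+ →₀ ℕ) :
    genBasis b m = MvPowerSeries.coeff m (genSeriesInt b) := Module.Basis.mk_apply _ _ _

theorem coe_genBasis (m : I × ℕ+ →₀ ℕ) :
    (genBasis b m : GQ R) = MvPowerSeries.coeff m (genSeries b) := by
  rw [genBasis_apply]; rfl

theorem genBasis_zero : genBasis b 0 = 1 :=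
  Subtype.ext ((coe_genBasis b 0).trans (coeff_genSeries_zero b))

end Lattice

/-! ### The universal property of pairs of points -/

section Points

variable {R I A B : Type*} [Ring R] [CommRing A] [CommRing B] (b : Module.Basis I ℤ R)

theorem formalNbhdMap_mul (f : A →+* B) (u v : formalNbhd R A) :
    formalNbhdMap R f (u * v) = formalNbhdMap R f u * formalNbhdMap R f v := by
  refine Subtype.ext (Units.ext ?_)
  exact map_mul (wittTensorMap R f) _ _

/-- The corresponding identity in A ⊗ `GQ R` loses the torsion of A. For the universal pair the base
ring is free, so the tensor product with the lattice embeds into the rational one and the identity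
descends. Any pair of points is an image of a universal one. -/
theorem evalSeries_genSeriesInt_mul (u v : formalNbhd R A) :
    evalSeries (isFormalFamily_nbhdCoord b u) (genSeriesInt b) *
      evalSeries (isFormalFamily_nbhdCoord b v) (genSeriesInt b) =
        evalSeries (isFormalFamily_nbhdCoord b (u * v)) (genSeriesInt b) := by
  obtain ⟨n, hn⟩ :=
    ((isFormalFamily_nbhdCoord b u).sumElim (isFormalFamily_nbhdCoord b v)).exists_bound
  have ht := isFormalFamily_truncVar (n := n)
  obtain ⟨p, hp⟩ := exists_nbhdCoord_eq b (ht.comp Sum.inl_injective)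
  obtain ⟨q, hq⟩ := exists_nbhdCoord_eq b (ht.comp Sum.inr_injective)
  have hp' : formalNbhdMap R (truncLift hn) p = u := nbhdCoord_injective b <| funext fun s => by
    rw [nbhdCoord_map, hp, truncLift_truncVar]; rfl
  have hq' : formalNbhdMap R (truncLift hn) q = v := nbhdCoord_injective b <| funext fun s => by
    rw [nbhdCoord_map, hq, truncLift_truncVar]; rfl
  have key : evalSeries (isFormalFamily_nbhdCoord b p) (genSeriesInt b) *
      evalSeries (isFormalFamily_nbhdCoord b q) (genSeriesInt b) =
        evalSeries (isFormalFamily_nbhdCoord b (p * q)) (genSeriesInt b) := by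
    refine tensorMap_injective (g := (genRing b).subtype) Subtype.val_injective ?_
    have e : ∀ w : formalNbhd R (TruncRing n), tensorMap (RingHom.id _) (genRing b).subtype
        (evalSeries (isFormalFamily_nbhdCoord b w) (genSeriesInt b)) =
          evalSeries (isFormalFamily_nbhdCoord b w) (genSeries b) := fun w =>
      tensorMap_evalSeries _ _ _ _ (fun _ => rfl) _
    rw [map_mul, e, e, e, evalSeries_nbhd_mul]
  have e : ∀ w : formalNbhd R (TruncRing n), tensorMap (truncLift hn) (RingHom.id _)
      (evalSeries (isFormalFamily_nbhdCoord b w) (genSeriesInt b)) =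
        evalSeries (isFormalFamily_nbhdCoord b (formalNbhdMap R (truncLift hn) w)) (genSeriesInt b) :=
    fun w => tensorMap_evalSeries _ _ _ _ (fun s => nbhdCoord_map b _ _ _) _
  have h := congrArg (tensorMap (truncLift hn) (RingHom.id (genRing b))) key
  rwa [map_mul, e, e, e, formalNbhdMap_mul, hp', hq'] at h

theorem evalSeries_genSeriesInt_one :
    evalSeries (isFormalFamily_nbhdCoord b (1 : formalNbhd R A)) (genSeriesInt b) = 1 := by
  show ∑ᶠ m, _ = _
  rw [finsum_eq_single _ 0]
  · rw [famPow_zero, ← genBasis_apply, genBasis_zero]; rfl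
  · intro m hm
    obtain ⟨s, hs⟩ := Finsupp.ne_iff.1 hm
    rw [famPow_eq_zero (s := s) _ hs, TensorProduct.zero_tmul]
    rw [nbhdCoord_one, zero_pow hs]

end Points

/-! ### The Hopf structure of the lattice -/

section Hopf

variable {R I : Type*} [Ring R] (b : Module.Basis I ℤ R)

/-- The antipode inverts the generating series, whose constant coefficient is 1. This gives S(ξ_m)
recursively from products S(ξ_i) ξ_j with i of smaller degree. -/
theorem antipodeLin_mem_genRing {x : GQ R} (hx : x ∈ genRing b) : antipodeLin R x ∈ genRing b := by
  classical
  have h : ∀ m : I × ℕ+ →₀ ℕ, antipodeLin R (MvPowerSeries.coeff m (genSeries b)) ∈ genRing b := by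
    intro m
    induction hd : m.degree using Nat.strong_induction_on generalizing m with
    | _ d ih =>
      have h1 := congrArg (MvPowerSeries.coeff m) (antipodeSeries_genSeries b).1
      rw [MvPowerSeries.coeff_mul, ← Finset.add_sum_erase _ _
        (Finset.HasAntidiagonal.mem_antidiagonal.2 (show ((m, 0) : _ × _).1 + ((m, 0) : _ × _).2 = m from
          add_zero m)), coeff_genSeries_zero, mul_one, coeff_antipodeSeries] at h1
      rw [eq_sub_of_add_eq h1]
      refine sub_mem ?_ (sum_mem fun p hp => ?_)
      · rw [MvPowerSeries.coeff_one]
        split_ifs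
        · exact one_mem _
        · exact zero_mem _
      · obtain ⟨h2, h3⟩ := Finset.mem_erase.1 hp
        have h4 := Finset.HasAntidiagonal.mem_antidiagonal.1 h3
        refine mul_mem (ih p.1.degree ?_ p.1 rfl) (coeff_genSeries_mem b _)
        have h5 : p.2 ≠ 0 := fun h0 => h2 (Prod.ext (by simpa [h0] using h4) h0)
        have h6 : p.2.degree ≠ 0 := fun h0 => h5 ((Finsupp.degree_eq_zero_iff _).1 h0)
        rw [← hd, ← h4, map_add]
        omega
  induction hx using Submodule.span_induction with
  | mem x h' => obtain ⟨m, rfl⟩ := h'; exact h m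
  | zero => rw [map_zero]; exact zero_mem _
  | add x y _ _ h1 h2 => rw [map_add]; exact add_mem h1 h2
  | smul r x _ h1 => rw [map_zsmul]; exact zsmul_mem h1 r

/-- The antipode of the lattice. -/
noncomputable def genAntipode : genRing b →ₗ[ℤ] genRing b :=
  AddMonoidHom.toIntLinearMap
    { toFun := fun x => ⟨antipodeLin R x, antipodeLin_mem_genRing b x.2⟩
      map_zero' := Subtype.ext (map_zero _)
      map_add' := fun _ _ => Subtype.ext (map_add _ _ _) }

open Classical in
/-- The comultiplication of the lattice. -/
noncomputable def genComul : @LinearMap ℤ ℤ _ _ (RingHom.id ℤ) (genRing b)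
    (genRing b ⊗[ℤ] genRing b) _ _ _ TensorProduct.instModule :=
  (genBasis b).constr ℤ fun m => ∑ p ∈ Finset.HasAntidiagonal.antidiagonal m,
    genBasis b p.1 ⊗ₜ[ℤ] genBasis b p.2

theorem genComul_genBasis [DecidableEq I] (m : I × ℕ+ →₀ ℕ) : genComul b (genBasis b m) =
    ∑ p ∈ Finset.HasAntidiagonal.antidiagonal m, genBasis b p.1 ⊗ₜ[ℤ] genBasis b p.2 := by
  rw [genComul, Module.Basis.constr_basis]
  congr!

open Classical in
/-- The counit of the lattice. -/
noncomputable def genCounit : genRing b →ₗ[ℤ] ℤ :=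
  (genBasis b).constr ℤ fun m => if m = 0 then 1 else 0

theorem genCounit_genBasis [DecidableEq I] (m : I × ℕ+ →₀ ℕ) :
    genCounit b (genBasis b m) = if m = 0 then 1 else 0 := by
  rw [genCounit, Module.Basis.constr_basis]
  congr!

theorem inclTensor_tmul (G : Subring (GQ R)) (x y : G) :
    inclTensor G (x ⊗ₜ y) = (x : GQ R) ⊗ₜ[ℚ] (y : GQ R) := rfl

theorem inclTensor_mul (G : Subring (GQ R)) (x y : G ⊗[ℤ] G) :
    inclTensor G (x * y) = inclTensor G x * inclTensor G y := by
  induction x using TensorProduct.induction_on with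
  | zero => rw [zero_mul, map_zero, zero_mul]
  | add x x' hx hx' => rw [add_mul, map_add, map_add, add_mul, hx, hx']
  | tmul p q =>
    induction y using TensorProduct.induction_on with
    | zero => rw [mul_zero, map_zero, mul_zero]
    | add x x' hx hx' => rw [mul_add, map_add, map_add, mul_add, hx, hx']
    | tmul r s =>
      rw [Algebra.TensorProduct.tmul_mul_tmul, inclTensor_tmul, inclTensor_tmul, inclTensor_tmul,
        Algebra.TensorProduct.tmul_mul_tmul]
      rfl

/-- Tensor products of dual functionals recover the integral coordinates from the rational tensor
square. Multiplicativity of the comultiplication can then be checked in the rational algebra. -/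
theorem inclTensor_injective : Function.Injective (inclTensor (genRing b)) := by
  classical
  intro x y h
  refine ((genBasis b).tensorProduct (genBasis b)).ext_elem fun k => ?_
  obtain ⟨f, hf⟩ := exists_dual_functional b k.1
  obtain ⟨g, hg⟩ := exists_dual_functional b k.2
  have key : ∀ z : genRing b ⊗[ℤ] genRing b,
      TensorProduct.lift (LinearMap.mul ℚ ℚ) (TensorProduct.map f g (inclTensor (genRing b) z)) =
        ((((genBasis b).tensorProduct (genBasis b)).repr z k : ℤ) : ℚ) := by
    intro z
    have hz : ((TensorProduct.lift (LinearMap.mul ℚ ℚ)).toAddMonoidHom.comp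
        ((TensorProduct.map f g).toAddMonoidHom.comp (inclTensor (genRing b)).toAddMonoidHom)).toIntLinearMap =
          ((Int.castAddHom ℚ).comp
            (((genBasis b).tensorProduct (genBasis b)).coord k).toAddMonoidHom).toIntLinearMap := by
      refine ((genBasis b).tensorProduct (genBasis b)).ext fun m => ?_
      show TensorProduct.lift (LinearMap.mul ℚ ℚ) (TensorProduct.map f g (inclTensor (genRing b)
        (((genBasis b).tensorProduct (genBasis b)) m))) =
          ((((genBasis b).tensorProduct (genBasis b)).repr
            (((genBasis b).tensorProduct (genBasis b)) m) k : ℤ) : ℚ)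
      rw [Module.Basis.repr_self, Module.Basis.tensorProduct_apply, inclTensor_tmul,
        TensorProduct.map_tmul, TensorProduct.lift.tmul, coe_genBasis, coe_genBasis, hf, hg,
        Finsupp.single_apply, LinearMap.mul_apply']
      have e : m = k ↔ k.1 = m.1 ∧ k.2 = m.2 := by
        rw [Prod.ext_iff, eq_comm, eq_comm (a := m.2)]
      by_cases h1 : k.1 = m.1 <;> by_cases h2 : k.2 = m.2 <;> simp [e, h1, h2]
    exact LinearMap.congr_fun hz z
  have h1 := congrArg (fun z => TensorProduct.lift (LinearMap.mul ℚ ℚ) (TensorProduct.map f g z)) h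
  simp only [key] at h1
  exact_mod_cast h1

theorem inclTensor_genComul (x : genRing b) : inclTensor (genRing b) (genComul b x) = comulQ R x := by
  classical
  have h : ((inclTensor (genRing b)).toAddMonoidHom.comp (genComul b).toAddMonoidHom).toIntLinearMap =
      (((comulQ R).toLinearMap.toAddMonoidHom).comp (genRing b).subtype.toAddMonoidHom).toIntLinearMap := by
    refine (genBasis b).ext fun m => ?_
    show inclTensor (genRing b) (genComul b (genBasis b m)) = comulQ R (genBasis b m : GQ R)
    rw [genComul_genBasis, map_sum, coe_genBasis, comulQ_coeff_genSeries]
    refine Finset.sum_congr rfl fun p _ => ?_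
    rw [inclTensor_tmul, coe_genBasis, coe_genBasis]
  exact LinearMap.congr_fun h x

theorem coe_genCounit (x : genRing b) : (genCounit b x : ℚ) = counitQ R x := by
  classical
  have h : ((Int.castAddHom ℚ).comp (genCounit b).toAddMonoidHom).toIntLinearMap =
      (((counitQ R).toLinearMap.toAddMonoidHom).comp (genRing b).subtype.toAddMonoidHom).toIntLinearMap := by
    refine (genBasis b).ext fun m => ?_
    show ((genCounit b (genBasis b m) : ℤ) : ℚ) = counitQ R (genBasis b m : GQ R)
    rw [genCounit_genBasis, coe_genBasis, counitQ_coeff_genSeries]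
    split_ifs <;> simp
  exact LinearMap.congr_fun h x

theorem sum_genAntipode_mul [DecidableEq I] (m : I × ℕ+ →₀ ℕ) :
    ∑ p ∈ Finset.HasAntidiagonal.antidiagonal m, genAntipode b (genBasis b p.1) * genBasis b p.2 =
      if m = 0 then 1 else 0 := by
  refine Subtype.ext ?_
  have h1 := congrArg (MvPowerSeries.coeff m) (antipodeSeries_genSeries b).1
  rw [MvPowerSeries.coeff_mul, MvPowerSeries.coeff_one] at h1
  rw [AddSubmonoidClass.coe_finsetSum, show (((if m = 0 then 1 else 0 : genRing b)) : GQ R) =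
    if m = 0 then 1 else 0 by split_ifs <;> rfl, ← h1]
  refine Finset.sum_congr rfl fun p _ => ?_
  rw [coeff_antipodeSeries, ← coe_genBasis, ← coe_genBasis]
  rfl

theorem sum_mul_genAntipode [DecidableEq I] (m : I × ℕ+ →₀ ℕ) :
    ∑ p ∈ Finset.HasAntidiagonal.antidiagonal m, genBasis b p.1 * genAntipode b (genBasis b p.2) =
      if m = 0 then 1 else 0 := by
  refine Subtype.ext ?_
  have h1 := congrArg (MvPowerSeries.coeff m) (antipodeSeries_genSeries b).2
  rw [MvPowerSeries.coeff_mul, MvPowerSeries.coeff_one] at h1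
  rw [AddSubmonoidClass.coe_finsetSum, show (((if m = 0 then 1 else 0 : genRing b)) : GQ R) =
    if m = 0 then 1 else 0 by split_ifs <;> rfl, ← h1]
  refine Finset.sum_congr rfl fun p _ => ?_
  rw [coeff_antipodeSeries, ← coe_genBasis, ← coe_genBasis]
  rfl

/-- The Hopf algebra structure of the lattice. -/
noncomputable def genHopf : HopfStructure (genRing b) where
  comul := genComul b
  counit := genCounit b
  coassoc := by
    classical
    refine (genBasis b).ext fun m => ?_
    simp only [LinearMap.comp_apply, LinearEquiv.coe_coe, genComul_genBasis, map_sum,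
      LinearMap.rTensor_tmul, LinearMap.lTensor_tmul, TensorProduct.sum_tmul, TensorProduct.tmul_sum,
      TensorProduct.assoc_tmul]
    rw [Finset.sum_sigma', Finset.sum_sigma']
    -- Both sides run over the decompositions of m into three monomials, grouped in two ways.
    refine Finset.sum_nbij' (fun x => ⟨(x.2.1, x.2.2 + x.1.2), (x.2.2, x.1.2)⟩)
      (fun x => ⟨(x.1.1 + x.2.1, x.2.2), (x.1.1, x.2.1)⟩) ?_ ?_ ?_ ?_ ?_
    · rintro ⟨⟨i, j⟩, ⟨k, l⟩⟩ h
      simp only [Finset.mem_sigma, Finset.HasAntidiagonal.mem_antidiagonal] at h ⊢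
      exact ⟨by rw [← add_assoc, h.2, h.1], trivial⟩
    · rintro ⟨⟨i, j⟩, ⟨k, l⟩⟩ h
      simp only [Finset.mem_sigma, Finset.HasAntidiagonal.mem_antidiagonal] at h ⊢
      exact ⟨by rw [add_assoc, h.2, h.1], trivial⟩
    · rintro ⟨⟨i, j⟩, ⟨k, l⟩⟩ h
      simp only [Finset.mem_sigma, Finset.HasAntidiagonal.mem_antidiagonal] at h ⊢
      rw [h.2]
    · rintro ⟨⟨i, j⟩, ⟨k, l⟩⟩ h
      simp only [Finset.mem_sigma, Finset.HasAntidiagonal.mem_antidiagonal] at h ⊢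
      rw [h.2]
    · rintro ⟨⟨i, j⟩, ⟨k, l⟩⟩ h
      rfl
  rTensor_counit_comp_comul := by
    classical
    refine (genBasis b).ext fun m => ?_
    simp only [LinearMap.comp_apply, genComul_genBasis, map_sum, LinearMap.rTensor_tmul,
      genCounit_genBasis, TensorProduct.mk_apply]
    rw [Finset.sum_eq_single (0, m)]
    · rw [if_pos rfl]
    · rintro ⟨i, j⟩ h hne
      rw [if_neg, TensorProduct.zero_tmul]
      rintro rfl
      exact hne (Prod.ext rfl (by simpa using h))
    · intro h
      exact absurd (Finset.HasAntidiagonal.mem_antidiagonal.2 (zero_add m)) h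
  lTensor_counit_comp_comul := by
    classical
    refine (genBasis b).ext fun m => ?_
    simp only [LinearMap.comp_apply, genComul_genBasis, map_sum, LinearMap.lTensor_tmul,
      genCounit_genBasis, TensorProduct.mk_apply, LinearMap.flip_apply]
    rw [Finset.sum_eq_single (m, 0)]
    · rw [if_pos rfl]
    · rintro ⟨i, j⟩ h hne
      rw [if_neg, TensorProduct.tmul_zero]
      rintro rfl
      exact hne (Prod.ext (by simpa using h) rfl)
    · intro h
      exact absurd (Finset.HasAntidiagonal.mem_antidiagonal.2 (add_zero m)) h
  counit_one := by
    refine Int.cast_injective (α := ℚ) ((coe_genCounit b 1).trans ?_)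
    rw [OneMemClass.coe_one, map_one, Int.cast_one]
  counit_mul x y := by
    refine Int.cast_injective (α := ℚ) ((coe_genCounit b (x * y)).trans ?_)
    rw [MulMemClass.coe_mul, map_mul (counitQ R), ← coe_genCounit, ← coe_genCounit, Int.cast_mul]
  comul_one := inclTensor_injective b <| by
    rw [inclTensor_genComul, OneMemClass.coe_one, map_one]
    rfl
  comul_mul x y := inclTensor_injective b <| by
    rw [inclTensor_mul, inclTensor_genComul, inclTensor_genComul, inclTensor_genComul,
      MulMemClass.coe_mul, map_mul]
  antipode := genAntipode b
  mul_antipode_rTensor_comul := by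
    classical
    refine (genBasis b).ext fun m => ?_
    simp only [LinearMap.comp_apply, genComul_genBasis, map_sum, LinearMap.rTensor_tmul,
      LinearMap.mul'_apply, genCounit_genBasis, sum_genAntipode_mul]
    split_ifs <;> simp
  mul_antipode_lTensor_comul := by
    classical
    refine (genBasis b).ext fun m => ?_
    simp only [LinearMap.comp_apply, genComul_genBasis, map_sum, LinearMap.lTensor_tmul,
      LinearMap.mul'_apply, genCounit_genBasis, sum_mul_genAntipode]
    split_ifs <;> simp

theorem genHopf_isRestriction : (genHopf b).IsRestriction where
  comul_eq := inclTensor_genComul b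
  counit_eq := coe_genCounit b
  antipode_eq _ := rfl

end Hopf

/-! ### Integral power series as functions on formal families -/

section IntEval

variable {τ A B S : Type*} [CommRing A] [CommRing B] [Ring S]

/-- The value of an integral power series at a formal family. -/
noncomputable def intEval (c : τ → A) (F : MvPowerSeries τ ℤ) : A :=
  ∑ᶠ m, MvPowerSeries.coeff m F • famPow c m

theorem FamBound.intEval_eq {c : τ → A} {n : τ →₀ ℕ} (h : FamBound c n) (F : MvPowerSeries τ ℤ) :
    intEval c F = ∑ m ∈ monoIic n, MvPowerSeries.coeff m F • famPow c m := by
  refine finsum_eq_sum_of_support_subset _ fun m hm => ?_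
  refine Finset.mem_coe.2 (mem_monoIic.2 (h m fun h0 => hm ?_))
  simp only [h0, smul_zero]

variable (A) in
/-- The contraction of the second tensor factor by a functional. -/
noncomputable def contract (φ : Module.Dual ℤ S) : A ⊗[ℤ] S →+ A :=
  (TensorProduct.lift (LinearMap.mk₂ ℤ (fun (a : A) (s : S) => φ s • a)
    (fun _ _ _ => smul_add _ _ _) (fun _ _ _ => smul_comm _ _ _)
    (fun _ _ _ => by rw [map_add, add_smul])
    (fun _ _ _ => by rw [map_smul, smul_assoc]))).toAddMonoidHom

theorem contract_tmul (φ : Module.Dual ℤ S) (a : A) (s : S) : contract A φ (a ⊗ₜ s) = φ s • a := rfl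

/-- The coefficientwise application of a functional. -/
noncomputable def dualSeries (φ : Module.Dual ℤ S) (F : MvPowerSeries τ S) : MvPowerSeries τ ℤ :=
  fun m => φ (MvPowerSeries.coeff m F)

theorem coeff_dualSeries (φ : Module.Dual ℤ S) (F : MvPowerSeries τ S) (m : τ →₀ ℕ) :
    MvPowerSeries.coeff m (dualSeries φ F) = φ (MvPowerSeries.coeff m F) := rfl

theorem contract_evalSeries (φ : Module.Dual ℤ S) {c : τ → A} (hc : IsFormalFamily c)
    (F : MvPowerSeries τ S) :
    contract A φ (evalSeries hc F) = intEval c (dualSeries φ F) := by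
  obtain ⟨n, hn⟩ := hc.exists_bound
  rw [evalSeries_eq hc hn, map_sum, hn.intEval_eq]
  rfl

theorem contract_id_mul (x y : A ⊗[ℤ] ℤ) : contract A LinearMap.id (x * y) =
    contract A LinearMap.id x * contract A LinearMap.id y := by
  induction x using TensorProduct.induction_on with
  | zero => rw [zero_mul, map_zero, zero_mul]
  | add x x' hx hx' => rw [add_mul, map_add, map_add, add_mul, hx, hx']
  | tmul p q =>
    induction y using TensorProduct.induction_on with
    | zero => rw [mul_zero, map_zero, mul_zero]
    | add x x' hx hx' => rw [mul_add, map_add, map_add, mul_add, hx, hx']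
    | tmul r s =>
      rw [Algebra.TensorProduct.tmul_mul_tmul, contract_tmul, contract_tmul, contract_tmul,
        smul_mul_smul_comm]
      rfl

theorem intEval_mul {c : τ → A} (hc : IsFormalFamily c) (F G : MvPowerSeries τ ℤ) :
    intEval c (F * G) = intEval c F * intEval c G := by
  have h : ∀ F : MvPowerSeries τ ℤ, intEval c F = contract A LinearMap.id (evalSeries hc F) :=
    fun F => (contract_evalSeries LinearMap.id hc F).symm
  rw [h, h, h, map_mul, contract_id_mul]

theorem intEval_add {c : τ → A} (hc : IsFormalFamily c) (F G : MvPowerSeries τ ℤ) :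
    intEval c (F + G) = intEval c F + intEval c G := by
  obtain ⟨n, hn⟩ := hc.exists_bound
  rw [hn.intEval_eq, hn.intEval_eq, hn.intEval_eq, ← Finset.sum_add_distrib]
  simp only [map_add, add_smul]

theorem intEval_one (c : τ → A) : intEval c (1 : MvPowerSeries τ ℤ) = 1 := by
  classical
  rw [intEval, finsum_eq_single _ 0]
  · rw [famPow_zero, MvPowerSeries.coeff_zero_one, one_smul]
  · intro m hm
    rw [MvPowerSeries.coeff_one, if_neg hm, zero_smul]

theorem map_intEval (f : A →+* B) {c : τ → A} (hc : IsFormalFamily c) (F : MvPowerSeries τ ℤ) :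
    f (intEval c F) = intEval (fun s => f (c s)) F := by
  obtain ⟨n, hn⟩ := hc.exists_bound
  rw [hn.intEval_eq, (hn.map f).intEval_eq, map_sum]
  simp only [map_zsmul, map_famPow]

end IntEval

/-! ### Functions on formal schemes with coordinates -/

/-- Natural coordinates on the `k`-tuples of points that identify them with the formal families indexed
by `τ`. -/
structure FormalCoords (R : Type u) [Ring R] (k : ℕ) (τ : Type v) where
  coord : ∀ {A : Type w} [CommRing A], (Fin k → formalNbhd R A) → τ → A
  formal : ∀ {A : Type w} [CommRing A] (p : Fin k → formalNbhd R A), IsFormalFamily (coord p)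
  map : ∀ {A B : Type w} [CommRing A] [CommRing B] (f : A →+* B) (p : Fin k → formalNbhd R A),
    coord (fun i => formalNbhdMap R f (p i)) = fun s => f (coord p s)
  injective : ∀ {A : Type w} [CommRing A], Function.Injective (coord (A := A))
  surjective : ∀ {A : Type w} [CommRing A] {c : τ → A}, IsFormalFamily c → ∃ p, coord p = c

namespace FormalCoords

variable {R : Type u} [Ring R] {k : ℕ} {τ : Type v} (D : FormalCoords.{u, v, w} R k τ)

/-- The function defined by a power series. -/
noncomputable def eval (F : MvPowerSeries τ ℤ) : FormalFun.{u, w} R k :=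
  ⟨fun _ p => intEval (D.coord p) F, fun A B f p => by
    rw [map_intEval f (D.formal p), ← D.map]⟩

theorem evalAt_eval (F : MvPowerSeries τ ℤ) {A : CommRingCat.{w}} (p : Fin k → formalNbhd R A) :
    evalAt (D.eval F) p = intEval (D.coord p) F := rfl

theorem eval_add (F G : MvPowerSeries τ ℤ) : D.eval (F + G) = D.eval F + D.eval G :=
  Subtype.ext (funext fun _ => funext fun p => intEval_add (D.formal p) F G)

theorem eval_mul (F G : MvPowerSeries τ ℤ) : D.eval (F * G) = D.eval F * D.eval G :=
  Subtype.ext (funext fun _ => funext fun p => intEval_mul (D.formal p) F G)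

theorem eval_one : D.eval 1 = 1 :=
  Subtype.ext (funext fun _ => funext fun p => intEval_one (D.coord p))

instance (n : τ →₀ ℕ) : Small.{w} (TruncRing n) := Countable.toSmall _

/-- The ring of the universal bounded family, in a given universe. -/
abbrev UnivRing (n : τ →₀ ℕ) : Type w := Shrink.{w} (TruncRing n)

/-- The universal bounded family. -/
noncomputable def univVar (n : τ →₀ ℕ) (s : τ) : UnivRing.{v, w} n :=
  (Shrink.ringEquiv (TruncRing n)).symm (truncVar n s)

/-- The coefficients of an element of the ring of the universal bounded family. -/
noncomputable def univCoeff {n : τ →₀ ℕ} (m : {m // m ≤ n}) : UnivRing.{v, w} n →+ ℤ :=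
  (truncCoeff n m).comp (Shrink.ringEquiv (TruncRing n)).toAddMonoidHom

theorem isFormalFamily_univVar (n : τ →₀ ℕ) : IsFormalFamily (univVar.{v, w} n) :=
  isFormalFamily_truncVar.map (Shrink.ringEquiv (TruncRing n)).symm.toRingHom

theorem famBound_univVar (n : τ →₀ ℕ) : FamBound (univVar.{v, w} n) n :=
  famBound_truncVar.map (Shrink.ringEquiv (TruncRing n)).symm.toRingHom

theorem univCoeff_famPow [DecidableEq τ] {n : τ →₀ ℕ} (m : {m // m ≤ n}) (j : τ →₀ ℕ) :
    univCoeff m (famPow (univVar.{v, w} n) j) = if j = m.1 then 1 else 0 := by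
  rw [← truncCoeff_famPow]
  show truncCoeff n m ((Shrink.ringEquiv (TruncRing n)).toRingHom (famPow (univVar n) j)) = _
  rw [map_famPow]
  congr 2
  funext s
  exact (Shrink.ringEquiv (TruncRing n)).apply_symm_apply _

theorem univCoeff_intEval {n : τ →₀ ℕ} (m : {m // m ≤ n}) (F : MvPowerSeries τ ℤ) :
    univCoeff m (intEval (univVar.{v, w} n) F) = MvPowerSeries.coeff m.1 F := by
  classical
  rw [(famBound_univVar n).intEval_eq, map_sum, Finset.sum_eq_single m.1]
  · rw [map_zsmul, univCoeff_famPow, if_pos rfl, smul_eq_mul, mul_one]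
  · intro j _ hj
    rw [map_zsmul, univCoeff_famPow, if_neg hj, smul_zero]
  · intro h
    exact absurd (mem_monoIic.2 m.2) h

theorem univRing_eq_sum {n : τ →₀ ℕ} (x : UnivRing.{v, w} n) :
    x = ∑ m ∈ (monoIic n).attach,
      univCoeff ⟨m.1, mem_monoIic.1 m.2⟩ x • famPow (univVar.{v, w} n) m.1 := by
  refine (Shrink.ringEquiv (TruncRing n)).injective ?_
  conv_lhs => rw [truncRing_eq_sum (Shrink.ringEquiv (TruncRing n) x)]
  rw [map_sum]
  refine Finset.sum_congr rfl fun m _ => ?_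
  rw [map_zsmul]
  congr 1
  have h := map_famPow (Shrink.ringEquiv (TruncRing n)).toRingHom (univVar.{v, w} n) m.1
  refine Eq.trans ?_ h.symm
  congr 1
  funext s
  exact ((Shrink.ringEquiv (TruncRing n)).apply_symm_apply _).symm

/-- The homomorphism from the ring of the universal family given by a bounded family. -/
noncomputable def univLift {A : Type w} [CommRing A] {c : τ → A} {n : τ →₀ ℕ} (hc : FamBound c n) :
    UnivRing.{v, w} n →+* A :=
  (truncLift hc).comp (Shrink.ringEquiv (TruncRing n)).toRingHom

theorem univLift_univVar {A : Type w} [CommRing A] {c : τ → A} {n : τ →₀ ℕ} (hc : FamBound c n)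
    (s : τ) : univLift hc (univVar n s) = c s := by
  show truncLift hc (Shrink.ringEquiv (TruncRing n) ((Shrink.ringEquiv (TruncRing n)).symm _)) = _
  rw [RingEquiv.apply_symm_apply, truncLift_truncVar]

/-- The point with coordinates the universal bounded family. -/
noncomputable def univPoint (n : τ →₀ ℕ) : Fin k → formalNbhd R (UnivRing.{v, w} n) :=
  (D.surjective (isFormalFamily_univVar n)).choose

theorem coord_univPoint (n : τ →₀ ℕ) : D.coord (D.univPoint n) = univVar n :=
  (D.surjective (isFormalFamily_univVar n)).choose_spec

theorem map_univPoint {A : Type w} [CommRing A] {p : Fin k → formalNbhd R A} {n : τ →₀ ℕ}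
    (h : FamBound (D.coord p) n) : (fun i => formalNbhdMap R (univLift h) (D.univPoint n i)) = p := by
  refine D.injective ?_
  rw [D.map, coord_univPoint]
  exact funext fun s => univLift_univVar h s

/-- The value at the universal family bounded by m has the m-th coefficient of the power series as
its own coefficient at m. -/
theorem eval_injective : Function.Injective D.eval := by
  intro F G h
  refine MvPowerSeries.ext fun m => ?_
  have h1 := congrArg (fun g : FormalFun.{u, w} R k =>
    univCoeff ⟨m, le_rfl⟩ (evalAt g (A := CommRingCat.of (UnivRing.{v, w} m)) (D.univPoint m))) h
  have h2 : ∀ F, univCoeff ⟨m, le_rfl⟩ (evalAt (D.eval F)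
      (A := CommRingCat.of (UnivRing.{v, w} m)) (D.univPoint m)) = MvPowerSeries.coeff m F := by
    intro F
    rw [evalAt_eval]
    refine Eq.trans ?_ (univCoeff_intEval ⟨m, le_rfl⟩ F)
    exact congrArg (fun c => univCoeff ⟨m, le_rfl⟩ (intEval c F)) (D.coord_univPoint m)
  exact (h2 F).symm.trans (h1.trans (h2 G))

/-- The coefficients of a function. -/
noncomputable def funCoeff (g : FormalFun.{u, w} R k) (m : τ →₀ ℕ) : ℤ :=
  univCoeff ⟨m, le_rfl⟩ (evalAt g (A := CommRingCat.of (UnivRing.{v, w} m)) (D.univPoint m))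

theorem evalAt_map (g : FormalFun.{u, w} R k) {A B : Type w} [CommRing A] [CommRing B] (f : A →+* B)
    (p : Fin k → formalNbhd R A) :
    evalAt g (A := CommRingCat.of B) (fun i => formalNbhdMap R f (p i)) =
      f (evalAt g (A := CommRingCat.of A) p) :=
  g.2 (CommRingCat.of A) (CommRingCat.of B) f p

/-- The Yoneda argument: a point with bound n is the image of the universal point with bound n, so
naturality makes the value at the universal point determine the value at every such point. -/
theorem evalAt_eq_sum (g : FormalFun.{u, w} R k) {A : Type w} [CommRing A]
    (p : Fin k → formalNbhd R A) {n : τ →₀ ℕ} (h : FamBound (D.coord p) n) :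
    evalAt g (A := CommRingCat.of A) p = ∑ m ∈ (monoIic n).attach,
      univCoeff ⟨m.1, mem_monoIic.1 m.2⟩
        (evalAt g (A := CommRingCat.of (UnivRing.{v, w} n)) (D.univPoint n)) •
          famPow (D.coord p) m.1 := by
  have h1 := evalAt_map g (univLift h) (D.univPoint n)
  rw [D.map_univPoint h] at h1
  rw [h1]
  conv_lhs => rw [univRing_eq_sum (evalAt g (A := CommRingCat.of (UnivRing.{v, w} n)) (D.univPoint n)),
    map_sum]
  refine Finset.sum_congr rfl fun m _ => ?_
  rw [map_zsmul, map_famPow]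
  congr 2
  funext s
  exact univLift_univVar h s

/-- The coefficients do not depend on the bound: the universal family for m is also bounded by every
larger n, and its value can be expanded with respect to n. -/
theorem univCoeff_evalAt (g : FormalFun.{u, w} R k) {n : τ →₀ ℕ} (m : {m // m ≤ n}) :
    univCoeff m (evalAt g (A := CommRingCat.of (UnivRing.{v, w} n)) (D.univPoint n)) =
      D.funCoeff g m.1 := by
  classical
  have hb : FamBound (D.coord (D.univPoint m.1)) n := by
    rw [coord_univPoint]
    exact (famBound_univVar m.1).mono m.2
  rw [funCoeff, D.evalAt_eq_sum g (D.univPoint m.1) hb, map_sum,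
    Finset.sum_eq_single ⟨m.1, mem_monoIic.2 m.2⟩]
  · rw [coord_univPoint, map_zsmul, univCoeff_famPow, if_pos rfl, smul_eq_mul, mul_one]
  · intro j _ hj
    rw [coord_univPoint, map_zsmul, univCoeff_famPow, if_neg fun h => hj (Subtype.ext h), smul_zero]
  · exact fun h => absurd (Finset.mem_attach _ _) h

/-- Since the coefficients at the various universal points are compatible, they form a single power
series, which then has the right value at every point. -/
theorem eval_surjective : Function.Surjective D.eval := by
  intro g
  refine ⟨fun m => D.funCoeff g m, Subtype.ext (funext fun A => funext fun p => ?_)⟩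
  obtain ⟨n, hn⟩ := (D.formal p).exists_bound
  refine Eq.trans (hn.intEval_eq _) (Eq.trans ?_ (D.evalAt_eq_sum g p hn).symm)
  rw [← Finset.sum_attach]
  refine Finset.sum_congr rfl fun m _ => ?_
  rw [univCoeff_evalAt]
  rfl

/-- The functions are the power series in the coordinates. -/
noncomputable def equiv : MvPowerSeries τ ℤ ≃+ FormalFun.{u, w} R k :=
  AddEquiv.ofBijective (AddMonoidHom.mk' D.eval D.eval_add) ⟨D.eval_injective, D.eval_surjective⟩

end FormalCoords

/-! ### Coordinates of points and of pairs of points -/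

section Coords

variable {R : Type u} [Ring R] {I : Type v} (b : Module.Basis I ℤ R)

/-- The coordinates of a point. -/
noncomputable def pointCoords : FormalCoords.{u, v, w} R 1 (I × ℕ+) where
  coord p := nbhdCoord b (p 0)
  formal p := isFormalFamily_nbhdCoord b (p 0)
  map f p := funext fun s => nbhdCoord_map b f (p 0) s
  injective := fun {_ _ p q} h => funext fun i => by
    rw [Subsingleton.elim i 0]; exact nbhdCoord_injective b h
  surjective hc := by
    obtain ⟨u, hu⟩ := exists_nbhdCoord_eq b hc
    exact ⟨fun _ => u, hu⟩

/-- The coordinates of a pair of points. -/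
noncomputable def pairCoords : FormalCoords.{u, v, w} R 2 ((I × ℕ+) ⊕ (I × ℕ+)) where
  coord p := Sum.elim (nbhdCoord b (p 0)) (nbhdCoord b (p 1))
  formal p := (isFormalFamily_nbhdCoord b (p 0)).sumElim (isFormalFamily_nbhdCoord b (p 1))
  map f p := funext fun s => by
    rcases s with s | s
    · exact nbhdCoord_map b f (p 0) s
    · exact nbhdCoord_map b f (p 1) s
  injective := fun {_ _ p q} h => funext fun i => by
    fin_cases i
    · exact nbhdCoord_injective b (funext fun s => congrFun h (Sum.inl s))
    · exact nbhdCoord_injective b (funext fun s => congrFun h (Sum.inr s))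
  surjective {A _ c} hc := by
    obtain ⟨u, hu⟩ := exists_nbhdCoord_eq b (hc.comp Sum.inl_injective)
    obtain ⟨v, hv⟩ := exists_nbhdCoord_eq b (hc.comp Sum.inr_injective)
    refine ⟨![u, v], funext fun s => ?_⟩
    rcases s with s | s
    · exact congrFun hu s
    · exact congrFun hv s

end Coords

/-! ### Leading monomials -/

section Lead

variable {τ V : Type*} [AddCommMonoid V] (wt : (τ →₀ ℕ) →+ V) (N : (τ →₀ ℕ) →+ ℕ)

/-- The polynomial has coefficient one at the monomial `e`, and all its other monomials have the same weight
and a greater value of `N`. -/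
structure IsLead (P : MvPolynomial τ ℤ) (e : τ →₀ ℕ) : Prop where
  coeff_self : MvPolynomial.coeff e P = 1
  of_coeff_ne_zero : ∀ m, MvPolynomial.coeff m P ≠ 0 → m ≠ e → wt m = wt e ∧ N e < N m

variable {wt N}

theorem IsLead.weight_eq {P : MvPolynomial τ ℤ} {e m : τ →₀ ℕ} (h : IsLead wt N P e)
    (hm : MvPolynomial.coeff m P ≠ 0) : wt m = wt e := by
  by_cases he : m = e
  · rw [he]
  · exact (h.of_coeff_ne_zero m hm he).1

theorem IsLead.le {P : MvPolynomial τ ℤ} {e m : τ →₀ ℕ} (h : IsLead wt N P e)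
    (hm : MvPolynomial.coeff m P ≠ 0) : N e ≤ N m := by
  by_cases he : m = e
  · rw [he]
  · exact (h.of_coeff_ne_zero m hm he).2.le

theorem IsLead.one : IsLead wt N (1 : MvPolynomial τ ℤ) 0 where
  coeff_self := MvPolynomial.coeff_zero_one
  of_coeff_ne_zero m hm h0 := by
    classical
    rw [MvPolynomial.coeff_one, if_neg (Ne.symm h0)] at hm
    exact absurd rfl hm

/-- N is additive and minimal at the leading monomials, so i + j = e + f forces i = e and j = f,
while any other product of monomials has a strictly larger N. -/
theorem IsLead.mul {P Q : MvPolynomial τ ℤ} {e f : τ →₀ ℕ} (hP : IsLead wt N P e)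
    (hQ : IsLead wt N Q f) : IsLead wt N (P * Q) (e + f) where
  coeff_self := by
    classical
    rw [MvPolynomial.coeff_mul, Finset.sum_eq_single (e, f), hP.coeff_self, hQ.coeff_self, one_mul]
    · rintro ⟨i, j⟩ hij hne
      by_contra h0
      have hi0 : MvPolynomial.coeff i P ≠ 0 := left_ne_zero_of_mul h0
      have hj0 : MvPolynomial.coeff j Q ≠ 0 := right_ne_zero_of_mul h0
      have hi := hP.of_coeff_ne_zero i hi0
      have hj := hQ.of_coeff_ne_zero j hj0
      have hi' := hP.le hi0
      have hj' := hQ.le hj0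
      have h1 : i + j = e + f := Finset.HasAntidiagonal.mem_antidiagonal.1 hij
      have h2 := congrArg N h1
      rw [map_add, map_add] at h2
      have hie : i = e := by
        by_contra h
        have := (hi h).2
        omega
      have hjf : j = f := by
        by_contra h
        have := (hj h).2
        omega
      exact hne (Prod.ext hie hjf)
    · intro h
      refine absurd ?_ h
      rw [Finset.HasAntidiagonal.mem_antidiagonal]
  of_coeff_ne_zero m hm hne := by
    classical
    rw [MvPolynomial.coeff_mul] at hm
    obtain ⟨⟨i, j⟩, hij, h0⟩ := Finset.exists_ne_zero_of_sum_ne_zero hm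
    obtain rfl : i + j = m := Finset.HasAntidiagonal.mem_antidiagonal.1 hij
    have hi : MvPolynomial.coeff i P ≠ 0 := left_ne_zero_of_mul h0
    have hj : MvPolynomial.coeff j Q ≠ 0 := right_ne_zero_of_mul h0
    rw [map_add, map_add, map_add, map_add, hP.weight_eq hi, hQ.weight_eq hj]
    refine ⟨rfl, ?_⟩
    by_cases hie : i = e
    · have hjf : j ≠ f := fun h => hne (by rw [hie, h])
      have h1 := (hQ.of_coeff_ne_zero j hj hjf).2
      have h2 := hP.le hi
      omega
    · have h1 := (hP.of_coeff_ne_zero i hi hie).2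
      have h2 := hQ.le hj
      omega

theorem IsLead.prod {ι : Type*} (s : Finset ι) {P : ι → MvPolynomial τ ℤ} {e : ι → τ →₀ ℕ}
    (h : ∀ i ∈ s, IsLead wt N (P i) (e i)) : IsLead wt N (∏ i ∈ s, P i) (∑ i ∈ s, e i) := by
  classical
  induction s using Finset.induction_on with
  | empty => exact IsLead.one
  | insert a s ha ih =>
    rw [Finset.prod_insert ha, Finset.sum_insert ha]
    exact (h a (Finset.mem_insert_self a s)).mul (ih fun i hi => h i (Finset.mem_insert_of_mem hi))

theorem IsLead.rename {τ' V' : Type*} [AddCommMonoid V'] {wt' : (τ' →₀ ℕ) →+ V'}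
    {N' : (τ' →₀ ℕ) →+ ℕ} {g : τ → τ'} (hg : Function.Injective g) {P : MvPolynomial τ ℤ}
    {e : τ →₀ ℕ} (h : IsLead wt N P e) (f : V → V')
    (hwt : ∀ m, wt' (m.mapDomain g) = f (wt m)) (hN : ∀ m, N' (m.mapDomain g) = N m) :
    IsLead wt' N' (MvPolynomial.rename g P) (e.mapDomain g) where
  coeff_self := by rw [MvPolynomial.coeff_rename_mapDomain _ hg, h.coeff_self]
  of_coeff_ne_zero m hm hne := by
    obtain ⟨u, rfl, hu⟩ := MvPolynomial.coeff_rename_ne_zero _ _ _ hm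
    obtain ⟨h1, h2⟩ := h.of_coeff_ne_zero u hu fun h0 => hne (by rw [h0])
    rw [hwt, hwt, hN, hN, h1]
    exact ⟨rfl, h2⟩

end Lead

/-! ### The leading monomials of Schur functions -/

section Rearrangement

/-- When the squares are expanded, only the cross term ∑ i c(π i) depends on π. By the rearrangement
inequality it is least when c ∘ π and i are oppositely ordered, and for strictly decreasing c this
forces π to be monotone, hence the identity. -/
theorem sum_sq_lt_of_perm {k : ℕ} {c : Fin k → ℤ} (hc : StrictAnti c) {π : Equiv.Perm (Fin k)}
    (hπ : π ≠ 1) : ∑ i, (c i + i) ^ 2 < ∑ i, (c (π i) + i) ^ 2 := by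
  have h1 : Antivary (fun i : Fin k => ((i : ℕ) : ℤ)) c := by
    intro i j hij
    exact Int.ofNat_le.2 (Fin.le_def.1 (hc.lt_iff_gt.1 hij).le)
  have h2 : ¬ Antivary (fun i : Fin k => ((i : ℕ) : ℤ)) (c ∘ π) := by
    intro h
    have hmono : StrictMono π := by
      intro i j hij
      by_contra hlt
      have hne : π i ≠ π j := fun h0 => hij.ne (π.injective h0)
      have h3 : π j < π i := lt_of_le_of_ne (not_lt.1 hlt) hne.symm
      have h4 : ((j : ℕ) : ℤ) ≤ ((i : ℕ) : ℤ) := h (hc h3)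
      have h5 : (i : ℕ) < j := hij
      omega
    refine hπ (Equiv.ext fun i => ?_)
    have := Subsingleton.elim (hmono.orderIsoOfSurjective π π.surjective) (OrderIso.refl (Fin k))
    exact congrArg (fun e : Fin k ≃o Fin k => e i) this
  have h3 := h1.sum_mul_lt_sum_mul_comp_perm_iff (σ := π) |>.2 h2
  have h4 : ∑ i, c (π i) ^ 2 = ∑ i, c i ^ 2 := Equiv.sum_comp π fun i => c i ^ 2
  have h5 : ∀ d : Fin k → ℤ, ∑ i, (d i + i) ^ 2 =
      ∑ i, d i ^ 2 + 2 * ∑ i : Fin k, ((i : ℕ) : ℤ) • d i + ∑ i : Fin k, ((i : ℕ) : ℤ) ^ 2 := by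
    intro d
    rw [Finset.mul_sum, ← Finset.sum_add_distrib, ← Finset.sum_add_distrib]
    exact Finset.sum_congr rfl fun i _ => by rw [smul_eq_mul]; ring
  rw [h5, h5 fun i => c (π i), h4]
  linarith

end Rearrangement

section Schur

/-- The degree of a monomial in the elementary symmetric functions. -/
noncomputable def symWeight : (ℕ+ →₀ ℕ) →+ ℕ := Finsupp.weight fun n : ℕ+ => (n : ℕ)

/-- The sum of the squares of the indices. -/
noncomputable def symSquare : (ℕ+ →₀ ℕ) →+ ℕ := Finsupp.weight fun n : ℕ+ => (n : ℕ) ^ 2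

theorem symWeight_single (n : ℕ+) : symWeight (Finsupp.single n 1) = n := by
  rw [symWeight, Finsupp.weight_single, one_smul]

theorem symSquare_single (n : ℕ+) : symSquare (Finsupp.single n 1) = (n : ℕ) ^ 2 := by
  rw [symSquare, Finsupp.weight_single, one_smul]

/-- The conventions for nonpositive indices fit: e₀ = 1 has weight 0, and for negative d there is no
monomial. All entries of the Jacobi–Trudi determinant are thereby treated alike. -/
theorem coeff_elemSym_ne_zero {d : ℤ} {m : ℕ+ →₀ ℕ} (h : MvPolynomial.coeff m (elemSym d) ≠ 0) :
    (symWeight m : ℤ) = d ∧ (symSquare m : ℤ) = d ^ 2 := by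
  classical
  rcases lt_trichotomy d 0 with hd | rfl | hd
  · simp [elemSym, hd.not_gt, hd.ne] at h
  · have h1 : elemSym 0 = 1 := by simp [elemSym]
    rw [h1, MvPolynomial.coeff_one] at h
    have : m = 0 := by
      by_contra h0
      rw [if_neg (Ne.symm h0)] at h
      exact h rfl
    subst this
    simp
  · lift d to ℕ using hd.le
    lift d to ℕ+ using (by exact_mod_cast hd)
    rw [elemSym_pnat, MvPolynomial.coeff_X] at h
    have : Finsupp.single d 1 = m := by
      by_contra h0
      rw [if_neg h0] at h
      exact h rfl
    subst this
    rw [symWeight_single, symSquare_single]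
    push_cast
    exact ⟨rfl, rfl⟩

theorem coeff_prod_elemSym_ne_zero {ι : Type*} (s : Finset ι) {d : ι → ℤ} {m : ℕ+ →₀ ℕ}
    (h : MvPolynomial.coeff m (∏ i ∈ s, elemSym (d i)) ≠ 0) :
    (symWeight m : ℤ) = ∑ i ∈ s, d i ∧ (symSquare m : ℤ) = ∑ i ∈ s, d i ^ 2 := by
  classical
  induction s using Finset.induction_on generalizing m with
  | empty =>
    have := coeff_elemSym_ne_zero (d := 0) (m := m) (by simpa [elemSym] using h)
    simpa using this
  | insert a s ha ih =>
    rw [Finset.prod_insert ha, MvPolynomial.coeff_mul] at h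
    obtain ⟨⟨i, j⟩, hij, h0⟩ := Finset.exists_ne_zero_of_sum_ne_zero h
    obtain rfl : i + j = m := Finset.HasAntidiagonal.mem_antidiagonal.1 hij
    obtain ⟨h1, h2⟩ := coeff_elemSym_ne_zero (m := i) (left_ne_zero_of_mul h0)
    obtain ⟨h3, h4⟩ := ih (m := j) (right_ne_zero_of_mul h0)
    rw [Finset.sum_insert ha, Finset.sum_insert ha, map_add, map_add, ← h2, ← h3, ← h4, ← h1]
    push_cast
    exact ⟨rfl, rfl⟩

theorem colLen_pos (μ : YoungDiagram) (i : Fin (μ.rowLen 0)) : 0 < μ.colLen i :=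
  YoungDiagram.mem_iff_lt_colLen.1 (YoungDiagram.mem_iff_lt_rowLen.2 i.2)

/-- The length of a column of a Young diagram. -/
def colPart (μ : YoungDiagram) (i : Fin (μ.rowLen 0)) : ℕ+ := ⟨μ.colLen i, colLen_pos μ i⟩

theorem coe_colPart (μ : YoungDiagram) (i : Fin (μ.rowLen 0)) :
    ((colPart μ i : ℕ+) : ℕ) = μ.colLen i := rfl

/-- The multiplicities of the columns of a Young diagram. -/
noncomputable def colMult (μ : YoungDiagram) : ℕ+ →₀ ℕ :=
  ∑ i : Fin (μ.rowLen 0), Finsupp.single (colPart μ i) 1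

theorem prod_elemSym_colLen (μ : YoungDiagram) :
    ∏ i : Fin (μ.rowLen 0), elemSym (μ.colLen i : ℤ) = MvPolynomial.monomial (colMult μ) 1 := by
  have h : ∀ i : Fin (μ.rowLen 0), elemSym (μ.colLen i : ℤ) =
      MvPolynomial.X (colPart μ i) := fun i => elemSym_pnat (colPart μ i)
  simp only [h]
  rw [colMult, MvPolynomial.monomial_sum_index, map_one, one_mul]
  rfl

/-- The term of π in the determinant is the product of the e_{c(π i) + i}, where c i = λ'ᵢ - i is
strictly decreasing. The sum of the indices is independent of π, whereas the sum of their squares is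
least for π = 1 alone, where the term is the product of the e_{λ'ᵢ}. -/
theorem isLead_schur (μ : YoungDiagram) : IsLead symWeight symSquare (schur μ) (colMult μ) := by
  set c : Fin (μ.rowLen 0) → ℤ := fun i => (μ.colLen i : ℤ) - i with hcdef
  have hc : StrictAnti c := by
    intro i j hij
    have h1 := μ.colLen_anti i j (Fin.le_def.1 hij.le)
    have h2 : (i : ℕ) < j := hij
    simp only [hcdef]
    omega
  have hci : ∀ i, c i + i = μ.colLen i := fun i => sub_add_cancel _ _
  have hdet : schur μ = ∑ π : Equiv.Perm (Fin (μ.rowLen 0)),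
      Equiv.Perm.sign π • ∏ i, elemSym (c (π i) + i) := by
    rw [schur, Matrix.det_apply]
    rfl
  have hone : ∏ i, elemSym (c ((1 : Equiv.Perm (Fin (μ.rowLen 0))) i) + i) =
      MvPolynomial.monomial (colMult μ) 1 := by
    rw [← prod_elemSym_colLen]
    exact Finset.prod_congr rfl fun i _ => by rw [Equiv.Perm.one_apply, hci]
  have hself : (symWeight (colMult μ) : ℤ) = ∑ i, (c i + i) ∧
      (symSquare (colMult μ) : ℤ) = ∑ i, (c i + i) ^ 2 := by
    refine coeff_prod_elemSym_ne_zero Finset.univ (d := fun i => c i + i) ?_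
    rw [show ∏ i, elemSym (c i + i) = MvPolynomial.monomial (colMult μ) 1 from hone,
      MvPolynomial.coeff_monomial, if_pos rfl]
    exact one_ne_zero
  have hlt : ∀ (π : Equiv.Perm (Fin (μ.rowLen 0))) (m : ℕ+ →₀ ℕ), π ≠ 1 →
      MvPolynomial.coeff m (∏ i, elemSym (c (π i) + i)) ≠ 0 →
        symWeight m = symWeight (colMult μ) ∧ symSquare (colMult μ) < symSquare m := by
    intro π m hπ hm
    obtain ⟨h1, h2⟩ := coeff_prod_elemSym_ne_zero Finset.univ hm
    have h3 := sum_sq_lt_of_perm hc hπ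
    rw [← h2, ← hself.2] at h3
    refine ⟨?_, by exact_mod_cast h3⟩
    have h4 : ∑ i, (c (π i) + i) = ∑ i, (c i + i) := by
      rw [Finset.sum_add_distrib, Finset.sum_add_distrib, Equiv.sum_comp π c]
    rw [h4, ← hself.1] at h1
    exact_mod_cast h1
  constructor
  · rw [hdet, MvPolynomial.coeff_sum, Finset.sum_eq_single 1]
    · rw [Equiv.Perm.sign_one, one_smul, hone, MvPolynomial.coeff_monomial, if_pos rfl]
    · intro π _ hπ
      rw [Units.smul_def, MvPolynomial.coeff_smul]
      by_contra h0
      exact (hlt π _ hπ (right_ne_zero_of_mul h0)).2.ne rfl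
    · exact fun h => absurd (Finset.mem_univ _) h
  · intro m hm hne
    rw [hdet, MvPolynomial.coeff_sum] at hm
    obtain ⟨π, _, h0⟩ := Finset.exists_ne_zero_of_sum_ne_zero hm
    rw [Units.smul_def, MvPolynomial.coeff_smul] at h0
    have h1 := right_ne_zero_of_mul h0
    refine hlt π m ?_ h1
    rintro rfl
    rw [hone, MvPolynomial.coeff_monomial, if_neg (Ne.symm hne)] at h1
    exact h1 rfl

theorem toMultiset_colMult (μ : YoungDiagram) :
    (Finsupp.toMultiset (colMult μ)).map (fun n : ℕ+ => (n : ℕ)) = (μ.transpose.rowLens : Multiset ℕ) := by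
  rw [colMult, Finsupp.toMultiset_sum]
  simp only [Finsupp.toMultiset_single, one_smul]
  rw [← Multiset.coe_mapAddMonoidHom, map_sum]
  simp only [Multiset.coe_mapAddMonoidHom, Multiset.map_singleton, coe_colPart]
  rw [YoungDiagram.rowLens, YoungDiagram.colLen_transpose]
  have h1 : (μ.transpose.rowLen : ℕ → ℕ) = μ.colLen := funext fun i => YoungDiagram.rowLen_transpose μ i
  rw [h1, Fin.sum_univ_eq_sum_range (fun i => ({μ.colLen i} : Multiset ℕ)), Finset.sum,
    ← Multiset.map_coe, Multiset.coe_range]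
  rw [Finset.range_val, ← Function.comp_def (fun x => ({x} : Multiset ℕ)) μ.colLen, ← Multiset.map_map,
    Multiset.sum_map_singleton]

theorem colMult_injective : Function.Injective colMult := by
  intro μ ν h
  have h1 := (toMultiset_colMult μ).symm.trans ((congrArg (fun m => (Finsupp.toMultiset m).map fun n : ℕ+ => (n : ℕ)) h).trans (toMultiset_colMult ν))
  have h2 : μ.transpose.rowLens = ν.transpose.rowLens :=
    (Multiset.coe_eq_coe.1 h1).eq_of_sortedGE μ.transpose.rowLens_sorted ν.transpose.rowLens_sorted
  exact YoungDiagram.transpose_eq_iff.1 (YoungDiagram.equivListRowLens.injective (Subtype.ext h2))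

/-- Every finite multiset of positive integers, sorted decreasingly, is the list of row lengths of a
diagram; its transpose has them as columns. -/
theorem colMult_surjective : Function.Surjective colMult := by
  intro m
  set L := ((Finsupp.toMultiset m).map (fun n : ℕ+ => (n : ℕ))).sort (· ≥ ·) with hL
  have hs : L.SortedGE := List.sortedGE_iff_pairwise.2 (Multiset.pairwise_sort _ _)
  have hpos : ∀ x ∈ L, 0 < x := by
    intro x hx
    rw [hL, Multiset.mem_sort] at hx
    obtain ⟨n, _, rfl⟩ := Multiset.mem_map.1 hx
    exact n.pos
  refine ⟨(YoungDiagram.ofRowLens L hs).transpose, ?_⟩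
  refine Multiset.toFinsupp.symm.injective (Multiset.map_injective PNat.coe_injective ?_)
  refine (toMultiset_colMult _).trans ?_
  rw [YoungDiagram.transpose_transpose, YoungDiagram.rowLens_ofRowLens_eq_self hpos,
    hL, Multiset.sort_eq]
  rfl

theorem colMult_bot : colMult ⊥ = 0 := by
  have h : (⊥ : YoungDiagram).rowLen 0 = 0 := by
    by_contra h
    exact YoungDiagram.notMem_bot _ (YoungDiagram.mem_iff_lt_rowLen.2 (Nat.pos_of_ne_zero h))
  rw [colMult]
  have : IsEmpty (Fin ((⊥ : YoungDiagram).rowLen 0)) := by rw [h]; infer_instance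
  exact Fintype.sum_empty _

end Schur

/-! ### Multipartitions and monomials -/

section MultiSchur

variable {I : Type*}

/-- The weight of a monomial, graded by the copies. -/
noncomputable def multiWeight : (I × ℕ+ →₀ ℕ) →+ (I →₀ ℕ) :=
  Finsupp.weight fun s : I × ℕ+ => Finsupp.single s.1 (s.2 : ℕ)

/-- The sum of the squares of the indices. -/
noncomputable def multiSquare : (I × ℕ+ →₀ ℕ) →+ ℕ :=
  Finsupp.weight fun s : I × ℕ+ => (s.2 : ℕ) ^ 2

/-- The leading monomial of the Schur function of a multipartition. -/
noncomputable def leadMono (μ : Multipartition I) : I × ℕ+ →₀ ℕ :=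
  ∑ U ∈ μ.2.toFinset, (colMult (μ.1 U)).mapDomain (Prod.mk U)

theorem isLead_multiSchur (μ : Multipartition I) :
    IsLead multiWeight multiSquare (multiSchur μ) (leadMono μ) := by
  refine IsLead.prod _ fun U _ => ?_
  refine (isLead_schur (μ.1 U)).rename (Prod.mk_right_injective U) (Finsupp.single U)
    (fun m => ?_) fun m => ?_
  · rw [multiWeight, symWeight, Finsupp.weight_apply, Finsupp.weight_apply, Finsupp.sum_mapDomain_index]
    · rw [Finsupp.sum, Finsupp.sum, Finsupp.single_finsetSum]
      simp
    · simp
    · intros; rw [add_smul]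
  · rw [multiSquare, symSquare, Finsupp.weight_apply, Finsupp.weight_apply, Finsupp.sum_mapDomain_index]
    · simp
    · intros; rw [add_smul]

theorem leadMono_apply (μ : Multipartition I) (U : I) (n : ℕ+) :
    leadMono μ (U, n) = colMult (μ.1 U) n := by
  classical
  rw [leadMono, Finsupp.finsetSum_apply, Finset.sum_eq_single U]
  · exact Finsupp.mapDomain_apply (Prod.mk_right_injective U) _ _
  · intro V _ hV
    refine Finsupp.mapDomain_of_notMem_range _ _ ?_
    rintro ⟨k, hk⟩
    exact hV (congrArg Prod.fst hk)
  · intro h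
    have : μ.1 U = ⊥ := by
      by_contra h0
      exact h (μ.2.mem_toFinset.2 h0)
    rw [this, colMult_bot, Finsupp.mapDomain_zero, Finsupp.zero_apply]

theorem leadMono_injective : Function.Injective (leadMono : Multipartition I → _) := by
  intro μ ν h
  refine Subtype.ext (funext fun U => colMult_injective (Finsupp.ext fun n => ?_))
  rw [← leadMono_apply, ← leadMono_apply, h]

theorem leadMono_surjective : Function.Surjective (leadMono : Multipartition I → _) := by
  classical
  intro m
  choose f hf using fun U => colMult_surjective (m.comapDomain (Prod.mk U) (Prod.mk_right_injective U).injOn)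
  have hfin : {U | f U ≠ ⊥}.Finite := by
    refine (m.support.image Prod.fst).finite_toSet.subset fun U hU => ?_
    by_contra h0
    refine hU (colMult_injective ?_)
    rw [hf, colMult_bot]
    ext n
    by_contra hn
    exact h0 (Finset.mem_coe.2 (Finset.mem_image.2 ⟨(U, n), Finsupp.mem_support_iff.2 hn, rfl⟩))
  refine ⟨(⟨f, hfin⟩ : Multipartition I), Finsupp.ext fun s => (leadMono_apply _ s.1 s.2).trans ?_⟩
  exact congrArg (fun g : ℕ+ →₀ ℕ => g s.2) (hf s.1)

/-- Multipartitions correspond to the monomials in the elementary symmetric functions. -/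
noncomputable def leadEquiv : Multipartition I ≃ (I × ℕ+ →₀ ℕ) :=
  Equiv.ofBijective leadMono ⟨leadMono_injective, leadMono_surjective⟩

theorem mul_le_multiWeight (m : I × ℕ+ →₀ ℕ) (s : I × ℕ+) : m s * s.2 ≤ multiWeight m s.1 := by
  classical
  rw [multiWeight, Finsupp.weight_apply, Finsupp.sum, Finsupp.finsetSum_apply]
  by_cases h : m s = 0
  · rw [h, zero_mul]; exact Nat.zero_le _
  · refine le_trans ?_ (Finset.single_le_sum (fun _ _ => Nat.zero_le _) (Finsupp.mem_support_iff.2 h))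
    simp

/-- The total degree would not do here, as it has infinite fibres for infinite I. The weight graded
by copies bounds everything: a variable (U, k) that occurs has k ≤ v U, and its exponent is at most
v U. -/
theorem finite_multiWeight_fibre (v : I →₀ ℕ) :
    {m : I × ℕ+ →₀ ℕ | multiWeight m = v}.Finite := by
  classical
  let n : I × ℕ+ →₀ ℕ := Finsupp.onFinset
    -- The upper end of the interval only has to exceed all values of v, so that the support is
    -- visibly finite.
    (v.support ×ˢ (Finset.Icc 1 (v.sum fun _ k => k).succPNat))
    (fun s => if (s.2 : ℕ) ≤ v s.1 then v s.1 else 0) fun s hs => by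
      have h1 : (s.2 : ℕ) ≤ v s.1 := by
        by_contra h; exact hs (if_neg h)
      have h2 : v s.1 ≠ 0 := by
        have := s.2.pos; omega
      rw [Finset.mem_product, Finsupp.mem_support_iff, Finset.mem_Icc]
      refine ⟨h2, one_le, ?_⟩
      have h3 : v s.1 ≤ v.sum fun _ k => k :=
        Finset.single_le_sum (f := fun a => v a) (fun _ _ => Nat.zero_le _) (Finsupp.mem_support_iff.2 h2)
      rw [← PNat.coe_le_coe, Nat.succPNat_coe]
      omega
  refine (monoIic n).finite_toSet.subset fun m hm => Finset.mem_coe.2 (mem_monoIic.2 fun s => ?_)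
  have h1 := mul_le_multiWeight m s
  rw [show multiWeight m = v from hm] at h1
  show m s ≤ if (s.2 : ℕ) ≤ v s.1 then v s.1 else 0
  by_cases h : m s = 0
  · rw [h]; exact Nat.zero_le _
  · have h2 : (s.2 : ℕ) ≤ v s.1 := (Nat.le_mul_of_pos_left _ (Nat.pos_of_ne_zero h)).trans h1
    rw [if_pos h2]
    exact (Nat.le_mul_of_pos_right _ s.2.pos).trans h1

/-- Only leading monomials of the same weight as m are possible. The sums over all multipartitions
in `IsZFamily` are therefore finite, and `finsum` never takes its default value. -/
theorem finite_coeff_multiSchur_ne_zero (m : I × ℕ+ →₀ ℕ) :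
    {μ : Multipartition I | MvPolynomial.coeff m (multiSchur μ) ≠ 0}.Finite := by
  refine ((finite_multiWeight_fibre (multiWeight m)).preimage leadMono_injective.injOn).subset ?_
  intro μ hμ
  exact ((isLead_multiSchur μ).weight_eq hμ).symm

end MultiSchur

/-! ### Unitriangular systems -/

/-- A unitriangular matrix with finite rows. -/
structure IsUnitriangular {M : Type*} (N : M → ℕ) (a : M → M → ℤ) : Prop where
  diag : ∀ m, a m m = 1
  lower : ∀ m f, a m f ≠ 0 → f ≠ m → N f < N m
  finite : ∀ m, {f | a m f ≠ 0}.Finite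

namespace IsUnitriangular

variable {M : Type*} {N : M → ℕ} {a : M → M → ℤ} (h : IsUnitriangular N a)
  {V : Type*} [AddCommGroup V]

include h in
theorem finsum_eq [DecidableEq M] (Z : M → V) (m : M) :
    ∑ᶠ f, a m f • Z f = Z m + ∑ f ∈ (h.finite m).toFinset.erase m, a m f • Z f := by
  rw [finsum_eq_sum_of_support_subset (s := (h.finite m).toFinset)]
  · rw [← Finset.add_sum_erase _ _ (show m ∈ (h.finite m).toFinset by
      rw [Set.Finite.mem_toFinset, Set.mem_ofPred_eq, h.diag]; exact one_ne_zero), h.diag, one_smul]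
  · intro f hf
    rw [Finset.mem_coe, Set.Finite.mem_toFinset]
    intro h0
    exact hf (by simp only [h0, zero_smul])

theorem lt_of_mem [DecidableEq M] {m f : M} (hf : f ∈ (h.finite m).toFinset.erase m) : N f < N m := by
  obtain ⟨h1, h2⟩ := Finset.mem_erase.1 hf
  exact h.lower m f ((h.finite m).mem_toFinset.1 h2) h1

open Classical in
/-- The solution of a unitriangular system. -/
noncomputable def solve (X : M → V) (m : M) : V :=
  -- The test on N always succeeds for these f; it is there to justify the recursion.
  X m - ∑ f ∈ (h.finite m).toFinset.erase m, if _hf : N f < N m then a m f • solve X f else 0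
termination_by N m

theorem solve_eq [DecidableEq M] (X : M → V) (m : M) :
    h.solve X m = X m - ∑ f ∈ (h.finite m).toFinset.erase m, a m f • h.solve X f := by
  rw [solve]
  congr 1
  refine Finset.sum_congr (by congr!) fun f hf => ?_
  rw [dif_pos (h.lt_of_mem hf)]

theorem finsum_solve (X : M → V) (m : M) : X m = ∑ᶠ f, a m f • h.solve X f := by
  classical
  rw [h.finsum_eq, solve_eq]
  abel

include h in
theorem unique {Z Z' : M → V} (hZ : ∀ m, ∑ᶠ f, a m f • Z f = ∑ᶠ f, a m f • Z' f) : Z = Z' := by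
  classical
  funext m
  induction hd : N m using Nat.strong_induction_on generalizing m with
  | _ d ih =>
    have h1 := hZ m
    rw [h.finsum_eq, h.finsum_eq, Finset.sum_congr rfl fun f hf => by
      rw [ih (N f) (hd ▸ h.lt_of_mem hf) f rfl]] at h1
    exact add_right_cancel h1

/-- The solution at m is the basis vector at m plus a combination of basis vectors with smaller N.
-/
theorem repr_solve (ξ : Module.Basis M ℤ V) (m k : M)
    (hk : (ξ.repr (h.solve ξ m) - Finsupp.single m 1 : M →₀ ℤ) k ≠ 0) : N k < N m := by
  classical
  induction hd : N m using Nat.strong_induction_on generalizing m with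
  | _ d ih =>
    rw [solve_eq, map_sub, Module.Basis.repr_self, sub_sub_cancel_left, map_sum, Finsupp.neg_apply,
      Finsupp.finsetSum_apply, neg_ne_zero] at hk
    obtain ⟨f, hf, h0⟩ := Finset.exists_ne_zero_of_sum_ne_zero hk
    have hlt := h.lt_of_mem hf
    rw [map_zsmul, Finsupp.smul_apply] at h0
    have h1 := right_ne_zero_of_mul h0
    by_cases hkf : k = f
    · rw [hkf, ← hd]; exact hlt
    · have h2 := ih (N f) (hd ▸ hlt) f (by
        rw [Finsupp.sub_apply, Finsupp.single_apply, if_neg (Ne.symm hkf), sub_zero]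
        exact h1) rfl
      omega

/-- In a relation, take an index i with nonzero coefficient and N maximal. No other term of the
relation involves the basis vector at i, and the solution at i has coefficient 1 there. -/
theorem linearIndependent_solve (ξ : Module.Basis M ℤ V) : LinearIndependent ℤ (h.solve ξ) := by
  classical
  rw [linearIndependent_iff']
  intro s g hg
  by_contra! hne
  obtain ⟨j, hj, hgj⟩ := hne
  obtain ⟨i, hi, hmax⟩ := Finset.exists_max_image (s.filter fun i => g i ≠ 0) N
    ⟨j, Finset.mem_filter.2 ⟨hj, hgj⟩⟩
  obtain ⟨his, hgi⟩ := Finset.mem_filter.1 hi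
  have h1 := congrArg (fun x => ξ.repr x i) hg
  simp only [map_sum, map_zsmul, Finsupp.finsetSum_apply, Finsupp.smul_apply, map_zero,
    Finsupp.zero_apply] at h1
  rw [Finset.sum_eq_single i] at h1
  · have h2 : ξ.repr (h.solve ξ i) i = 1 := by
      by_contra h0
      refine (h.repr_solve ξ i i ?_).ne rfl
      rw [Finsupp.sub_apply, Finsupp.single_eq_same]
      exact sub_ne_zero.2 h0
    rw [h2, smul_eq_mul, mul_one] at h1
    exact hgi h1
  · intro k hk hki
    by_contra h0
    have h2 := hmax k (Finset.mem_filter.2 ⟨hk, left_ne_zero_of_mul h0⟩)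
    have h3 := h.repr_solve ξ k i (by
      rw [Finsupp.sub_apply, Finsupp.single_apply, if_neg hki, sub_zero]
      exact right_ne_zero_of_mul h0)
    omega
  · exact fun h0 => absurd his h0

theorem span_solve (ξ : Module.Basis M ℤ V) : ⊤ ≤ Submodule.span ℤ (Set.range (h.solve ξ)) := by
  classical
  rw [← ξ.span_eq, Submodule.span_le]
  rintro _ ⟨m, rfl⟩
  rw [h.finsum_solve ξ m, h.finsum_eq]
  exact add_mem (Submodule.subset_span ⟨m, rfl⟩) (Submodule.sum_mem _ fun f _ =>
    Submodule.smul_mem _ _ (Submodule.subset_span ⟨f, rfl⟩))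

/-- The solution of a unitriangular system for a basis is a basis. -/
noncomputable def solveBasis (ξ : Module.Basis M ℤ V) : Module.Basis M ℤ V :=
  Module.Basis.mk (h.linearIndependent_solve ξ) (h.span_solve ξ)

theorem solveBasis_apply (ξ : Module.Basis M ℤ V) (m : M) : h.solveBasis ξ m = h.solve ξ m :=
  Module.Basis.mk_apply _ _ _

end IsUnitriangular

/-! ### The basis dual to the Schur functions -/

section SchurBasis

variable {I : Type*}

theorem isUnitriangular_multiSchur : IsUnitriangular (multiSquare : (I × ℕ+ →₀ ℕ) → ℕ)
    fun m f => MvPolynomial.coeff m (multiSchur (leadEquiv.symm f)) where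
  diag m := by
    have := (isLead_multiSchur (leadEquiv.symm m)).coeff_self
    rwa [show leadMono (leadEquiv.symm m) = m from leadEquiv.apply_symm_apply m] at this
  lower m f hm hne := by
    have := (isLead_multiSchur (leadEquiv.symm f)).of_coeff_ne_zero m hm
    rw [show leadMono (leadEquiv.symm f) = f from leadEquiv.apply_symm_apply f] at this
    exact (this hne.symm).2
  finite m := (finite_coeff_multiSchur_ne_zero m).preimage leadEquiv.symm.injective.injOn

theorem finsum_multiSchur_smul {V : Type*} [AddCommGroup V] (Z : Multipartition I → V)
    (m : I × ℕ+ →₀ ℕ) : ∑ᶠ μ, MvPolynomial.coeff m (multiSchur μ) • Z μ =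
      ∑ᶠ f, MvPolynomial.coeff m (multiSchur (leadEquiv.symm f)) • Z (leadEquiv.symm f) :=
  (finsum_comp_equiv leadEquiv.symm).symm

variable {R : Type*} [Ring R] (b : Module.Basis I ℤ R)

/-- The basis of the lattice dual to the Schur functions. -/
noncomputable def schurBasis : Module.Basis (Multipartition I) ℤ (genRing b) :=
  (isUnitriangular_multiSchur.solveBasis (genBasis b)).reindex leadEquiv.symm

theorem genBasis_eq_finsum (m : I × ℕ+ →₀ ℕ) :
    genBasis b m = ∑ᶠ μ, MvPolynomial.coeff m (multiSchur μ) • schurBasis b μ := by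
  rw [finsum_multiSchur_smul]
  simp only [schurBasis, Module.Basis.reindex_apply, Equiv.symm_symm, Equiv.apply_symm_apply,
    IsUnitriangular.solveBasis_apply]
  exact isUnitriangular_multiSchur.finsum_solve (genBasis b) m

theorem map_finsum_multiSchur {V W : Type*} [AddCommGroup V] [AddCommGroup W] (f : V →+ W)
    (Z : Multipartition I → V) (m : I × ℕ+ →₀ ℕ) :
    f (∑ᶠ μ, MvPolynomial.coeff m (multiSchur μ) • Z μ) =
      ∑ᶠ μ, MvPolynomial.coeff m (multiSchur μ) • f (Z μ) := by
  rw [AddMonoidHom.map_finsum f]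
  · simp only [map_zsmul]
  · refine (finite_coeff_multiSchur_ne_zero m).subset fun μ hμ h0 => hμ ?_
    simp only [h0, zero_smul]

theorem isZFamily_schurBasis : IsZFamily b fun μ => (schurBasis b μ : GQ R) := by
  intro m
  rw [← coe_genBasis, genBasis_eq_finsum]
  exact map_finsum_multiSchur (genRing b).subtype.toAddMonoidHom _ m

theorem IsZFamily.unique {Z Z' : Multipartition I → GQ R} (h : IsZFamily b Z) (h' : IsZFamily b Z') :
    Z = Z' := by
  have h1 : Z ∘ leadEquiv.symm = Z' ∘ leadEquiv.symm := by
    refine isUnitriangular_multiSchur.unique fun m => ?_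
    have h2 := (h m).symm.trans (h' m)
    rwa [finsum_multiSchur_smul, finsum_multiSchur_smul] at h2
  funext μ
  have := congrFun h1 (leadEquiv μ)
  simpa using this

end SchurBasis

/-! ### The dual of the lattice -/

section Dual

variable {R : Type u} [Ring R] {I : Type v} (b : Module.Basis I ℤ R)

/-- The full dual is the ring of power series. -/
noncomputable def dualEquiv : Module.Dual ℤ (genRing b) ≃+ MvPowerSeries (I × ℕ+) ℤ :=
  ((genBasis b).constr ℤ).symm.toAddEquiv

theorem coeff_dualEquiv (φ : Module.Dual ℤ (genRing b)) (m : I × ℕ+ →₀ ℕ) :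
    MvPowerSeries.coeff m (dualEquiv b φ) = φ (genBasis b m) := rfl

theorem dualEquiv_eq (φ : Module.Dual ℤ (genRing b)) :
    dualEquiv b φ = dualSeries φ (genSeriesInt b) := by
  ext m
  rw [coeff_dualEquiv, coeff_dualSeries, genBasis_apply]

theorem dualEquiv_counit : dualEquiv b (genHopf b).counit = 1 := by
  classical
  ext m
  rw [coeff_dualEquiv, MvPowerSeries.coeff_one]
  exact genCounit_genBasis b m

theorem dualTmul_tmul {G : Type*} [Ring G] (φ ψ : Module.Dual ℤ G) (x y : G) :
    dualTmul φ ψ (x ⊗ₜ y) = φ x * ψ y := rfl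

theorem dualEquiv_dualMul (φ ψ : Module.Dual ℤ (genRing b)) :
    dualEquiv b ((genHopf b).dualMul φ ψ) = dualEquiv b φ * dualEquiv b ψ := by
  classical
  ext m
  rw [coeff_dualEquiv, MvPowerSeries.coeff_mul]
  show dualTmul φ ψ (genComul b (genBasis b m)) = _
  rw [genComul_genBasis, map_sum]
  rfl

theorem coeff_dualEquiv_eq_finsum (φ : Module.Dual ℤ (genRing b)) (m : I × ℕ+ →₀ ℕ) :
    MvPowerSeries.coeff m (dualEquiv b φ) =
      ∑ᶠ μ : Multipartition I, φ (schurBasis b μ) * MvPolynomial.coeff m (multiSchur μ) := by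
  rw [coeff_dualEquiv, genBasis_eq_finsum]
  refine (map_finsum_multiSchur φ.toAddMonoidHom _ m).trans (finsum_congr fun μ => ?_)
  rw [smul_eq_mul, mul_comm]
  rfl

/-- The full dual of the tensor square is the ring of power series in two sets of variables. -/
noncomputable def dualPairEquiv :
    Module.Dual ℤ (genRing b ⊗[ℤ] genRing b) ≃+ MvPowerSeries ((I × ℕ+) ⊕ (I × ℕ+)) ℤ :=
  ((((genBasis b).tensorProduct (genBasis b)).reindex
    Finsupp.sumFinsuppEquivProdFinsupp.symm).constr ℤ).symm.toAddEquiv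

theorem coeff_dualPairEquiv (β : Module.Dual ℤ (genRing b ⊗[ℤ] genRing b)) (i j : I × ℕ+ →₀ ℕ) :
    MvPowerSeries.coeff (i.sumElim j) (dualPairEquiv b β) = β (genBasis b i ⊗ₜ genBasis b j) := by
  show β (((genBasis b).tensorProduct (genBasis b)).reindex
    Finsupp.sumFinsuppEquivProdFinsupp.symm (i.sumElim j)) = _
  rw [Module.Basis.reindex_apply, Equiv.symm_symm,
    show Finsupp.sumFinsuppEquivProdFinsupp (i.sumElim j) = (i, j) from
      Finsupp.sumFinsuppEquivProdFinsupp.apply_symm_apply (i, j),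
    Module.Basis.tensorProduct_apply]

/-- The full dual as functions on the formal neighbourhood. -/
noncomputable def pointEquiv : Module.Dual ℤ (genRing b) ≃+ FormalFun.{u, w} R 1 :=
  (dualEquiv b).trans (pointCoords b).equiv

/-- The full dual of the tensor square as functions on pairs of points. -/
noncomputable def pairEquiv :
    Module.Dual ℤ (genRing b ⊗[ℤ] genRing b) ≃+ FormalFun.{u, w} R 2 :=
  (dualPairEquiv b).trans (pairCoords b).equiv

theorem pointEquiv_counit : pointEquiv.{u, v, w} b (genHopf b).counit = 1 := by
  show (pointCoords b).eval (dualEquiv b (genHopf b).counit) = 1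
  rw [dualEquiv_counit, FormalCoords.eval_one]

theorem pointEquiv_dualMul (φ ψ : Module.Dual ℤ (genRing b)) :
    pointEquiv.{u, v, w} b ((genHopf b).dualMul φ ψ) = pointEquiv b φ * pointEquiv b ψ := by
  show (pointCoords b).eval (dualEquiv b ((genHopf b).dualMul φ ψ)) = _
  rw [dualEquiv_dualMul, FormalCoords.eval_mul]
  rfl

variable {A : CommRingCat.{w}}

theorem evalAt_pointEquiv (φ : Module.Dual ℤ (genRing b)) (p : formalNbhd R A) :
    evalAt (pointEquiv b φ) ![p] = intEval (nbhdCoord b p) (dualEquiv b φ) := rfl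

theorem evalAt_pointEquiv_eq_contract (φ : Module.Dual ℤ (genRing b)) (p : formalNbhd R A) :
    evalAt (pointEquiv b φ) ![p] =
      contract A φ (evalSeries (isFormalFamily_nbhdCoord b p) (genSeriesInt b)) := by
  rw [evalAt_pointEquiv, contract_evalSeries, dualEquiv_eq]

theorem FamBound.intEval_sumElim {τ τ' B : Type*} [CommRing B] {c : τ → B} {d : τ' → B} {m : τ →₀ ℕ}
    {n : τ' →₀ ℕ} (hc : FamBound c m) (hd : FamBound d n) (F : MvPowerSeries (τ ⊕ τ') ℤ) :
    intEval (Sum.elim c d) F = ∑ i ∈ monoIic m, ∑ j ∈ monoIic n,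
      MvPowerSeries.coeff (i.sumElim j) F • (famPow c i * famPow d j) := by
  have h1 : ∀ i j, famPow (Sum.elim c d) (i.sumElim j) = famPow c i * famPow d j := fun i j =>
    famPow_sumElim _ i j
  have h2 : FamBound (Sum.elim c d) (m.sumElim n) := by
    intro k hk
    obtain ⟨⟨i, j⟩, rfl⟩ := Finsupp.sumFinsuppEquivProdFinsupp.symm.surjective k
    have h3 : famPow (Sum.elim c d) (i.sumElim j) ≠ 0 := hk
    rw [h1] at h3
    exact sumElim_le_sumElim.2 ⟨hc i (left_ne_zero_of_mul h3), hd j (right_ne_zero_of_mul h3)⟩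
  rw [h2.intEval_eq, ← Finset.sum_product']
  refine (Finset.sum_nbij' (fun x => x.1.sumElim x.2) Finsupp.sumFinsuppEquivProdFinsupp
    ?_ ?_ ?_ ?_ ?_).symm
  · intro x hx
    obtain ⟨hx1, hx2⟩ := Finset.mem_product.1 hx
    exact mem_monoIic.2 (sumElim_le_sumElim.2 ⟨mem_monoIic.1 hx1, mem_monoIic.1 hx2⟩)
  · intro k hk
    obtain ⟨⟨i, j⟩, rfl⟩ := Finsupp.sumFinsuppEquivProdFinsupp.symm.surjective k
    rw [Equiv.apply_symm_apply]
    obtain ⟨hi, hj⟩ := sumElim_le_sumElim.1 (mem_monoIic.1 (show i.sumElim j ∈ _ from hk))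
    exact Finset.mem_product.2 ⟨mem_monoIic.2 hi, mem_monoIic.2 hj⟩
  · intro x _
    exact Finsupp.sumFinsuppEquivProdFinsupp.apply_symm_apply x
  · intro k _
    exact Finsupp.sumFinsuppEquivProdFinsupp.symm_apply_apply k
  · intro x _
    rw [h1]

theorem evalAt_pairEquiv (β : Module.Dual ℤ (genRing b ⊗[ℤ] genRing b)) (p q : formalNbhd R A)
    {m n : I × ℕ+ →₀ ℕ} (hm : FamBound (nbhdCoord b p) m) (hn : FamBound (nbhdCoord b q) n) :
    evalAt (pairEquiv b β) ![p, q] = ∑ i ∈ monoIic m, ∑ j ∈ monoIic n,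
      β (genBasis b i ⊗ₜ genBasis b j) • (famPow (nbhdCoord b p) i * famPow (nbhdCoord b q) j) := by
  refine (hm.intEval_sumElim hn (dualPairEquiv b β)).trans ?_
  simp only [coeff_dualPairEquiv]

theorem evalAt_pairEquiv_dualTmul (φ ψ : Module.Dual ℤ (genRing b)) (p q : formalNbhd R A) :
    evalAt (pairEquiv b (dualTmul φ ψ)) ![p, q] =
      evalAt (pointEquiv b φ) ![p] * evalAt (pointEquiv b ψ) ![q] := by
  obtain ⟨m, hm⟩ := (isFormalFamily_nbhdCoord b p).exists_bound
  obtain ⟨n, hn⟩ := (isFormalFamily_nbhdCoord b q).exists_bound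
  rw [evalAt_pairEquiv b _ p q hm hn, evalAt_pointEquiv, evalAt_pointEquiv, hm.intEval_eq,
    hn.intEval_eq, Finset.sum_mul_sum]
  refine Finset.sum_congr rfl fun i _ => Finset.sum_congr rfl fun j _ => ?_
  rw [dualTmul_tmul, coeff_dualEquiv, coeff_dualEquiv, smul_mul_smul_comm]

theorem exists_finset_evalAt_pairEquiv (p q : formalNbhd R A) :
    ∃ s : Finset (genRing b ⊗[ℤ] genRing b), ∀ β : Module.Dual ℤ (genRing b ⊗[ℤ] genRing b),
      (∀ x ∈ s, β x = 0) → evalAt (pairEquiv b β) ![p, q] = 0 := by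
  classical
  obtain ⟨m, hm⟩ := (isFormalFamily_nbhdCoord b p).exists_bound
  obtain ⟨n, hn⟩ := (isFormalFamily_nbhdCoord b q).exists_bound
  refine ⟨(monoIic m ×ˢ monoIic n).image fun x => genBasis b x.1 ⊗ₜ genBasis b x.2, fun β hβ => ?_⟩
  rw [evalAt_pairEquiv b _ p q hm hn]
  refine Finset.sum_eq_zero fun i hi => Finset.sum_eq_zero fun j hj => ?_
  rw [hβ _ (Finset.mem_image.2 ⟨(i, j), Finset.mem_product.2 ⟨hi, hj⟩, rfl⟩), zero_smul]

/-- Contraction of G(p) G(q) = G(p q) with φ: the left side becomes ∑ φ(ξ_i ξ_j) times the monomials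
of p and q, which is the comultiplication of φ evaluated at the pair. -/
theorem evalAt_pairEquiv_dualComul (φ : Module.Dual ℤ (genRing b)) (p q : formalNbhd R A) :
    evalAt (pairEquiv b (dualComul φ)) ![p, q] = evalAt (pointEquiv b φ) ![p * q] := by
  obtain ⟨m, hm⟩ := (isFormalFamily_nbhdCoord b p).exists_bound
  obtain ⟨n, hn⟩ := (isFormalFamily_nbhdCoord b q).exists_bound
  rw [evalAt_pairEquiv b _ p q hm hn, evalAt_pointEquiv_eq_contract, ← evalSeries_genSeriesInt_mul,
    evalSeries_eq _ hm, evalSeries_eq _ hn, Finset.sum_mul_sum, map_sum]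
  refine Finset.sum_congr rfl fun i _ => ?_
  rw [map_sum]
  refine Finset.sum_congr rfl fun j _ => ?_
  rw [Algebra.TensorProduct.tmul_mul_tmul, contract_tmul, genBasis_apply, genBasis_apply]
  rfl

theorem evalAt_pointEquiv_one (φ : Module.Dual ℤ (genRing b)) :
    evalAt (pointEquiv b φ) ![(1 : formalNbhd R A)] = ((φ 1 : ℤ) : A) := by
  rw [evalAt_pointEquiv_eq_contract, evalSeries_genSeriesInt_one, Algebra.TensorProduct.one_def,
    contract_tmul, zsmul_eq_mul, mul_one]

/-- Applied coefficientwise, the antipode gives a left inverse of the generating series, whose value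
at p is a left inverse of G(p). By multiplicativity the value of the series at p⁻¹ is a right
inverse, so the two coincide. -/
theorem evalAt_pointEquiv_dualAntipode (φ : Module.Dual ℤ (genRing b)) (p : formalNbhd R A) :
    evalAt (pointEquiv b ((genHopf b).dualAntipode φ)) ![p] = evalAt (pointEquiv b φ) ![p⁻¹] := by
  classical
  let F : MvPowerSeries (I × ℕ+) (genRing b) :=
    fun m => genAntipode b (MvPowerSeries.coeff m (genSeriesInt b))
  have hF : F * genSeriesInt b = 1 := by
    ext m : 1
    rw [MvPowerSeries.coeff_mul, MvPowerSeries.coeff_one, ← sum_genAntipode_mul b m]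
    refine Finset.sum_congr rfl fun x _ => ?_
    rw [genBasis_apply, genBasis_apply]
    rfl
  have h1 : evalSeries (isFormalFamily_nbhdCoord b p) F =
      evalSeries (isFormalFamily_nbhdCoord b p⁻¹) (genSeriesInt b) := by
    refine left_inv_eq_right_inv
      (a := evalSeries (isFormalFamily_nbhdCoord b p) (genSeriesInt b)) ?_ ?_
    · rw [← map_mul, hF, map_one]
    · rw [evalSeries_genSeriesInt_mul]
      simp only [mul_inv_cancel]
      exact evalSeries_genSeriesInt_one b
  rw [evalAt_pointEquiv_eq_contract, evalAt_pointEquiv_eq_contract, ← h1, contract_evalSeries,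
    contract_evalSeries]
  rfl

end Dual

/-- The test rings range over an arbitrary universe `w`, unrelated to those of R and I; this is
possible because the universal truncated rings are countable. -/
theorem theorem9p7 {R : Type u} [Ring R] {I : Type v} (b : Module.Basis I ℤ R)
    (i₁ : I) (hb : b i₁ = 1) :
    -- the family `Z_λ` defined by the generating series
    ∃ Z : Multipartition I → GQ R, IsZFamily b Z ∧ (∀ Z', IsZFamily b Z' → Z' = Z) ∧
    -- its `ℤ`-span is a ring `G` with basis `Z_λ`, and a Hopf algebra
    ∃ (G : Subring (GQ R)) (ζ : Module.Basis (Multipartition I) ℤ G) (h : HopfStructure G),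
      (∀ μ, (ζ μ : GQ R) = Z μ) ∧ h.IsRestriction ∧
    -- the full dual of `G` is the ring of power series in the `eₙ^{(U)}`
    ∃ Φ : Module.Dual ℤ G ≃+ MvPowerSeries (I × ℕ+) ℤ,
      Φ h.counit = 1 ∧
      (∀ φ ψ, Φ (h.dualMul φ ψ) = Φ φ * Φ ψ) ∧
      (∀ φ m, MvPowerSeries.coeff m (Φ φ) =
        ∑ᶠ μ : Multipartition I, φ (ζ μ) * MvPolynomial.coeff m (multiSchur μ)) ∧
    -- the full dual of `G` is the Hopf algebra of functions on the formal neighbourhood of the identity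
    ∃ (Ψ : Module.Dual ℤ G ≃+ FormalFun.{u, w} R 1)
      (Ψ₂ : Module.Dual ℤ (G ⊗[ℤ] G) ≃+ FormalFun.{u, w} R 2),
      -- `Ψ` is a ring isomorphism, given by evaluation of power series at the coordinates
      Ψ h.counit = 1 ∧
      (∀ φ ψ, Ψ (h.dualMul φ ψ) = Ψ φ * Ψ ψ) ∧
      (∀ φ (A : CommRingCat.{w}) (p : formalNbhd R A), evalAt (Ψ φ) ![p] =
        ∑ᶠ m : I × ℕ+ →₀ ℕ, MvPowerSeries.coeff m (Φ φ) • m.prod fun s k => nbhdCoord b p s ^ k) ∧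
      -- `Ψ₂` is the completed tensor square of `Ψ`
      (∀ φ ψ (A : CommRingCat.{w}) (p q : formalNbhd R A),
        evalAt (Ψ₂ (dualTmul φ ψ)) ![p, q] = evalAt (Ψ φ) ![p] * evalAt (Ψ ψ) ![q]) ∧
      (∀ (A : CommRingCat.{w}) (p q : formalNbhd R A), ∃ s : Finset (G ⊗[ℤ] G),
        ∀ β : Module.Dual ℤ (G ⊗[ℤ] G), (∀ x ∈ s, β x = 0) → evalAt (Ψ₂ β) ![p, q] = 0) ∧
      -- comultiplication, counit and antipode correspond to product, unit and inverse of points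
      (∀ φ (A : CommRingCat.{w}) (p q : formalNbhd R A),
        evalAt (Ψ₂ (dualComul φ)) ![p, q] = evalAt (Ψ φ) ![p * q]) ∧
      (∀ φ (A : CommRingCat.{w}), evalAt (Ψ φ) ![(1 : formalNbhd R A)] = ((φ 1 : ℤ) : A)) ∧
      (∀ φ (A : CommRingCat.{w}) (p : formalNbhd R A),
        evalAt (Ψ (h.dualAntipode φ)) ![p] = evalAt (Ψ φ) ![p⁻¹]) := by
  refine ⟨fun μ => (schurBasis b μ : GQ R), isZFamily_schurBasis b,
    fun Z' h => h.unique b (isZFamily_schurBasis b), genRing b, schurBasis b, genHopf b,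
    fun _ => rfl, genHopf_isRestriction b, dualEquiv b, dualEquiv_counit b, dualEquiv_dualMul b,
    coeff_dualEquiv_eq_finsum b, pointEquiv b, pairEquiv b, pointEquiv_counit b,
    pointEquiv_dualMul b, fun _ _ _ => rfl, fun φ ψ A p q => evalAt_pairEquiv_dualTmul b φ ψ p q,
    fun A p q => exists_finset_evalAt_pairEquiv b p q,
    fun φ A p q => evalAt_pairEquiv_dualComul b φ p q, fun φ A => evalAt_pointEquiv_one b φ,
    fun φ A p => evalAt_pointEquiv_dualAntipode b φ p⟩
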